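/- Let $\ell\ge 0$ be an integer and $q\in[0,1)$. Let $C(S_q^{2\ell+1})$ be the universal unital $C^*$-algebra generated by $z_1,\dots,z_{\ell+1}$ with the relations $$z_iz_j=q\,z_jz_i\ (j<i),\qquad z_i^*z_j=q\,z_jz_i^*\ (i\ne j),\qquad z_iz_i^*-z_i^*z_i+(1-q^2)\sum_{k>i}z_kz_k^*=0,\qquad \sum_{i=1}^{\ell+1}z_iz_i^*=1 .$$ Put $\mathcal H_\ell=\ell_2(\mathbb N)^{\otimes\ell}\otimes\ell_2(\mathbb Z)$. Let $N e_n=ne_n$ and let $S e_n=e_{n-1}$ be the left shift (on $\ell_2(\mathbb N)$, with $Se_0=0$, or on $\ell_2(\mathbb Z)$), and let $p_0=|e_0\rangle\langle e_0|$. Let $$Y_{k,q}=Y_{k,q}^{(\ell+1)}=(q^N)^{\otimes(k-1)}\otimes\sqrt{1-q^{2N}}\,S^*\otimes I^{\otimes(\ell+1-k)}\ (1\le k\le\ell),\qquad Y_{\ell+1,q}=Y_{\ell+1,q}^{(\ell+1)}=(q^N)^{\otimes\ell}\otimes S^*,$$ where $q^N=p_0$ for $q=0$. Let $\pi_\ell:C(S_q^{2\ell+1})\to\mathcal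 L(\mathcal H_\ell)$ be the representation with $\pi_\ell(z_k)=Y_{k,q}$, and let $A_\ell=\pi_\ell(C(S_q^{2\ell+1}))$. Define subspaces $\mathcal A_\ell^\infty\subset\mathcal L(\mathcal H_\ell)$ with seminorms $\|\cdot\|_m$, $m\in\mathbb N$, by recursion on $\ell$. The algebra $\mathcal A_0^\infty$ consists of all $\sum_{n\in\mathbb Z}a_n\mathbf z^n$ with $(a_n)$ rapidly decreasing, where $\mathbf z=S^*$ on $\ell_2(\mathbb Z)$, and $\|\sum_n a_n\mathbf z^n\|_m=\sum_n(1+|n|)^m|a_n|$. For $\ell\ge1$ let $\alpha_1=(Y_{1,0}^{(\ell+1)})^*=S\otimes I$; then $\mathcal A_\ell^\infty$ consists of all $$a=\sum_{j,k\in\mathbb N}\alpha_1^{*j}(p_0\otimes a_{jk})\alpha_1^k+\sum_{k\ge0}\lambda_k\alpha_1^k+\sum_{k>0}\lambda_{-k}\alpha_1^{*k}$$ with $a_{jk}\in\mathcal A_{\ell-1}^\infty$, $\sum_{j,k}(1+j+k)^n\|a_{jk}\|_m<\infty$ for all $n,m\in\mathbb N$, and $(\lambda_k)_{k\in\mathbb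 Z}$ rapidly decreasing, and $$\|a\|_m=\max_{r,s\le m}\sum_{j,k}(1+j+k)^r\|a_{jk}\|_s+\sum_{k\in\mathbb Z}(1+|k|)^m|\lambda_k| .$$ **Proposition.** $\mathcal A_\ell^\infty$ is a dense $*$-subalgebra of $A_\ell$. With the seminorms $\|\cdot\|_m$ it is a Fréchet $*$-algebra (a complete Hausdorff locally convex space with jointly continuous product and continuous involution) whose inclusion in $A_\ell$ is continuous. It is closed under holomorphic functional calculus in $A_\ell$: if $a\in\mathcal A_\ell^\infty$ and $f$ is holomorphic in an open neighbourhood $U$ of the spectrum of $a$ in $A_\ell$, then $f(a)=\frac1{2\pi i}\oint_\Gamma f(\lambda)(\lambda-a)^{-1}\,d\lambda\in\mathcal A_\ell^\infty$, where $\Gamma$ is a cycle in $U\setminus\operatorname{spec}(a)$ with winding number $1$ around every point of $\operatorname{spec}(a)$ and $0$ around every point outside $U$. Moreover $Y_{1,q},\dots,Y_{\ell+1,q}\in\mathcal A_\ell^\infty$. -/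

import Mathlib

open scoped ENNReal

namespace QuantumSphere

noncomputable section Operators

/-- The Hilbert space `ℓ²(X)`. -/
abbrev H (X : Type) : Type := lp (fun _ : X => ℂ) 2

/-- The C⋆-algebra of bounded operators on `ℓ²(X)`. -/
abbrev L (X : Type) : Type := H X →L[ℂ] H X

/-- The standard basis vector `e_x` of `ℓ²(X)`. -/
def e {X : Type} (x : X) : H X := by
  classical exact lp.single 2 x (1 : ℂ)

variable {X Y : Type}

theorem e_apply [DecidableEq X] (x y : X) : (e x : H X) y = if y = x then 1 else 0 := by
  classical
  simp only [e, lp.coeFn_single, Pi.single_apply]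
  congr

theorem inner_e (x : X) (v : H X) : inner ℂ (e x) v = v x := by
  classical
  simp only [e]
  rw [lp.inner_single_left]
  simp

theorem ext_e {A B : H X →L[ℂ] H Y} (h : ∀ x, A (e x) = B (e x)) : A = B := by
  classical
  ext1 v
  have hv := lp.hasSum_single (p := 2) (by norm_num) v
  have key : ∀ x, A (lp.single 2 x (v x)) = B (lp.single 2 x (v x)) := by
    intro x
    have : (lp.single 2 x (v x) : H X) = v x • e x := by
      simp only [e]
      rw [← lp.single_smul]; simp
    rw [this, map_smul, map_smul, h]
  have hA := hv.mapL A
  have hB := hv.mapL B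
  simp only [key] at hA
  exact hA.unique hB

theorem hasSum_sq (v : H X) : HasSum (fun x => ‖v x‖ ^ 2) (‖v‖ ^ 2) := by
  have := lp.hasSum_norm (p := 2) (by norm_num) v
  simpa using this

theorem memℓp_two {f : X → ℂ} (h : Summable fun x => ‖f x‖ ^ 2) : Memℓp (E := fun _ : X => ℂ) f 2 := by
  apply memℓp_gen; simpa using h

theorem norm_le_of_hasSum {v : H X} {s C : ℝ} (hC : 0 ≤ C) (h : HasSum (fun x => ‖v x‖ ^ 2) s)
    (hs : s ≤ C ^ 2) : ‖v‖ ≤ C := by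
  have := (hasSum_sq v).unique h
  exact (sq_le_sq₀ (norm_nonneg _) hC).1 (this ▸ hs)

/-- Composition with an injective map `f : X → Y`, as a contraction `ℓ²(Y) → ℓ²(X)`. -/
def pull (f : X → Y) (hf : f.Injective) : H Y →L[ℂ] H X :=
  LinearMap.mkContinuous
    { toFun := fun v => ⟨fun x => v (f x),
        memℓp_two ((hasSum_sq v).summable.comp_injective hf)⟩
      map_add' := fun _ _ => rfl
      map_smul' := fun _ _ => rfl } 1 (fun v => by
        have hs := (hasSum_sq v).summable.comp_injective hf
        refine norm_le_of_hasSum (by positivity) hs.hasSum ?_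
        rw [one_mul, ← (hasSum_sq v).tsum_eq]
        exact Summable.tsum_le_tsum_of_inj f hf (fun _ _ => by positivity) (fun _ => le_rfl) hs
          (hasSum_sq v).summable)

@[simp] theorem pull_apply (f : X → Y) (hf : f.Injective) (v : H Y) (x : X) :
    pull f hf v x = v (f x) := rfl

/-- The diagonal operator `e_x ↦ d x • e_x`. -/
def diag (d : X → ℂ) (hd : ∀ x, ‖d x‖ ≤ 1) : L X :=
  have key : ∀ (v : H X) (x : X), ‖d x * v x‖ ^ 2 ≤ ‖v x‖ ^ 2 := fun v x => by
    gcongr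
    rw [norm_mul]
    exact mul_le_of_le_one_left (norm_nonneg _) (hd x)
  have hs : ∀ v : H X, Summable fun x => ‖d x * v x‖ ^ 2 := fun v =>
    Summable.of_nonneg_of_le (fun _ => by positivity) (key v) (hasSum_sq v).summable
  LinearMap.mkContinuous
    { toFun := fun v => ⟨fun x => d x * v x, memℓp_two (hs v)⟩
      map_add' := fun v w => by ext x; exact mul_add _ _ _
      map_smul' := fun c v => by ext x; exact mul_left_comm _ _ _ } 1 (fun v => by
        refine norm_le_of_hasSum (by positivity) (hs v).hasSum ?_
        rw [one_mul, ← (hasSum_sq v).tsum_eq]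
        exact (hs v).tsum_le_tsum (key v) (hasSum_sq v).summable)

@[simp] theorem diag_apply (d : X → ℂ) (hd : ∀ x, ‖d x‖ ≤ 1) (v : H X) (x : X) :
    diag d hd v x = d x * v x := rfl

/-- The `x`-th slice of a vector of `ℓ²(X × Y) = ℓ²(X) ⊗ ℓ²(Y)`. -/
def slice (x : X) : H (X × Y) →L[ℂ] H Y := pull (fun y => (x, y)) (fun _ _ h => (Prod.mk.inj h).2)

@[simp] theorem slice_apply (x : X) (v : H (X × Y)) (y : Y) : slice x v y = v (x, y) := rfl

theorem hasSum_slice (v : H (X × Y)) : HasSum (fun x => ‖slice x v‖ ^ 2) (‖v‖ ^ 2) :=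
  (hasSum_sq v).prod_fiberwise fun x => hasSum_sq (slice x v)

theorem summable_amp (a : L Y) (v : H (X × Y)) :
    Summable fun p : X × Y => ‖a (slice p.1 v) p.2‖ ^ 2 := by
  refine (summable_prod_of_nonneg (fun _ => by positivity)).2
    ⟨fun x => (hasSum_sq (a (slice x v))).summable, ?_⟩
  have : ∀ x : X, ∑' y, ‖a (slice x v) y‖ ^ 2 = ‖a (slice x v)‖ ^ 2 := fun x =>
    (hasSum_sq (a (slice x v))).tsum_eq
  simp only [this]
  refine Summable.of_nonneg_of_le (fun _ => by positivity) (fun x => ?_)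
    ((hasSum_slice v).summable.mul_left (‖a‖ ^ 2))
  rw [← mul_pow]
  gcongr
  exact a.le_opNorm _

/-- The amplification `I ⊗ a` on `ℓ²(X) ⊗ ℓ²(Y) = ℓ²(X × Y)`. -/
def ampR (X : Type) {Y : Type} (a : L Y) : L (X × Y) :=
  LinearMap.mkContinuous
    { toFun := fun v => ⟨fun p => a (slice p.1 v) p.2, memℓp_two (summable_amp a v)⟩
      map_add' := fun v w => by ext p; simp; rfl
      map_smul' := fun c v => by ext p; simp } ‖a‖ (fun v => by
        refine norm_le_of_hasSum (by positivity) (summable_amp a v).hasSum ?_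
        rw [(summable_amp a v).tsum_prod, mul_pow, ← (hasSum_slice v).tsum_eq, ← tsum_mul_left]
        have : ∀ x : X, ∑' y, ‖a (slice x v) y‖ ^ 2 = ‖a (slice x v)‖ ^ 2 := fun x =>
          (hasSum_sq (a (slice x v))).tsum_eq
        simp only [this]
        have hle : ∀ x : X, ‖a (slice x v)‖ ^ 2 ≤ ‖a‖ ^ 2 * ‖slice x v‖ ^ 2 := fun x => by
          rw [← mul_pow]
          gcongr
          exact a.le_opNorm _
        have hs := (hasSum_slice v).summable.mul_left (‖a‖ ^ 2)
        exact (Summable.of_nonneg_of_le (fun _ => by positivity) hle hs).tsum_le_tsum hle hs)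

theorem ampR_apply (a : L Y) (v : H (X × Y)) (p : X × Y) :
    ampR X a v p = a (slice p.1 v) p.2 := rfl

@[simp] theorem slice_ampR (a : L Y) (v : H (X × Y)) (x : X) :
    slice x (ampR X a v) = a (slice x v) := rfl

/-- The swapOp `ℓ²(Y × X) → ℓ²(X × Y)`. -/
def swapOp (X Y : Type) : H (Y × X) →L[ℂ] H (X × Y) := pull Prod.swap Prod.swap_injective

/-- The amplification `T ⊗ I` on `ℓ²(X) ⊗ ℓ²(Y) = ℓ²(X × Y)`. -/
def ampL {X : Type} (Y : Type) (T : L X) : L (X × Y) := swapOp X Y ∘L ampR Y T ∘L swapOp Y X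

/-- The tensor product `T ⊗ a` of operators, on `ℓ²(X) ⊗ ℓ²(Y) = ℓ²(X × Y)`. -/
def tensor (T : L X) (a : L Y) : L (X × Y) := ampL Y T * ampR X a

theorem slice_e [DecidableEq X] (x x' : X) (y : Y) :
    slice x (e (x', y)) = if x = x' then e y else 0 := by
  classical
  ext y'
  simp only [slice_apply, e_apply, Prod.mk.injEq]
  split_ifs with h1 h2 h3 <;> simp_all [e_apply]

theorem ampR_e (a : L Y) (x x' : X) (y y' : Y) [DecidableEq X] :
    ampR X a (e (x, y)) (x', y') = if x' = x then a (e y) y' else 0 := by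
  rw [ampR_apply, slice_e]
  split_ifs <;> simp

theorem ampL_e (T : L X) (x x' : X) (y y' : Y) [DecidableEq Y] :
    ampL Y T (e (x, y)) (x', y') = if y' = y then T (e x) x' else 0 := by
  have : swapOp Y X (e (x, y)) = e (y, x) := by
    classical
    ext ⟨b, c⟩
    simp only [swapOp, pull_apply, e_apply, Prod.swap_prod_mk, Prod.mk.injEq, and_comm]
  change ampR Y T (swapOp Y X (e (x, y))) (y', x') = _
  rw [this, ampR_e]

/-- `T ⊗ a` acts on elementary tensors of basis vectors as expected. -/
theorem tensor_e (T : L X) (a : L Y) (x x' : X) (y y' : Y) :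
    tensor T a (e (x, y)) (x', y') = T (e x) x' * a (e y) y' := by
  classical
  change T (slice y' (swapOp Y X (ampR X a (e (x, y))))) x' = _
  have : slice y' (swapOp Y X (ampR X a (e (x, y)))) = a (e y) y' • e x := by
    ext x''
    change ampR X a (e (x, y)) (x'', y') = a (e y) y' * (e x : H X) x''
    rw [ampR_e, e_apply]
    split_ifs <;> simp
  rw [this, map_smul, mul_comm]
  rfl

theorem amp_comm (T : L X) (a : L Y) : ampR X a * ampL Y T = ampL Y T * ampR X a := by
  classical
  apply ext_e
  rintro ⟨x, y⟩
  ext ⟨x', y'⟩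
  refine Eq.trans ?_ (tensor_e T a x x' y y').symm
  change a (slice x' (ampL Y T (e (x, y)))) y' = _
  have : slice x' (ampL Y T (e (x, y))) = T (e x) x' • e y := by
    ext y''
    change ampL Y T (e (x, y)) (x', y'') = T (e x) x' * (e y : H Y) y''
    rw [ampL_e, e_apply]
    split_ifs <;> simp
  rw [this, map_smul]
  rfl

theorem ampR_mul (a b : L Y) : ampR X (a * b) = ampR X a * ampR X b := rfl
theorem ampL_mul (a b : L X) : ampL Y (a * b) = ampL Y a * ampL Y b := rfl

theorem tensor_mul (T T' : L X) (a a' : L Y) :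
    tensor T a * tensor T' a' = tensor (T * T') (a * a') := by
  simp only [tensor, ampR_mul, ampL_mul]
  rw [mul_assoc, mul_assoc, ← mul_assoc (ampR X a), amp_comm, mul_assoc]

theorem inner_e_star (A : L X) (x y : X) : (star A) (e x) y = star (A (e y) x) := by
  rw [← inner_e, ContinuousLinearMap.star_eq_adjoint, ContinuousLinearMap.adjoint_inner_right,
    ← inner_conj_symm, inner_e]
  rfl

theorem star_tensor (T : L X) (a : L Y) : star (tensor T a) = tensor (star T) (star a) := by
  apply ext_e
  rintro ⟨x, y⟩
  ext ⟨x', y'⟩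
  rw [inner_e_star, tensor_e, tensor_e, inner_e_star, inner_e_star, star_mul']

theorem tensor_ext {A B : L (X × Y)}
    (h : ∀ x y x' y', A (e (x, y)) (x', y') = B (e (x, y)) (x', y')) : A = B :=
  ext_e fun ⟨x, y⟩ => by ext ⟨x', y'⟩; exact h x y x' y'

theorem tensor_add_left (T T' : L X) (a : L Y) :
    tensor (T + T') a = tensor T a + tensor T' a := by
  apply tensor_ext; intro x y x' y'
  simp [tensor_e, add_mul]

theorem tensor_sub_left (T T' : L X) (a : L Y) :
    tensor (T - T') a = tensor T a - tensor T' a := by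
  apply tensor_ext; intro x y x' y'
  simp [tensor_e, sub_mul]

theorem tensor_sub_right (T : L X) (a a' : L Y) :
    tensor T (a - a') = tensor T a - tensor T a' := by
  apply tensor_ext; intro x y x' y'
  simp [tensor_e, mul_sub]

theorem tensor_add_right (T : L X) (a a' : L Y) :
    tensor T (a + a') = tensor T a + tensor T a' := by
  apply tensor_ext; intro x y x' y'
  simp [tensor_e, mul_add]

theorem tensor_zero_right (T : L X) : tensor T (0 : L Y) = 0 := by
  apply tensor_ext; intro x y x' y'
  simp [tensor_e]

theorem tensor_smul_left (c : ℂ) (T : L X) (a : L Y) : tensor (c • T) a = c • tensor T a := by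
  apply tensor_ext; intro x y x' y'
  simp [tensor_e, mul_assoc]

theorem tensor_smul_right (c : ℂ) (T : L X) (a : L Y) : tensor T (c • a) = c • tensor T a := by
  apply tensor_ext; intro x y x' y'
  simp [tensor_e, mul_left_comm]

theorem tensor_sum_right {ι : Type} (s : Finset ι) (T : L X) (a : ι → L Y) :
    tensor T (∑ i ∈ s, a i) = ∑ i ∈ s, tensor T (a i) := by
  classical
  induction s using Finset.induction_on with
  | empty => simp [tensor_zero_right]
  | insert i s hi ih => simp [Finset.sum_insert hi, tensor_add_right, ih]

theorem tensor_one : tensor (1 : L X) (1 : L Y) = 1 := rfl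

/-- The left shift `S e_n = e_{n-1}` on `ℓ²(ℕ)` (with `S e_0 = 0`). -/
def shiftN : L ℕ := pull (fun n => n + 1) (add_left_injective 1)

/-- The left shift `S e_n = e_{n-1}` on `ℓ²(ℤ)`. -/
def shiftZ : L ℤ := pull (fun n => n + 1) (add_left_injective 1)

theorem pull_star_apply (f : X → X) (hf : f.Injective) (v : H X) (x : X) :
    star (pull f hf) v (f x) = v x := by
  classical
  have : pull f hf (e (f x)) = e x := by
    ext y; simp [e_apply, hf.eq_iff]
  rw [← inner_e, ContinuousLinearMap.star_eq_adjoint, ContinuousLinearMap.adjoint_inner_right,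
    this, inner_e]

theorem pull_star_apply_of_notMem (f : X → X) (hf : f.Injective) (v : H X) (y : X)
    (hy : ∀ x, f x ≠ y) : star (pull f hf) v y = 0 := by
  classical
  have : pull f hf (e y) = 0 := by
    ext x; simp [e_apply, hy]
  rw [← inner_e, ContinuousLinearMap.star_eq_adjoint, ContinuousLinearMap.adjoint_inner_right,
    this, inner_zero_left]

theorem pull_mul_star (f : X → X) (hf : f.Injective) : pull f hf * star (pull f hf) = 1 := by
  ext v x; exact pull_star_apply f hf v x

theorem star_shiftN_zero (v : H ℕ) : (star shiftN) v 0 = 0 :=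
  pull_star_apply_of_notMem (fun n => n + 1) (add_left_injective 1) v 0 Nat.succ_ne_zero

theorem star_shiftN_succ (v : H ℕ) (n : ℕ) : (star shiftN) v (n + 1) = v n :=
  pull_star_apply (fun n => n + 1) (add_left_injective 1) v n

theorem star_shiftZ_succ (v : H ℤ) (n : ℤ) : (star shiftZ) v (n + 1) = v n :=
  pull_star_apply (fun n => n + 1) (add_left_injective 1) v n

theorem shiftZ_star_mul : star shiftZ * shiftZ = 1 := by
  ext v n
  obtain ⟨m, rfl⟩ : ∃ m : ℤ, m + 1 = n := ⟨n - 1, by ring⟩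
  rw [mul_apply_eq_comp, star_shiftZ_succ]
  rfl

theorem shiftZ_mul_star : shiftZ * star shiftZ = 1 := pull_mul_star _ _

theorem shiftN_mul_star : shiftN * star shiftN = 1 := pull_mul_star _ _

/-- The projection `p_0 = |e_0⟩⟨e_0|` on `ℓ²(ℕ)`. -/
def p0 : L ℕ := diag (fun n => if n = 0 then 1 else 0) (fun n => by split_ifs <;> simp)

/-- The range `[0, 1)` of the deformation parameter `q`. -/
abbrev Param : Type := Set.Ico (0 : ℝ) 1

/-- The operator `q^N` on `ℓ²(ℕ)`; for `q = 0` it is `p_0`, as `0 ^ 0 = 1`. -/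
def qN (q : Param) : L ℕ :=
  diag (fun n => (((q : ℝ) ^ n : ℝ) : ℂ)) (fun n => by
    rw [Complex.norm_real, Real.norm_of_nonneg (pow_nonneg q.2.1 n)]
    exact pow_le_one₀ q.2.1 q.2.2.le)

/-- The operator `√(1 - q^{2N})` on `ℓ²(ℕ)`. -/
def sqrtN (q : Param) : L ℕ :=
  diag (fun n => ((√(1 - (q : ℝ) ^ (2 * n)) : ℝ) : ℂ)) (fun n => by
    rw [Complex.norm_real, Real.norm_of_nonneg (Real.sqrt_nonneg _), Real.sqrt_le_one]
    have := pow_nonneg q.2.1 (2 * n)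
    linarith)

theorem star_diag_real (d : X → ℝ) (hd : ∀ x, ‖((d x : ℝ) : ℂ)‖ ≤ 1) :
    star (diag (fun x => ((d x : ℝ) : ℂ)) hd) = diag (fun x => ((d x : ℝ) : ℂ)) hd := by
  classical
  apply ext_e; intro x; ext y
  rw [inner_e_star]
  simp only [diag_apply, e_apply]
  by_cases h : x = y
  · subst h; simp
  · simp [h, Ne.symm h]

theorem star_qN (q : Param) : star (qN q) = qN q := star_diag_real _ _
theorem star_sqrtN (q : Param) : star (sqrtN q) = sqrtN q := star_diag_real _ _

theorem sqrtN_sq (q : Param) : sqrtN q * sqrtN q = 1 - qN q * qN q := by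
  ext v n
  change ((√(1 - (q : ℝ) ^ (2 * n)) : ℝ) : ℂ) * (((√(1 - (q : ℝ) ^ (2 * n)) : ℝ) : ℂ) * v n) =
    v n - (((q : ℝ) ^ n : ℝ) : ℂ) * ((((q : ℝ) ^ n : ℝ) : ℂ) * v n)
  rw [← mul_assoc, ← Complex.ofReal_mul, Real.mul_self_sqrt, ← mul_assoc, ← Complex.ofReal_mul]
  · push_cast; ring
  · have := pow_le_one₀ (n := 2 * n) q.2.1 q.2.2.le
    linarith

theorem shiftN_qN (q : Param) : shiftN * qN q = ((q : ℝ) : ℂ) • (qN q * shiftN) := by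
  ext v n
  change (((q : ℝ) ^ (n + 1) : ℝ) : ℂ) * v (n + 1) =
    ((q : ℝ) : ℂ) * ((((q : ℝ) ^ n : ℝ) : ℂ) * v (n + 1))
  push_cast; ring

theorem qN_sqrtN (q : Param) : qN q * sqrtN q = sqrtN q * qN q := by
  ext v n
  exact mul_left_comm _ _ _

theorem star_shift_shift_sqrtN (q : Param) : star shiftN * shiftN * sqrtN q = sqrtN q := by
  ext v n
  rw [mul_apply_eq_comp, mul_apply_eq_comp]
  cases n with
  | zero =>
    rw [star_shiftN_zero]
    simp [sqrtN]
  | succ n =>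
    rw [star_shiftN_succ]
    rfl

end Operators

end QuantumSphere

namespace QuantumSphere

/-- The defining relations of the quantum sphere `S_q^{2ℓ+1}` (the generators are numbered
from `0`). -/
structure SphereRelations (q : ℝ) {ℓ : ℕ} {B : Type*} [Ring B] [StarRing B] [Algebra ℂ B]
    (z : Fin (ℓ + 1) → B) : Prop where
  mul_rel : ∀ i j, j < i → z i * z j = (q : ℂ) • (z j * z i)
  star_mul_rel : ∀ i j, i ≠ j → star (z i) * z j = (q : ℂ) • (z j * star (z i))
  comm_rel : ∀ i, z i * star (z i) - star (z i) * z i +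
    ((1 - q ^ 2 : ℝ) : ℂ) • ∑ k ∈ Finset.Ioi i, z k * star (z k) = 0
  sum_rel : ∑ i, z i * star (z i) = 1

noncomputable section Generators

/-- The index set `ℕ^ℓ × ℤ`. -/
abbrev Idx : ℕ → Type
  | 0 => ℤ
  | ℓ + 1 => ℕ × Idx ℓ

instance instNonemptyIdx : (ℓ : ℕ) → Nonempty (Idx ℓ)
  | 0 => ⟨(0 : ℤ)⟩
  | ℓ + 1 => ⟨((0 : ℕ), (instNonemptyIdx ℓ).some)⟩

/-- The operators `Y_{1,q}, …, Y_{ℓ+1,q}` on `ℓ²(ℕ)^{⊗ ℓ} ⊗ ℓ²(ℤ)` (numbered from `0`):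
`Y_{k,q} = q^N ⊗ ⋯ ⊗ q^N ⊗ √(1 - q^{2N}) S^* ⊗ I ⊗ ⋯ ⊗ I` for `k ≤ ℓ`, with `k - 1` factors `q^N`,
and `Y_{ℓ+1,q} = q^N ⊗ ⋯ ⊗ q^N ⊗ S^*`. -/
def Y : (ℓ : ℕ) → (q : Param) → Fin (ℓ + 1) → L (Idx ℓ)
  | 0, _ => fun _ => star shiftZ
  | ℓ + 1, q => Fin.cons (tensor (sqrtN q * star shiftN) (1 : L (Idx ℓ)))
      (fun k : Fin (ℓ + 1) => tensor (qN q) (Y ℓ q k))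

theorem Y_zero (q : Param) (k : Fin 1) : Y 0 q k = star shiftZ := rfl

theorem Y_succ_zero (ℓ : ℕ) (q : Param) :
    Y (ℓ + 1) q 0 = tensor (sqrtN q * star shiftN) (1 : L (Idx ℓ)) := rfl

theorem Y_succ_succ (ℓ : ℕ) (q : Param) (k : Fin (ℓ + 1)) :
    Y (ℓ + 1) q k.succ = tensor (qN q) (Y ℓ q k) := rfl

theorem qN_star_shiftN (q : Param) :
    qN q * star shiftN = ((q : ℝ) : ℂ) • (star shiftN * qN q) := by
  have := congrArg star (shiftN_qN q)
  simpa [star_mul, star_smul, star_qN] using this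

theorem qN_X (q : Param) : qN q * (sqrtN q * star shiftN) =
    ((q : ℝ) : ℂ) • ((sqrtN q * star shiftN) * qN q) := by
  rw [← mul_assoc, qN_sqrtN, mul_assoc, qN_star_shiftN, mul_smul_comm, mul_assoc]

theorem star_X (q : Param) : star (sqrtN q * star shiftN) = shiftN * sqrtN q := by
  rw [star_mul, star_star, star_sqrtN]

theorem X_mul_star (q : Param) :
    (sqrtN q * star shiftN) * (shiftN * sqrtN q) = 1 - qN q * qN q := by
  rw [mul_assoc, ← mul_assoc (star shiftN), star_shift_shift_sqrtN, sqrtN_sq]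

theorem star_X_mul (q : Param) : (shiftN * sqrtN q) * (sqrtN q * star shiftN) =
    1 - (((q : ℝ) ^ 2 : ℝ) : ℂ) • (qN q * qN q) := by
  rw [mul_assoc, ← mul_assoc (sqrtN q), sqrtN_sq, sub_mul, mul_sub, one_mul, shiftN_mul_star,
    ← mul_assoc, ← mul_assoc, shiftN_qN, smul_mul_assoc, mul_assoc (qN q) shiftN, shiftN_qN,
    mul_smul_comm, smul_smul, smul_mul_assoc, mul_assoc (qN q), mul_assoc (qN q), shiftN_mul_star,
    mul_one]
  push_cast
  rw [pow_two]

theorem X_star_qN (q : Param) : (shiftN * sqrtN q) * qN q =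
    ((q : ℝ) : ℂ) • (qN q * (shiftN * sqrtN q)) := by
  rw [mul_assoc, ← qN_sqrtN, ← mul_assoc, shiftN_qN, smul_mul_assoc, mul_assoc]

theorem Y_mul_rel (q : Param) : (ℓ : ℕ) → ∀ i j : Fin (ℓ + 1), j < i →
    Y ℓ q i * Y ℓ q j = ((q : ℝ) : ℂ) • (Y ℓ q j * Y ℓ q i)
  | 0 => fun i j h => by omega
  | ℓ + 1 => fun i j => by
    refine Fin.cases ?_ (fun i => ?_) i
    · intro h; simp at h
    · refine Fin.cases ?_ (fun j => ?_) j
      · intro _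
        rw [Y_succ_zero, Y_succ_succ, tensor_mul, tensor_mul, qN_X, tensor_smul_left, mul_one,
          one_mul]
      · intro h
        rw [Y_succ_succ, Y_succ_succ, tensor_mul, tensor_mul,
          Y_mul_rel q ℓ i j (Fin.succ_lt_succ_iff.1 h), tensor_smul_right]

theorem Y_star_mul_rel (q : Param) : (ℓ : ℕ) → ∀ i j : Fin (ℓ + 1), i ≠ j →
    star (Y ℓ q i) * Y ℓ q j = ((q : ℝ) : ℂ) • (Y ℓ q j * star (Y ℓ q i))
  | 0 => fun i j h => by omega
  | ℓ + 1 => fun i j => by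
    refine Fin.cases ?_ (fun i => ?_) i
    · refine Fin.cases ?_ (fun j => ?_) j
      · intro h; simp at h
      · intro _
        rw [Y_succ_zero, Y_succ_succ, star_tensor, tensor_mul, tensor_mul, star_X, X_star_qN,
          tensor_smul_left, star_one, mul_one, one_mul]
    · refine Fin.cases ?_ (fun j => ?_) j
      · intro _
        rw [Y_succ_zero, Y_succ_succ, star_tensor, tensor_mul, tensor_mul, star_qN, qN_X,
          tensor_smul_left, mul_one, one_mul]
      · intro h
        rw [Y_succ_succ, Y_succ_succ, star_tensor, tensor_mul, tensor_mul, star_qN,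
          Y_star_mul_rel q ℓ i j (fun h' => h (h' ▸ rfl)), tensor_smul_right]

theorem Y_sum_rel (q : Param) : (ℓ : ℕ) → ∑ i, Y ℓ q i * star (Y ℓ q i) = 1
  | 0 => by
    rw [Fin.sum_univ_one, Y_zero, star_star, shiftZ_star_mul]
  | ℓ + 1 => by
    rw [Fin.sum_univ_succ]
    simp only [Y_succ_zero, Y_succ_succ, star_tensor, tensor_mul, star_X, X_mul_star, star_qN,
      star_one, mul_one]
    rw [← tensor_sum_right, Y_sum_rel q ℓ, ← tensor_add_left, sub_add_cancel, tensor_one]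

theorem Y_comm_rel (q : Param) : (ℓ : ℕ) → ∀ i : Fin (ℓ + 1),
    Y ℓ q i * star (Y ℓ q i) - star (Y ℓ q i) * Y ℓ q i +
      ((1 - (q : ℝ) ^ 2 : ℝ) : ℂ) • ∑ k ∈ Finset.Ioi i, Y ℓ q k * star (Y ℓ q k) = 0
  | 0 => fun i => by
    have : Finset.Ioi i = ∅ := by
      ext k; simp
    rw [this, Y_zero, star_star, shiftZ_star_mul, shiftZ_mul_star]
    simp
  | ℓ + 1 => fun i => by
    refine Fin.cases ?_ (fun i => ?_) i
    · rw [Fin.sum_Ioi_zero]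
      simp only [Y_succ_zero, Y_succ_succ, star_tensor, tensor_mul, star_X, X_mul_star, star_qN,
        star_one, mul_one, star_X_mul]
      rw [← tensor_sum_right, Y_sum_rel q ℓ, ← tensor_sub_left, ← tensor_smul_left,
        ← tensor_add_left]
      have : (1 - qN q * qN q - (1 - (((q : ℝ) ^ 2 : ℝ) : ℂ) • (qN q * qN q)) +
          ((1 - (q : ℝ) ^ 2 : ℝ) : ℂ) • (qN q * qN q)) = (0 : ℂ) • 1 := by
        push_cast
        module
      rw [this, tensor_smul_left, zero_smul]
    · rw [Fin.sum_Ioi_succ]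
      simp only [Y_succ_succ, star_tensor, tensor_mul, star_qN]
      rw [← tensor_sum_right, ← tensor_sub_right, ← tensor_smul_right, ← tensor_add_right,
        Y_comm_rel q ℓ i, tensor_zero_right]

theorem sphereRelations_Y (ℓ : ℕ) (q : Param) : SphereRelations (q : ℝ) (Y ℓ q) where
  mul_rel := Y_mul_rel q ℓ
  star_mul_rel := Y_star_mul_rel q ℓ
  comm_rel := Y_comm_rel q ℓ
  sum_rel := Y_sum_rel q ℓ

end Generators

end QuantumSphere

namespace QuantumSphere

noncomputable section UniversalAlgebra

/-- A nonzero unital C⋆-algebra together with elements satisfying the relations of `S_q^{2ℓ+1}`.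
(A C⋆-algebra generated by finitely many elements has at most continuum many elements, so the
smallest universe is no restriction.) -/
structure SphereRep (ℓ : ℕ) (q : ℝ) where
  carrier : Type
  [cstar : CStarAlgebra carrier]
  [nontrivial : Nontrivial carrier]
  gen : Fin (ℓ + 1) → carrier
  rel : SphereRelations q gen

attribute [instance] SphereRep.cstar SphereRep.nontrivial

theorem SphereRelations.norm_le_one {q : ℝ} {ℓ : ℕ} {B : Type*} [CStarAlgebra B] [Nontrivial B]
    {z : Fin (ℓ + 1) → B} (h : SphereRelations q z) (i : Fin (ℓ + 1)) : ‖z i‖ ≤ 1 := by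
  let _ := CStarAlgebra.spectralOrder B
  have _ := CStarAlgebra.spectralOrderedRing B
  have h1 : z i * star (z i) ≤ 1 := by
    rw [← h.sum_rel]
    exact Finset.single_le_sum (f := fun i => z i * star (z i))
      (fun j _ => mul_star_self_nonneg (z j)) (Finset.mem_univ i)
  have h2 := CStarAlgebra.norm_le_norm_of_nonneg_of_le (mul_star_self_nonneg (z i)) h1
  rw [CStarRing.norm_self_mul_star, norm_one] at h2
  nlinarith [norm_nonneg (z i)]

/-- The product C⋆-algebra of all C⋆-algebras with elements satisfying the relations. -/
abbrev SphereProd (ℓ : ℕ) (q : ℝ) : Type 1 := lp (fun R : SphereRep ℓ q => R.carrier) ∞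

instance instCStarAlgebraSphereProd (ℓ : ℕ) (q : ℝ) : CStarAlgebra (SphereProd ℓ q) where

/-- The family of all the `i`-th generators. -/
def prodGen (ℓ : ℕ) (q : ℝ) (i : Fin (ℓ + 1)) : SphereProd ℓ q :=
  ⟨fun R => R.gen i, memℓp_infty ⟨1, by rintro _ ⟨R, rfl⟩; exact R.rel.norm_le_one i⟩⟩

/-- The universal C⋆-algebra `C(S_q^{2ℓ+1})` generated by elements `z_1, …, z_{ℓ+1}` satisfying
the relations: the closed ⋆-subalgebra generated by the universal family, i.e. the completion of
the free ⋆-algebra modulo the relations in the supremum of the C⋆-seminorms `a ↦ ‖ρ a‖`, where `ρ`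
runs over all ⋆-homomorphisms to C⋆-algebras. -/
def sphereAlgebra (ℓ : ℕ) (q : ℝ) : StarSubalgebra ℂ (SphereProd ℓ q) :=
  (StarAlgebra.adjoin ℂ (Set.range (prodGen ℓ q))).topologicalClosure

instance instIsClosedSphereAlgebra (ℓ : ℕ) (q : ℝ) :
    IsClosed (sphereAlgebra ℓ q : Set (SphereProd ℓ q)) :=
  StarSubalgebra.isClosed_topologicalClosure _

/-- The generators `z_1, …, z_{ℓ+1}` of `C(S_q^{2ℓ+1})`, numbered from `0`. -/
def sphereGen (ℓ : ℕ) (q : ℝ) (i : Fin (ℓ + 1)) : sphereAlgebra ℓ q :=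
  ⟨prodGen ℓ q i, StarSubalgebra.le_topologicalClosure _
    (StarAlgebra.subset_adjoin ℂ _ (Set.mem_range_self i))⟩

/-- The homomorphism from the universal C⋆-algebra to a C⋆-algebra with elements satisfying the
relations, mapping the universal generators to these elements. -/
def SphereRep.hom {ℓ : ℕ} {q : ℝ} (R : SphereRep ℓ q) : sphereAlgebra ℓ q →⋆ₐ[ℂ] R.carrier where
  toFun a := (a : SphereProd ℓ q) R
  map_one' := rfl
  map_mul' _ _ := rfl
  map_zero' := rfl
  map_add' _ _ := rfl
  commutes' _ := rfl
  map_star' _ := rfl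

theorem SphereRep.hom_gen {ℓ : ℕ} {q : ℝ} (R : SphereRep ℓ q) (i : Fin (ℓ + 1)) :
    R.hom (sphereGen ℓ q i) = R.gen i := rfl

theorem sphereRelations_gen (ℓ : ℕ) (q : ℝ) : SphereRelations q (sphereGen ℓ q) where
  mul_rel i j h := by ext R; exact R.rel.mul_rel i j h
  star_mul_rel i j h := by ext R; exact R.rel.star_mul_rel i j h
  comm_rel i := by
    refine Subtype.ext (lp.ext (funext fun R => ?_))
    have := R.rel.comm_rel i
    simp only [← R.hom_gen, ← map_star, ← map_mul, ← map_sum, ← map_sub, ← map_smul,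
      ← map_add] at this
    exact this
  sum_rel := by
    refine Subtype.ext (lp.ext (funext fun R => ?_))
    have := R.rel.sum_rel
    simp only [← R.hom_gen, ← map_star, ← map_mul, ← map_sum] at this
    exact this

/-- The representation given by the operators `Y_{k,q}` on `ℓ²(ℕ)^{⊗ ℓ} ⊗ ℓ²(ℤ)`. -/
def repY (ℓ : ℕ) (q : Param) : SphereRep ℓ (q : ℝ) where
  carrier := L (Idx ℓ)
  cstar := inferInstance
  nontrivial := by
    have x := (instNonemptyIdx ℓ).some
    refine ⟨1, 0, fun h => ?_⟩
    have h1 : (1 : L (Idx ℓ)) (e x) x = (0 : L (Idx ℓ)) (e x) x := by rw [h]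
    classical
    simp [e_apply] at h1
  gen := Y ℓ q
  rel := sphereRelations_Y ℓ q

/-- The representation `π_ℓ : z_k ↦ Y_{k,q}` of `C(S_q^{2ℓ+1})` on `ℓ²(ℕ)^{⊗ ℓ} ⊗ ℓ²(ℤ)`. -/
def piRep (ℓ : ℕ) (q : Param) : sphereAlgebra ℓ (q : ℝ) →⋆ₐ[ℂ] L (Idx ℓ) :=
  (repY ℓ q).hom

theorem piRep_gen (ℓ : ℕ) (q : Param) (k : Fin (ℓ + 1)) :
    piRep ℓ q (sphereGen ℓ q k) = Y ℓ q k := rfl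

/-- The C⋆-algebra `A_ℓ(q) = π_ℓ(C(S_q^{2ℓ+1}))`. -/
def imageAlgebra (ℓ : ℕ) (q : Param) : StarSubalgebra ℂ (L (Idx ℓ)) := (piRep ℓ q).range

theorem exists_lift_of_isSelfAdjoint {A B : Type*} [CStarAlgebra A] [CStarAlgebra B]
    (φ : A →⋆ₐ[ℂ] B) {x : A} (hx : IsSelfAdjoint x) : ∃ y, φ y = φ x ∧ ‖y‖ ≤ ‖φ x‖ := by
  obtain _ | _ := subsingleton_or_nontrivial B
  · exact ⟨0, Subsingleton.elim _ _, by simp⟩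
  have hφ : Continuous φ := AddMonoidHomClass.continuous_of_bound φ 1 fun a => by
    rw [one_mul]; exact NonUnitalStarAlgHom.norm_apply_le φ a
  set c := ‖φ x‖
  let g : ℝ → ℝ := fun t => max (-c) (min c t)
  have hg : Continuous g := by fun_prop
  refine ⟨cfc g x, ?_, ?_⟩
  · have h1 : φ (cfc g x) = cfc g (φ x) :=
      StarAlgHomClass.map_cfc (S := ℂ) φ g x hg.continuousOn hφ hx (hx.map φ)
    rw [h1]
    conv_rhs => rw [← cfc_id ℝ (φ x) (hx.map φ)]
    refine cfc_congr fun t ht => ?_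
    have := spectrum.norm_le_norm_of_mem ht
    rw [Real.norm_eq_abs, abs_le] at this
    simp only [g, id]
    rw [min_eq_right this.2, max_eq_right this.1]
  · refine norm_cfc_le (norm_nonneg _) fun t _ => ?_
    have hc : 0 ≤ c := norm_nonneg _
    rw [Real.norm_eq_abs, abs_le]
    exact ⟨le_max_left _ _, max_le (by linarith) (min_le_left _ _)⟩

/-- The range of a ⋆-homomorphism of C⋆-algebras is closed. -/
theorem isClosed_range {A B : Type*} [CStarAlgebra A] [CStarAlgebra B]
    (φ : A →⋆ₐ[ℂ] B) : IsClosed (φ.range : Set B) := by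
  have lift : ∀ x : A, ∃ y, φ y = φ x ∧ ‖y‖ ≤ 2 * ‖φ x‖ := by
    intro x
    obtain ⟨y₁, h₁, h₁'⟩ := exists_lift_of_isSelfAdjoint φ (realPart x).2
    obtain ⟨y₂, h₂, h₂'⟩ := exists_lift_of_isSelfAdjoint φ (imaginaryPart x).2
    have hre : φ (realPart x : A) = (realPart (φ x) : B) := by
      rw [realPart_apply_coe, realPart_apply_coe, ← Complex.coe_smul, ← Complex.coe_smul,
        map_smul, map_add, map_star]
    have him : φ (imaginaryPart x : A) = (imaginaryPart (φ x) : B) := by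
      rw [imaginaryPart_apply_coe, imaginaryPart_apply_coe, ← Complex.coe_smul,
        ← Complex.coe_smul, map_smul, map_smul, map_sub, map_star]
    refine ⟨y₁ + Complex.I • y₂, ?_, ?_⟩
    · rw [map_add, map_smul, h₁, h₂, ← map_smul, ← map_add, realPart_add_I_smul_imaginaryPart]
    · refine (norm_add_le _ _).trans ?_
      rw [norm_smul, Complex.norm_I, one_mul, two_mul]
      have a1 := realPart.norm_le (φ x)
      have a2 := imaginaryPart.norm_le (φ x)
      rw [hre] at h₁'
      rw [him] at h₂'
      exact add_le_add (h₁'.trans a1) (h₂'.trans a2)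
  let f : NormedAddGroupHom A B :=
    { toFun := φ
      map_add' := map_add φ
      bound' := ⟨1, fun a => by rw [one_mul]; exact NonUnitalStarAlgHom.norm_apply_le φ a⟩ }
  have hsurj : f.SurjectiveOnWith f.range 2 := by
    rintro _ ⟨x, rfl⟩
    obtain ⟨y, hy, hy'⟩ := lift x
    exact ⟨y, hy, hy'⟩
  have h2 := controlled_closure_of_complete (by norm_num) (by norm_num : (0 : ℝ) < 1) hsurj
  refine isClosed_of_closure_subset fun b hb => ?_
  have hb' : b ∈ f.range.topologicalClosure := hb
  obtain ⟨x, hx, -⟩ := h2 b hb'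
  exact ⟨x, hx⟩

instance instIsClosedImageAlgebra (ℓ : ℕ) (q : Param) :
    IsClosed (imageAlgebra ℓ q : Set (L (Idx ℓ))) := isClosed_range _

instance instCompleteImageAlgebra (ℓ : ℕ) (q : Param) : CompleteSpace (imageAlgebra ℓ q) :=
  (instIsClosedImageAlgebra ℓ q).completeSpace_coe

end UniversalAlgebra

end QuantumSphere

namespace QuantumSphere

noncomputable section SmoothAlgebra

/-- Rapidly decreasing families of scalars. -/
def RapidDecay (c : ℤ → ℂ) : Prop :=
  ∀ m : ℕ, Summable fun n : ℤ => (1 + |(n : ℝ)|) ^ m * ‖c n‖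

/-- The powers `T^n` for `n ≥ 0` and `(T^*)^{-n}` for `n < 0`. -/
def laurentPow {X : Type} (T : L X) : ℤ → L X
  | Int.ofNat n => T ^ n
  | Int.negSucc n => star T ^ (n + 1)

/-- A set of bounded operators on `ℓ²(X)` with a sequence of functions, the seminorms. -/
structure SmoothData (X : Type) where
  carrier : Set (L X)
  seminorm : ℕ → L X → ℝ

/-- `a = ∑ c_n z^n` with rapidly decreasing `c`, where `z = S^*` is the right shift on `ℓ²(ℤ)`. -/
def IsFourierExpansion (c : ℤ → ℂ) (a : L ℤ) : Prop :=
  RapidDecay c ∧ HasSum (fun n : ℤ => c n • laurentPow (star shiftZ) n) a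

/-- The operator `α_1 = Y_{1,0}^*` on `ℓ²(ℕ)^{⊗ (ℓ + 1)} ⊗ ℓ²(ℤ)`. -/
def alpha (ℓ : ℕ) : L (ℕ × Idx ℓ) := star (Y (ℓ + 1) ⟨0, le_rfl, one_pos⟩ 0)

/-- `a = ∑_{j,k} α_1^{*j} (p_0 ⊗ x_{jk}) α_1^k + ∑_{k ≥ 0} c_k α_1^k + ∑_{k > 0} c_{-k} α_1^{*k}` with
`x_{jk}` in the given algebra, `∑_{j,k} (1 + j + k)^n ‖x_{jk}‖_m < ∞` for all `n, m`, and `c`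
rapidly decreasing. -/
def IsExpansion {ℓ : ℕ} (D : SmoothData (Idx ℓ)) (x : ℕ × ℕ → L (Idx ℓ)) (c : ℤ → ℂ)
    (a : L (ℕ × Idx ℓ)) : Prop :=
  (∀ p, x p ∈ D.carrier) ∧
  (∀ n m : ℕ, Summable fun p : ℕ × ℕ => (1 + p.1 + p.2 : ℝ) ^ n * D.seminorm m (x p)) ∧
  RapidDecay c ∧
  ∃ b t : L (ℕ × Idx ℓ),
    HasSum (fun p : ℕ × ℕ => star (alpha ℓ) ^ p.1 * tensor p0 (x p) * alpha ℓ ^ p.2) b ∧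
    HasSum (fun k : ℤ => c k • laurentPow (alpha ℓ) k) t ∧
    a = b + t

/-- The algebras `𝒜_ℓ^∞` with their seminorms, by recursion on `ℓ`. The coefficients of an expansion
are determined by the operator, so the infimum in the definition of `‖a‖_m` is over one value. -/
def smoothData : (ℓ : ℕ) → SmoothData (Idx ℓ)
  | 0 =>
    { carrier := {a | ∃ c, IsFourierExpansion c a}
      seminorm := fun m a =>
        sInf {r | ∃ c, IsFourierExpansion c a ∧ r = ∑' n : ℤ, (1 + |(n : ℝ)|) ^ m * ‖c n‖} }
  | ℓ + 1 =>
    { carrier := {a | ∃ x c, IsExpansion (smoothData ℓ) x c a}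
      seminorm := fun m a =>
        sInf {r | ∃ x c, IsExpansion (smoothData ℓ) x c a ∧
          r = (⨆ rs : Fin (m + 1) × Fin (m + 1), ∑' p : ℕ × ℕ,
              (1 + p.1 + p.2 : ℝ) ^ (rs.1 : ℕ) * (smoothData ℓ).seminorm rs.2 (x p)) +
            ∑' k : ℤ, (1 + |(k : ℝ)|) ^ m * ‖c k‖} }

/-- The smooth algebra `𝒜_ℓ^∞`, as a set of operators. -/
def smoothSet (ℓ : ℕ) : Set (L (Idx ℓ)) := (smoothData ℓ).carrier

/-- The seminorms `‖·‖_m` on `𝒜_ℓ^∞`. -/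
def smoothSeminorm (ℓ m : ℕ) (a : L (Idx ℓ)) : ℝ := (smoothData ℓ).seminorm m a

end SmoothAlgebra

section Frechet

/-- The countable family `p` of seminorms defines a Fréchet space topology (Hausdorff and complete) on
the ⋆-algebra `E` for which the product is jointly continuous, the involution is continuous, and the
given map `j` to a space `B` is continuous. -/
def IsFrechetStarAlgebra {E B : Type*} [Ring E] [StarRing E] [Algebra ℂ E] [TopologicalSpace B]
    (p : SeminormFamily ℂ E ℕ) (j : E → B) : Prop :=
  ∃ _ : UniformSpace E, IsUniformAddGroup E ∧ WithSeminorms p ∧ T2Space E ∧ CompleteSpace E ∧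
    ContinuousMul E ∧ ContinuousStar E ∧ Continuous j

end Frechet

noncomputable section HolomorphicCalculus

/-- A closed piecewise `C¹` curve in the plane, parametrized by `[0, 1]`. -/
def IsPiecewiseC1Loop (γ : ℝ → ℂ) : Prop :=
  γ 0 = γ 1 ∧ ∃ (N : ℕ) (t : Fin (N + 1) → ℝ), StrictMono t ∧ t 0 = 0 ∧ t (Fin.last N) = 1 ∧
    ∀ i : Fin N, ContDiffOn ℝ 1 γ (Set.Icc (t i.castSucc) (t i.succ))

/-- `(2πi)⁻¹ ∮_Γ g(λ) dλ` for the cycle `Γ` consisting of the curves `Γ_1, …, Γ_n`. -/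
def contourIntegral {A : Type*} [NormedAddCommGroup A] [NormedSpace ℂ A] {n : ℕ}
    (Γ : Fin n → ℝ → ℂ) (g : ℂ → A) : A :=
  (2 * Real.pi * Complex.I : ℂ)⁻¹ • ∑ i, ∫ t in (0 : ℝ)..1, deriv (Γ i) t • g (Γ i t)

/-- `Γ` is a cycle in `U \ K` that winds once around every point of `K` and does not wind around
any point outside `U`. -/
def Surrounds {n : ℕ} (Γ : Fin n → ℝ → ℂ) (K U : Set ℂ) : Prop :=
  (∀ i, IsPiecewiseC1Loop (Γ i)) ∧
  (∀ i, ∀ t ∈ Set.Icc (0 : ℝ) 1, Γ i t ∈ U \ K) ∧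
  (∀ w ∈ K, contourIntegral Γ (fun z => (z - w)⁻¹) = 1) ∧
  (∀ w ∉ U, contourIntegral Γ (fun z => (z - w)⁻¹) = 0)

/-- `b = f(a)` in the holomorphic functional calculus of the Banach algebra `A`: `f` is holomorphic
in an open neighbourhood `U` of the spectrum of `a`, and
`b = (2πi)⁻¹ ∮_Γ f(λ) (λ - a)⁻¹ dλ` for a cycle `Γ` in `U` that surrounds the spectrum once. -/
def IsHolomorphicCalculus {A : Type*} [NormedRing A] [NormedAlgebra ℂ A] [CompleteSpace A]
    (f : ℂ → ℂ) (a b : A) : Prop :=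
  ∃ U : Set ℂ, IsOpen U ∧ spectrum ℂ a ⊆ U ∧ DifferentiableOn ℂ f U ∧
    ∃ (n : ℕ) (Γ : Fin n → ℝ → ℂ), Surrounds Γ (spectrum ℂ a) U ∧
      b = contourIntegral Γ (fun z => f z • resolvent a z)

/-- A subset of a unital Banach algebra is closed under holomorphic functional calculus if it
contains `f(a)` for all its elements `a` and all functions `f` holomorphic in a neighbourhood of the
spectrum of `a` in the Banach algebra. -/
def IsClosedUnderHolomorphicCalculus {A : Type*} [NormedRing A] [NormedAlgebra ℂ A]
    [CompleteSpace A] (S : Set A) : Prop :=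
  ∀ a ∈ S, ∀ (f : ℂ → ℂ) (b : A), IsHolomorphicCalculus f a b → b ∈ S

end HolomorphicCalculus

end QuantumSphere

/-! The algebra is defined by expansions, for which products and inverses are hard to control. The
proof shows that it is also cut out by conditions on commutators, and these pass to sums, products,
inverses and integrals almost formally.

The conditions are collected in `frame ℓ`. On the circle they ask that the operator commute with the
shift and that all its iterated commutators with the number operator be bounded. One level higher,
on `ℓ²(ℕ) ⊗ ℓ²(Y)`, iterated commutators with the new number operator `N` and with the old ones must
be bounded. Moreover the commutator with `α_1`, and each commutator `[I ⊗ d, a]`, `[I ⊗ T, a]`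
tested by the previous frame, must stay smooth after multiplication by arbitrary powers of `N` and
of the earlier weights. Exact commutation with the amplified bilateral shift is kept.

From conditions to expansions (`Frame.Mem.isBoundedFamily`): view `a` as a block matrix `(a_{jk})`.
Decay of `[α_1, a]` makes `a_{j+i,k+i}` converge rapidly as `i → ∞`. Decay of the other commutators
makes the limit commute with everything in the previous frame, so it is a scalar
(`exists_eq_smul_one`), namely `λ_{k-j}`. The differences `a_{jk} - λ_{k-j}`, multiplied by any
power of `1 + j + k`, satisfy the previous frame uniformly in `j, k`, and induction applies. This
uniformity is the reason for working with families of operators throughout.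

From expansions to conditions (`IsBoundedFamily.frameMem`): `[N, ·]` multiplies a matrix unit by `j
- k` and `α_1^k` by `-k`. Such polynomial factors are absorbed by rapidly decreasing coefficients,
and the conditions survive absolutely convergent sums (`Frame.Mem.tsum`).

The Leibniz rule now gives products. Joint continuity follows because products of bounded sequences
are bounded (`exists_seminorm_mul_le`). For holomorphic calculus the key is `[d, a⁻¹] = -a⁻¹ [d, a]
a⁻¹` (`IsAd.inv`): the resolvent along a contour satisfies the frame because it is continuous and
bounded in norm, and so do its integrals (`Frame.Mem.average`).

The remaining claims are more direct. The scalars `λ_n` are limits along diagonals, so coefficients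
are unique, the seminorms are weighted `ℓ¹` sums and completeness follows. The terms of an expansion
lie in `A_ℓ` because `p_0 ⊗ 1` is the norm limit of `(1 - Y_1 Y_1^*)^m`. The `Y_k` have
geometrically decreasing coefficients, which also gives density. -/

namespace QuantumSphere

open Filter Topology

/-! ### Commutators with unbounded diagonal operators -/

section MatrixCoefficients

variable {X Y : Type}

/-- `a'` is the commutator of the (unbounded) diagonal operator with eigenvalues `d` and `a`. -/
def IsAd (d : X → ℝ) (a a' : L X) : Prop :=
  ∀ x y, a' (e y) x = ((d x - d y : ℝ) : ℂ) * a (e y) x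

/-- `a'` is the product of the (unbounded) diagonal operator with eigenvalues `d` and `a`. -/
def IsLeft (d : X → ℝ) (a a' : L X) : Prop :=
  ∀ x y, a' (e y) x = (d x : ℂ) * a (e y) x

theorem IsAd.unique {d : X → ℝ} {a a' a'' : L X} (h : IsAd d a a') (h' : IsAd d a a'') :
    a' = a'' :=
  ext_e fun y => by ext x; rw [h x y, h' x y]

theorem IsLeft.unique {d : X → ℝ} {a a' a'' : L X} (h : IsLeft d a a') (h' : IsLeft d a a'') :
    a' = a'' :=
  ext_e fun y => by ext x; rw [h x y, h' x y]

theorem IsAd.zero (d : X → ℝ) : IsAd d (0 : L X) 0 := fun x y => by simp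

theorem IsLeft.zero (d : X → ℝ) : IsLeft d (0 : L X) 0 := fun x y => by simp

theorem IsAd.one (d : X → ℝ) : IsAd d (1 : L X) 0 := fun x y => by
  classical
  change (0 : ℂ) = _ * (e y : H X) x
  rw [e_apply]
  split_ifs with h
  · subst h; simp
  · simp

theorem IsAd.add {d : X → ℝ} {a a' b b' : L X} (ha : IsAd d a a') (hb : IsAd d b b') :
    IsAd d (a + b) (a' + b') := fun x y => by
  change a' (e y) x + b' (e y) x = _ * (a (e y) x + b (e y) x)
  rw [ha, hb, mul_add]

theorem IsLeft.add {d : X → ℝ} {a a' b b' : L X} (ha : IsLeft d a a') (hb : IsLeft d b b') :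
    IsLeft d (a + b) (a' + b') := fun x y => by
  change a' (e y) x + b' (e y) x = _ * (a (e y) x + b (e y) x)
  rw [ha, hb, mul_add]

theorem IsAd.smul {d : X → ℝ} {a a' : L X} (c : ℂ) (ha : IsAd d a a') :
    IsAd d (c • a) (c • a') := fun x y => by
  change c * a' (e y) x = _ * (c * a (e y) x)
  rw [ha, mul_left_comm]

theorem IsLeft.smul {d : X → ℝ} {a a' : L X} (c : ℂ) (ha : IsLeft d a a') :
    IsLeft d (c • a) (c • a') := fun x y => by
  change c * a' (e y) x = _ * (c * a (e y) x)
  rw [ha, mul_left_comm]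

/-- The relation passes from basis vectors to all vectors because the rows `star a' (e x)` and `star
a (e x)` are proportional with real factor `d x`. Hence multiplication on the right needs no
condition on the other factor. -/
theorem IsLeft.apply {d : X → ℝ} {a a' : L X} (h : IsLeft d a a') (v : H X) (x : X) :
    a' v x = (d x : ℂ) * a v x := by
  have key : star a' (e x) = (d x : ℂ) • star a (e x) := by
    ext y
    rw [inner_e_star, h]
    change _ = (d x : ℂ) * (star a (e x)) y
    rw [inner_e_star]
    simp
  rw [← inner_e, ← inner_e, ← ContinuousLinearMap.adjoint_inner_left,
    ← ContinuousLinearMap.adjoint_inner_left, ← ContinuousLinearMap.star_eq_adjoint,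
    ← ContinuousLinearMap.star_eq_adjoint, key, inner_smul_left]
  simp

theorem IsLeft.mul_right {d : X → ℝ} {a a' : L X} (h : IsLeft d a a') (b : L X) :
    IsLeft d (a * b) (a' * b) := fun _ _ => h.apply _ _

theorem norm_diag_le (d : X → ℂ) (hd : ∀ x, ‖d x‖ ≤ 1) : ‖diag d hd‖ ≤ 1 := by
  unfold diag
  exact LinearMap.mkContinuous_norm_le _ zero_le_one _

/-- The resolvent `(1 + i t d)⁻¹` of a real diagonal operator. -/
noncomputable def diagRes (d : X → ℝ) (t : ℝ) : L X :=
  diag (fun x => (1 + Complex.I * (t * d x : ℝ))⁻¹) (fun x => by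
    rw [norm_inv]
    apply inv_le_one_of_one_le₀
    have := Complex.abs_re_le_norm (1 + Complex.I * (t * d x : ℝ))
    simpa using this)

theorem diagRes_ne_zero (s : ℝ) : (1 + Complex.I * (s : ℂ)) ≠ 0 := by
  intro h
  have := congrArg Complex.re h
  simp at this

theorem norm_diagRes_le (d : X → ℝ) (t : ℝ) : ‖diagRes d t‖ ≤ 1 :=
  norm_diag_le _ _

theorem diag_e (d : X → ℂ) (hd : ∀ x, ‖d x‖ ≤ 1) (y : X) : diag d hd (e y) = d y • e y := by
  classical
  ext x
  change d x * (e y : H X) x = d y * (e y : H X) x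
  rw [e_apply]
  split_ifs with h
  · rw [h]
  · simp

/-- With `R = (1 + itd)⁻¹` one has formally `Ra - aR = R (a (1 + itd) - (1 + itd) a) R = -R (it [d,
a]) R`. This replaces the unbounded `d` by a bounded operator, so that commutator rules become
algebra in `L X`. -/
theorem isAd_iff {d : X → ℝ} {a a' : L X} {t : ℝ} (ht : t ≠ 0) :
    IsAd d a a' ↔ diagRes d t * a - a * diagRes d t =
      -(diagRes d t * ((Complex.I * t) • a') * diagRes d t) := by
  have e1 : ∀ x y, (diagRes d t * a - a * diagRes d t) (e y) x =
      ((1 + Complex.I * (t * d x : ℝ))⁻¹ - (1 + Complex.I * (t * d y : ℝ))⁻¹) * a (e y) x := by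
    intro x y
    change (1 + Complex.I * (t * d x : ℝ))⁻¹ * a (e y) x - a (diagRes d t (e y)) x = _
    rw [diagRes, diag_e, map_smul]
    change _ - (1 + Complex.I * (t * d y : ℝ))⁻¹ * a (e y) x = _
    ring
  have e2 : ∀ x y, (-(diagRes d t * ((Complex.I * t) • a') * diagRes d t)) (e y) x =
      -((1 + Complex.I * (t * d x : ℝ))⁻¹ * (Complex.I * t *
        ((1 + Complex.I * (t * d y : ℝ))⁻¹ * a' (e y) x))) := by
    intro x y
    change -((1 + Complex.I * (t * d x : ℝ))⁻¹ * (Complex.I * t * a' (diagRes d t (e y)) x)) = _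
    rw [diagRes, diag_e, map_smul]
    rfl
  have ht' : (t : ℂ) ≠ 0 := by exact_mod_cast ht
  constructor
  · intro h
    refine ext_e fun y => ?_
    ext x
    rw [e1, e2, h x y]
    have h1 := diagRes_ne_zero (t * d x)
    have h2 := diagRes_ne_zero (t * d y)
    field_simp
    push_cast
    ring
  · intro h x y
    have h3 := e1 x y
    rw [h, e2] at h3
    have h1 := diagRes_ne_zero (t * d x)
    have h2 := diagRes_ne_zero (t * d y)
    field_simp at h3
    have h4 : (Complex.I * t) * a' (e y) x =
        (Complex.I * t) * (((d x - d y : ℝ) : ℂ) * a (e y) x) := by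
      push_cast at h3 ⊢
      linear_combination -h3
    exact mul_left_cancel₀ (mul_ne_zero Complex.I_ne_zero ht') h4

/-- The equation says `(1 + id) a = a + i (d a)`, with the unbounded factor inverted. -/
theorem isLeft_iff {d : X → ℝ} {a a' : L X} :
    IsLeft d a a' ↔ a = diagRes d 1 * (a + Complex.I • a') := by
  have e1 : ∀ x y, (diagRes d 1 * (a + Complex.I • a')) (e y) x =
      (1 + Complex.I * (d x : ℝ))⁻¹ * (a (e y) x + Complex.I * a' (e y) x) := fun x y => by
    change (1 + Complex.I * (1 * d x : ℝ))⁻¹ * _ = _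
    rw [one_mul]
    rfl
  constructor
  · intro h
    refine ext_e fun y => ?_
    ext x
    rw [e1, h x y]
    have h1 := diagRes_ne_zero (d x)
    field_simp
  · intro h x y
    have h3 := e1 x y
    rw [← h] at h3
    have h1 := diagRes_ne_zero (d x)
    field_simp at h3
    refine mul_left_cancel₀ Complex.I_ne_zero ?_
    push_cast at h3 ⊢
    linear_combination -h3

/-- The Leibniz rule. In the resolvent form it is pure ring theory, whereas coefficients of `a * b`
would be infinite sums. -/
theorem IsAd.mul {d : X → ℝ} {a a' b b' : L X} (ha : IsAd d a a') (hb : IsAd d b b') :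
    IsAd d (a * b) (a' * b + a * b') := by
  rw [isAd_iff one_ne_zero] at *
  set R := diagRes d 1
  rw [smul_add, ← smul_mul_assoc, ← mul_smul_comm]
  set A := (Complex.I * ((1 : ℝ) : ℂ)) • a'
  set B := (Complex.I * ((1 : ℝ) : ℂ)) • b'
  have h1 : R * a = a * R - R * A * R := by rw [sub_eq_iff_eq_add] at ha; rw [ha]; abel
  have h2 : b * R = R * b + R * B * R := by rw [sub_eq_iff_eq_add] at hb; rw [hb]; abel
  have : R * (A * b + a * B) * R = R * A * (b * R) + (R * a) * B * R := by noncomm_ring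
  rw [this, h2, h1, ← mul_assoc R a b, h1, mul_assoc a b R, h2]
  noncomm_ring

/-- The Leibniz rule for `a * c = 1` determines the commutator of `c` only if it is already known to
be bounded. To prove this, let `R = (1 + itd)⁻¹`. Then `u R = R a` and `R v = a R`, where `u, v → a`
as `t → 0`. For small `t` both are invertible, so `R c = u⁻¹ R` and `c R = R v⁻¹`, and `[R, c] = -c
[R, a] c` exhibits the bounded commutator `-v⁻¹ a' u⁻¹` of `c`. Its limit is `-c a' c`. -/
theorem IsAd.inv {d : X → ℝ} {a a' c : L X} (h1 : a * c = 1) (h2 : c * a = 1)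
    (ha : IsAd d a a') : IsAd d c (-(c * a' * c)) := by
  let u : ℝ → L X := fun t => a - diagRes d t * ((Complex.I * t) • a')
  let v : ℝ → L X := fun t => a + (Complex.I * t) • a' * diagRes d t
  have hz : Tendsto (fun t : ℝ => |t| * ‖a'‖) (𝓝[≠] 0) (𝓝 0) := by
    have : Continuous fun t : ℝ => |t| * ‖a'‖ := by fun_prop
    have := this.tendsto 0
    simp only [abs_zero, zero_mul] at this
    exact this.mono_left nhdsWithin_le_nhds
  have hu : Tendsto u (𝓝[≠] 0) (𝓝 a) := by
    have : Tendsto (fun t => diagRes d t * ((Complex.I * t) • a')) (𝓝[≠] 0) (𝓝 0) := by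
      refine squeeze_zero_norm (fun t => ?_) hz
      refine (norm_mul_le _ _).trans ?_
      rw [norm_smul]
      simp only [norm_mul, Complex.norm_I, one_mul, Complex.norm_real, Real.norm_eq_abs]
      exact mul_le_of_le_one_left (by positivity) (norm_diagRes_le d t)
    simpa [u] using tendsto_const_nhds.sub this
  have hv : Tendsto v (𝓝[≠] 0) (𝓝 a) := by
    have : Tendsto (fun t : ℝ => (Complex.I * t) • a' * diagRes d t) (𝓝[≠] 0) (𝓝 0) := by
      refine squeeze_zero_norm (fun t => ?_) hz
      refine (norm_mul_le _ _).trans ?_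
      rw [norm_smul]
      simp only [norm_mul, Complex.norm_I, one_mul, Complex.norm_real, Real.norm_eq_abs]
      exact mul_le_of_le_one_right (by positivity) (norm_diagRes_le d t)
    simpa [v] using tendsto_const_nhds.add this
  let au : (L X)ˣ := ⟨a, c, h1, h2⟩
  have hinv : Ring.inverse a = c := Ring.inverse_unit au
  have hcont : Tendsto (Ring.inverse : L X → L X) (𝓝 a) (𝓝 c) := by
    have := NormedRing.inverse_continuousAt au
    rw [← hinv]
    exact this
  have hU := hcont.comp hu
  have hV := hcont.comp hv
  have hopen : ∀ᶠ b in 𝓝 a, IsUnit b := Units.isOpen.mem_nhds ⟨au, rfl⟩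
  have hlim : Tendsto (fun t : ℝ => -(Ring.inverse (v t) * a' * Ring.inverse (u t))) (𝓝[≠] 0)
      (𝓝 (-(c * a' * c))) := ((hV.mul_const a').mul hU).neg
  have hev : ∀ᶠ t in 𝓝[≠] (0 : ℝ), IsAd d c (-(Ring.inverse (v t) * a' * Ring.inverse (u t))) := by
    filter_upwards [hu.eventually hopen, hv.eventually hopen, self_mem_nhdsWithin] with t hut hvt ht
    rw [isAd_iff ht] at ha ⊢
    set R := diagRes d t
    have hua : R * c = Ring.inverse (u t) * R := by
      have : u t * R = R * a := by
        simp only [u]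
        rw [sub_mul]
        rw [sub_eq_iff_eq_add] at ha
        rw [ha]; abel
      calc R * c = Ring.inverse (u t) * (u t * R) * c := by
            rw [← mul_assoc, Ring.inverse_mul_cancel _ hut, one_mul]
        _ = _ := by rw [this, mul_assoc, mul_assoc, h1, mul_one]
    have hva : c * R = R * Ring.inverse (v t) := by
      have : R * v t = a * R := by
        simp only [v]
        rw [mul_add]
        rw [sub_eq_iff_eq_add] at ha
        rw [ha]; noncomm_ring
      calc c * R = c * (R * v t) * Ring.inverse (v t) := by
            rw [mul_assoc, mul_assoc, Ring.mul_inverse_cancel _ hvt, mul_one]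
        _ = _ := by rw [this, ← mul_assoc c, h2, one_mul]
    have e1 : R * c - c * R = -(c * (R * a - a * R) * c) := by
      have : c * (R * a - a * R) * c = c * R * (a * c) - (c * a) * R * c := by noncomm_ring
      rw [this, h1, h2, mul_one, one_mul, neg_sub]
    rw [e1, ha]
    have : c * -(R * (Complex.I * t) • a' * R) * c = -((c * R) * ((Complex.I * t) • a') * (R * c)) := by
      noncomm_ring
    rw [this, hua, hva]
    simp only [smul_neg, mul_neg, neg_mul, neg_neg, mul_smul_comm, smul_mul_assoc]
    simp only [mul_assoc]
  intro x y
  have hl : Tendsto (fun t => (-(Ring.inverse (v t) * a' * Ring.inverse (u t))) (e y) x) (𝓝[≠] 0)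
      (𝓝 ((-(c * a' * c)) (e y) x)) := by
    have hc : Continuous fun b : L X => b (e y) x := by
      simp only [← inner_e]
      fun_prop
    exact (hc.tendsto _).comp hlim
  -- The coefficients of `[d, c]` do not depend on `t`, so the approximations are eventually
  -- constant in each coefficient.
  refine tendsto_nhds_unique hl (tendsto_const_nhds.congr' ?_)
  filter_upwards [hev] with t ht
  exact (ht x y).symm

/-- `ad_d (d' a) = d' (ad_d a)`. -/
theorem IsLeft.ad {d d' : X → ℝ} {a a' b b' : L X} (h : IsLeft d a a') (hb : IsAd d' a b)
    (hb' : IsAd d' a' b') : IsLeft d b b' := fun x y => by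
  rw [hb' x y, h x y, hb x y, mul_left_comm]

/-- `d (a b) = [d, a] b + a (d b)`. -/
theorem IsLeft.mul_left {d : X → ℝ} {a a' b b' : L X} (ha : IsAd d a a') (hb : IsLeft d b b') :
    IsLeft d (a * b) (a' * b + a * b') := by
  rw [isLeft_iff] at *
  rw [isAd_iff one_ne_zero] at ha
  set R := diagRes d 1
  have h1 : a * R = R * a + R * ((Complex.I * (1 : ℝ)) • a') * R := by
    rw [sub_eq_iff_eq_add] at ha; rw [ha]; abel
  calc a * b = (a * R) * (b + Complex.I • b') := by rw [mul_assoc, ← hb]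
    _ = R * (a * (b + Complex.I • b')) + R * (((Complex.I * (1 : ℝ)) • a') *
        (R * (b + Complex.I • b'))) := by rw [h1]; simp only [mul_assoc, add_mul]
    _ = _ := by
      rw [← hb, ← mul_add]
      simp only [Complex.ofReal_one, mul_one, mul_add, smul_add, mul_smul_comm, smul_mul_assoc]
      abel

end MatrixCoefficients

end QuantumSphere


namespace QuantumSphere

open Filter Topology

/-! ### Smooth and rapidly decreasing families, and the conditions of a frame -/

section Families

variable {X K : Type} [TopologicalSpace K]

/-- Bounded continuous families of operators. -/
def IsBC (a : K → L X) : Prop := Continuous a ∧ ∃ C : ℝ, ∀ t, ‖a t‖ ≤ C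

theorem IsBC.zero : IsBC (fun _ : K => (0 : L X)) := ⟨continuous_const, 0, fun _ => by simp⟩

theorem IsBC.add {a b : K → L X} (ha : IsBC a) (hb : IsBC b) : IsBC fun t => a t + b t := by
  obtain ⟨ha, C, hC⟩ := ha
  obtain ⟨hb, D, hD⟩ := hb
  exact ⟨ha.add hb, C + D, fun t => (norm_add_le _ _).trans (add_le_add (hC t) (hD t))⟩

theorem IsBC.mul {a b : K → L X} (ha : IsBC a) (hb : IsBC b) : IsBC fun t => a t * b t := by
  obtain ⟨ha, C, hC⟩ := ha
  obtain ⟨hb, D, hD⟩ := hb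
  exact ⟨ha.mul hb, C * D, fun t => (norm_mul_le _ _).trans (mul_le_mul (hC t) (hD t)
    (norm_nonneg _) ((norm_nonneg _).trans (hC t)))⟩

theorem IsBC.smul {a : K → L X} (c : ℂ) (ha : IsBC a) : IsBC fun t => c • a t := by
  obtain ⟨ha, C, hC⟩ := ha
  exact ⟨ha.const_smul c, ‖c‖ * C, fun t => (norm_smul_le _ _).trans
    (mul_le_mul_of_nonneg_left (hC t) (norm_nonneg _))⟩

theorem IsBC.comp {K' : Type} [TopologicalSpace K'] {a : K → L X} (ha : IsBC a) {f : K' → K}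
    (hf : Continuous f) : IsBC fun t => a (f t) := by
  obtain ⟨ha, C, hC⟩ := ha
  exact ⟨ha.comp hf, C, fun t => hC _⟩

/-- Families for which all `n`-fold commutators with the diagonal operators in `G` are bounded. -/
def AdSmooth (G : Set (X → ℝ)) : ℕ → (K → L X) → Prop
  | 0, a => IsBC a
  | n + 1, a => IsBC a ∧ ∀ d ∈ G, ∃ a' : K → L X, AdSmooth G n a' ∧ ∀ t, IsAd d (a t) (a' t)

variable {G : Set (X → ℝ)}

theorem AdSmooth.isBC : ∀ {n : ℕ} {a : K → L X}, AdSmooth G n a → IsBC a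
  | 0, _, h => h
  | _ + 1, _, h => h.1

theorem AdSmooth.of_succ : ∀ {n : ℕ} {a : K → L X}, AdSmooth G (n + 1) a → AdSmooth G n a
  | 0, _, h => h.1
  | _ + 1, _, h => ⟨h.1, fun d hd => by
      obtain ⟨a', h', h''⟩ := h.2 d hd
      exact ⟨a', h'.of_succ, h''⟩⟩

theorem AdSmooth.zero : ∀ n : ℕ, AdSmooth G n fun _ : K => (0 : L X)
  | 0 => IsBC.zero
  | n + 1 => ⟨IsBC.zero, fun d _ => ⟨_, AdSmooth.zero n, fun _ => IsAd.zero d⟩⟩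

theorem AdSmooth.add : ∀ {n : ℕ} {a b : K → L X}, AdSmooth G n a → AdSmooth G n b →
    AdSmooth G n fun t => a t + b t
  | 0, _, _, ha, hb => IsBC.add ha hb
  | _ + 1, _, _, ha, hb => ⟨ha.1.add hb.1, fun d hd => by
      obtain ⟨a', h', h''⟩ := ha.2 d hd
      obtain ⟨b', k', k''⟩ := hb.2 d hd
      exact ⟨_, h'.add k', fun t => (h'' t).add (k'' t)⟩⟩

theorem AdSmooth.smul (c : ℂ) : ∀ {n : ℕ} {a : K → L X}, AdSmooth G n a →
    AdSmooth G n fun t => c • a t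
  | 0, _, ha => IsBC.smul c ha
  | _ + 1, _, ha => ⟨ha.1.smul c, fun d hd => by
      obtain ⟨a', h', h''⟩ := ha.2 d hd
      exact ⟨_, h'.smul c, fun t => (h'' t).smul c⟩⟩

theorem AdSmooth.comp {K' : Type} [TopologicalSpace K'] {f : K' → K} (hf : Continuous f) :
    ∀ {n : ℕ} {a : K → L X}, AdSmooth G n a → AdSmooth G n fun t => a (f t)
  | 0, _, ha => IsBC.comp ha hf
  | _ + 1, _, ha => ⟨ha.1.comp hf, fun d hd => by
      obtain ⟨a', h', h''⟩ := ha.2 d hd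
      exact ⟨_, h'.comp hf, fun t => h'' (f t)⟩⟩

theorem AdSmooth.mul : ∀ {n : ℕ} {a b : K → L X}, AdSmooth G n a → AdSmooth G n b →
    AdSmooth G n fun t => a t * b t
  | 0, _, _, ha, hb => IsBC.mul ha hb
  | _ + 1, _, _, ha, hb => ⟨ha.1.mul hb.1, fun d hd => by
      obtain ⟨a', h', h''⟩ := ha.2 d hd
      obtain ⟨b', k', k''⟩ := hb.2 d hd
      exact ⟨_, (h'.mul hb.of_succ).add (ha.of_succ.mul k'), fun t => (h'' t).mul (k'' t)⟩⟩

theorem AdSmooth.neg {n : ℕ} {a : K → L X} (ha : AdSmooth G n a) :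
    AdSmooth G n fun t => -a t := by
  simpa using ha.smul (-1)

/-- The commutator `-c a' c` involves `c` only to order `n`, so induction on the order starts from
mere continuity and boundedness of `c`. -/
theorem AdSmooth.inv {a c : K → L X} (h1 : ∀ t, a t * c t = 1) (h2 : ∀ t, c t * a t = 1)
    (hc : IsBC c) : ∀ {n : ℕ}, AdSmooth G n a → AdSmooth G n c
  | 0, _ => hc
  | _ + 1, ha => ⟨hc, fun d hd => by
      obtain ⟨a', h', h''⟩ := ha.2 d hd
      have := AdSmooth.inv h1 h2 hc ha.of_succ
      exact ⟨_, ((this.mul h').mul this).neg, fun t => (h'' t).inv (h1 t) (h2 t)⟩⟩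

/-- Families for which all iterated commutators with the diagonal operators in `G` are bounded. -/
def IsSmooth (G : Set (X → ℝ)) (a : K → L X) : Prop := ∀ n, AdSmooth G n a

theorem IsSmooth.zero : IsSmooth G fun _ : K => (0 : L X) := AdSmooth.zero

theorem IsSmooth.add {a b : K → L X} (ha : IsSmooth G a) (hb : IsSmooth G b) :
    IsSmooth G fun t => a t + b t := fun n => (ha n).add (hb n)

theorem IsSmooth.smul {a : K → L X} (c : ℂ) (ha : IsSmooth G a) :
    IsSmooth G fun t => c • a t := fun n => (ha n).smul c

theorem IsSmooth.mul {a b : K → L X} (ha : IsSmooth G a) (hb : IsSmooth G b) :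
    IsSmooth G fun t => a t * b t := fun n => (ha n).mul (hb n)

theorem IsSmooth.comp {K' : Type} [TopologicalSpace K'] {f : K' → K} (hf : Continuous f)
    {a : K → L X} (ha : IsSmooth G a) : IsSmooth G fun t => a (f t) := fun n => (ha n).comp hf

/-- Each order supplies its own commutator family; they coincide because matrix coefficients
determine the operator. -/
theorem IsSmooth.exists_ad {a : K → L X} (ha : IsSmooth G a) {d : X → ℝ} (hd : d ∈ G) :
    ∃ a' : K → L X, IsSmooth G a' ∧ ∀ t, IsAd d (a t) (a' t) := by
  obtain ⟨a', -, h⟩ := (ha 1).2 d hd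
  refine ⟨a', fun n => ?_, h⟩
  obtain ⟨a'', h'', h'⟩ := (ha (n + 1)).2 d hd
  have : a' = a'' := funext fun t => (h t).unique (h' t)
  rwa [this]

theorem IsSmooth.of_ad {a : K → L X} (h : IsBC a)
    (h' : ∀ d ∈ G, ∃ a' : K → L X, IsSmooth G a' ∧ ∀ t, IsAd d (a t) (a' t)) : IsSmooth G a
  | 0 => h
  | n + 1 => ⟨h, fun d hd => by
      obtain ⟨a', h1, h2⟩ := h' d hd
      exact ⟨a', h1 n, h2⟩⟩

/-- Smooth families whose products with any `n` diagonal operators in `W` are smooth. -/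
def LeftDecay (G W : Set (X → ℝ)) : ℕ → (K → L X) → Prop
  | 0, a => IsSmooth G a
  | n + 1, a => IsSmooth G a ∧ ∀ d ∈ W, ∃ a' : K → L X, LeftDecay G W n a' ∧
      ∀ t, IsLeft d (a t) (a' t)

variable {W : Set (X → ℝ)}

theorem LeftDecay.isSmooth : ∀ {n : ℕ} {a : K → L X}, LeftDecay G W n a → IsSmooth G a
  | 0, _, h => h
  | _ + 1, _, h => h.1

theorem LeftDecay.of_succ : ∀ {n : ℕ} {a : K → L X}, LeftDecay G W (n + 1) a → LeftDecay G W n a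
  | 0, _, h => h.1
  | _ + 1, _, h => ⟨h.1, fun d hd => by
      obtain ⟨a', h', h''⟩ := h.2 d hd
      exact ⟨a', h'.of_succ, h''⟩⟩

theorem LeftDecay.zero : ∀ n : ℕ, LeftDecay G W n fun _ : K => (0 : L X)
  | 0 => IsSmooth.zero
  | n + 1 => ⟨IsSmooth.zero, fun d _ => ⟨_, LeftDecay.zero n, fun _ => IsLeft.zero d⟩⟩

theorem LeftDecay.add : ∀ {n : ℕ} {a b : K → L X}, LeftDecay G W n a → LeftDecay G W n b →
    LeftDecay G W n fun t => a t + b t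
  | 0, _, _, ha, hb => IsSmooth.add ha hb
  | _ + 1, _, _, ha, hb => ⟨ha.1.add hb.1, fun d hd => by
      obtain ⟨a', h', h''⟩ := ha.2 d hd
      obtain ⟨b', k', k''⟩ := hb.2 d hd
      exact ⟨_, h'.add k', fun t => (h'' t).add (k'' t)⟩⟩

theorem LeftDecay.smul (c : ℂ) : ∀ {n : ℕ} {a : K → L X}, LeftDecay G W n a →
    LeftDecay G W n fun t => c • a t
  | 0, _, ha => IsSmooth.smul c ha
  | _ + 1, _, ha => ⟨ha.1.smul c, fun d hd => by
      obtain ⟨a', h', h''⟩ := ha.2 d hd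
      exact ⟨_, h'.smul c, fun t => (h'' t).smul c⟩⟩

theorem LeftDecay.comp {K' : Type} [TopologicalSpace K'] {f : K' → K} (hf : Continuous f) :
    ∀ {n : ℕ} {a : K → L X}, LeftDecay G W n a → LeftDecay G W n fun t => a (f t)
  | 0, _, ha => IsSmooth.comp hf ha
  | _ + 1, _, ha => ⟨ha.1.comp hf, fun d hd => by
      obtain ⟨a', h', h''⟩ := ha.2 d hd
      exact ⟨_, h'.comp hf, fun t => h'' (f t)⟩⟩

theorem LeftDecay.mul_right : ∀ {n : ℕ} {a b : K → L X}, LeftDecay G W n a → IsSmooth G b →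
    LeftDecay G W n fun t => a t * b t
  | 0, _, _, ha, hb => IsSmooth.mul ha hb
  | _ + 1, _, _, ha, hb => ⟨ha.1.mul hb, fun d hd => by
      obtain ⟨a', h', h''⟩ := ha.2 d hd
      exact ⟨_, h'.mul_right hb, fun t => (h'' t).mul_right _⟩⟩

/-- Moving a weight `d` past `a` costs the commutator `[d, a]`, which is controlled only if `d` is
one of the coordinates; hence `W ⊆ G`. -/
theorem LeftDecay.mul_left (hW : W ⊆ G) : ∀ {n : ℕ} {a b : K → L X}, IsSmooth G a →
    LeftDecay G W n b → LeftDecay G W n fun t => a t * b t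
  | 0, _, _, ha, hb => IsSmooth.mul ha hb
  | _ + 1, _, _, ha, hb => ⟨ha.mul hb.1, fun d hd => by
      obtain ⟨a', h', h''⟩ := ha.exists_ad (hW hd)
      obtain ⟨b', k', k''⟩ := hb.2 d hd
      exact ⟨_, (LeftDecay.mul_left hW h' hb.of_succ).add (LeftDecay.mul_left hW ha k'),
        fun t => (k'' t).mul_left (h'' t)⟩⟩

/-- Commutators with diagonal operators preserve decay. -/
theorem LeftDecay.ad {d : X → ℝ} (hd : d ∈ G) : ∀ {n : ℕ} {a a' : K → L X},
    LeftDecay G W n a → (∀ t, IsAd d (a t) (a' t)) → LeftDecay G W n a'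
  | 0, a, a', ha, h => by
      obtain ⟨a'', h1, h2⟩ := IsSmooth.exists_ad ha hd
      have : a' = a'' := funext fun t => (h t).unique (h2 t)
      rwa [this]
  | n + 1, a, a', ha, h => by
      obtain ⟨a'', h1, h2⟩ := ha.1.exists_ad hd
      have : a' = a'' := funext fun t => (h t).unique (h2 t)
      subst this
      refine ⟨h1, fun w hw => ?_⟩
      obtain ⟨b, k1, k2⟩ := ha.2 w hw
      obtain ⟨b', l1, l2⟩ := k1.isSmooth.exists_ad hd
      exact ⟨b', LeftDecay.ad hd k1 l2, fun t => (k2 t).ad (h t) (l2 t)⟩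

/-- Smooth families whose products with any number of diagonal operators in `W` are smooth. -/
def IsRapid (G W : Set (X → ℝ)) (a : K → L X) : Prop := ∀ n, LeftDecay G W n a

theorem IsRapid.isSmooth {a : K → L X} (ha : IsRapid G W a) : IsSmooth G a := ha 0

theorem IsRapid.zero : IsRapid G W fun _ : K => (0 : L X) := LeftDecay.zero

theorem IsRapid.add {a b : K → L X} (ha : IsRapid G W a) (hb : IsRapid G W b) :
    IsRapid G W fun t => a t + b t := fun n => (ha n).add (hb n)

theorem IsRapid.smul {a : K → L X} (c : ℂ) (ha : IsRapid G W a) :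
    IsRapid G W fun t => c • a t := fun n => (ha n).smul c

theorem IsRapid.neg {a : K → L X} (ha : IsRapid G W a) : IsRapid G W fun t => -a t := by
  simpa using ha.smul (-1)

theorem IsRapid.sub {a b : K → L X} (ha : IsRapid G W a) (hb : IsRapid G W b) :
    IsRapid G W fun t => a t - b t := by
  simpa only [sub_eq_add_neg] using ha.add hb.neg

theorem IsRapid.comp {K' : Type} [TopologicalSpace K'] {f : K' → K} (hf : Continuous f)
    {a : K → L X} (ha : IsRapid G W a) : IsRapid G W fun t => a (f t) := fun n => (ha n).comp hf

theorem IsRapid.mul_right {a b : K → L X} (ha : IsRapid G W a) (hb : IsSmooth G b) :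
    IsRapid G W fun t => a t * b t := fun n => (ha n).mul_right hb

theorem IsRapid.mul_left (hW : W ⊆ G) {a b : K → L X} (ha : IsSmooth G a) (hb : IsRapid G W b) :
    IsRapid G W fun t => a t * b t := fun n => (hb n).mul_left hW ha

theorem IsRapid.ad {d : X → ℝ} (hd : d ∈ G) {a a' : K → L X} (ha : IsRapid G W a)
    (h : ∀ t, IsAd d (a t) (a' t)) : IsRapid G W a' := fun n => (ha n).ad hd h

theorem IsRapid.exists_left {d : X → ℝ} (hd : d ∈ W) {a : K → L X} (ha : IsRapid G W a) :
    ∃ a' : K → L X, IsRapid G W a' ∧ ∀ t, IsLeft d (a t) (a' t) := by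
  obtain ⟨a', -, h⟩ := (ha 1).2 d hd
  refine ⟨a', fun n => ?_, h⟩
  obtain ⟨a'', h'', h'⟩ := (ha (n + 1)).2 d hd
  have : a' = a'' := funext fun t => (h t).unique (h' t)
  rwa [this]

/-- Conditions on operators: `(d, W) ∈ F.ad` asks for the decay, with respect to `W`, of the
commutator with the diagonal operator `d`, `(T, W) ∈ F.comm` for that of the commutator with `T`,
and `T ∈ F.rigid` asks for commutation with `T`. -/
structure Frame (X : Type) where
  ad : Set ((X → ℝ) × Set (X → ℝ))
  comm : Set (L X × Set (X → ℝ))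
  rigid : Set (L X)

/-- The diagonal operators of a frame. -/
def Frame.coords (F : Frame X) : Set (X → ℝ) := Prod.fst '' F.ad

/-- The families that satisfy the conditions of the frame. -/
structure Frame.Mem (F : Frame X) (a : K → L X) : Prop where
  smooth : IsSmooth F.coords a
  ad : ∀ p ∈ F.ad, ∃ a' : K → L X, IsRapid F.coords p.2 a' ∧ ∀ t, IsAd p.1 (a t) (a' t)
  comm : ∀ p ∈ F.comm, IsRapid F.coords p.2 fun t => p.1 * a t - a t * p.1
  rigid : ∀ T ∈ F.rigid, ∀ t, T * a t = a t * T

/-- The weights of a frame are among its coordinates. -/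
structure Frame.Good (F : Frame X) : Prop where
  ad : ∀ p ∈ F.ad, p.2 ⊆ F.coords
  comm : ∀ p ∈ F.comm, p.2 ⊆ F.coords

variable {F : Frame X}

/-- Smoothness comes for free: the coordinates are exactly the first components of `F.ad`, and there
the first commutators are already assumed rapid, hence smooth. -/
theorem Frame.Mem.of_ad {a : K → L X} (h0 : IsBC a)
    (h1 : ∀ p ∈ F.ad, ∃ a' : K → L X, IsRapid F.coords p.2 a' ∧ ∀ t, IsAd p.1 (a t) (a' t))
    (h2 : ∀ p ∈ F.comm, IsRapid F.coords p.2 fun t => p.1 * a t - a t * p.1)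
    (h3 : ∀ T ∈ F.rigid, ∀ t, T * a t = a t * T) : F.Mem a where
  smooth := IsSmooth.of_ad h0 (by
    rintro _ ⟨p, hp, rfl⟩
    obtain ⟨a', h, h'⟩ := h1 p hp
    exact ⟨a', h.isSmooth, h'⟩)
  ad := h1
  comm := h2
  rigid := h3

theorem Frame.Mem.comp {K' : Type} [TopologicalSpace K'] {f : K' → K} (hf : Continuous f)
    {a : K → L X} (ha : F.Mem a) : F.Mem fun t => a (f t) where
  smooth := ha.smooth.comp hf
  ad p hp := by
    obtain ⟨a', h, h'⟩ := ha.ad p hp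
    exact ⟨_, h.comp hf, fun t => h' _⟩
  comm p hp := (ha.comm p hp).comp hf
  rigid T hT t := ha.rigid T hT _

theorem Frame.Mem.add {a b : K → L X} (ha : F.Mem a) (hb : F.Mem b) :
    F.Mem fun t => a t + b t where
  smooth := ha.smooth.add hb.smooth
  ad p hp := by
    obtain ⟨a', h, h'⟩ := ha.ad p hp
    obtain ⟨b', k, k'⟩ := hb.ad p hp
    exact ⟨_, h.add k, fun t => (h' t).add (k' t)⟩
  comm p hp := by
    have := (ha.comm p hp).add (hb.comm p hp)
    convert this using 2 with t
    noncomm_ring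
  rigid T hT t := by rw [mul_add, add_mul, ha.rigid T hT, hb.rigid T hT]

theorem Frame.Mem.mul (hF : F.Good) {a b : K → L X} (ha : F.Mem a) (hb : F.Mem b) :
    F.Mem fun t => a t * b t where
  smooth := ha.smooth.mul hb.smooth
  ad p hp := by
    obtain ⟨a', h, h'⟩ := ha.ad p hp
    obtain ⟨b', k, k'⟩ := hb.ad p hp
    exact ⟨_, (h.mul_right hb.smooth).add (k.mul_left (hF.ad p hp) ha.smooth),
      fun t => (h' t).mul (k' t)⟩
  comm p hp := by
    have := ((ha.comm p hp).mul_right hb.smooth).add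
      ((hb.comm p hp).mul_left (hF.comm p hp) ha.smooth)
    convert this using 2 with t
    noncomm_ring
  rigid T hT t := by rw [← mul_assoc, ha.rigid T hT, mul_assoc, hb.rigid T hT, mul_assoc]

/-- Every commutator of `c` has the form `-c [·, a] c`, and for a good frame the rapid families form
a two-sided ideal in the smooth ones. So all conditions pass to the inverse as soon as it is
continuous and bounded in norm; this is the source of spectral invariance. -/
theorem Frame.Mem.inv (hF : F.Good) {a c : K → L X} (ha : F.Mem a) (h1 : ∀ t, a t * c t = 1)
    (h2 : ∀ t, c t * a t = 1) (hc : IsBC c) : F.Mem c := by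
  have hs : IsSmooth F.coords c := fun n => (ha.smooth n).inv h1 h2 hc
  have key : ∀ t (T : L X), T * c t - c t * T = -(c t * (T * a t - a t * T) * c t) := by
    intro t T
    have : c t * (T * a t - a t * T) * c t = c t * T * (a t * c t) - (c t * a t) * T * c t := by
      noncomm_ring
    rw [this, h1, h2, mul_one, one_mul, neg_sub]
  refine ⟨hs, fun p hp => ?_, fun p hp => ?_, fun T hT t => ?_⟩
  · obtain ⟨a', h, h'⟩ := ha.ad p hp
    exact ⟨_, ((h.mul_left (hF.ad p hp) hs).mul_right hs).neg,
      fun t => (h' t).inv (h1 t) (h2 t)⟩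
  · have := (((ha.comm p hp).mul_left (hF.comm p hp) hs).mul_right hs).neg
    convert this using 2 with t
    exact key t p.1
  · rw [← sub_eq_zero, key, ha.rigid T hT, sub_self, mul_zero, zero_mul, neg_zero]

theorem Frame.Mem.scalar {g : K → ℂ} (hg : Continuous g) (hb : ∃ C, ∀ t, ‖g t‖ ≤ C) :
    F.Mem fun t => g t • (1 : L X) := by
  have h : ∀ d : X → ℝ, ∀ t, IsAd d (g t • (1 : L X)) 0 := fun d t => by
    simpa using (IsAd.one d).smul (g t)
  refine .of_ad ⟨by fun_prop, ?_⟩ (fun p _ => ⟨_, IsRapid.zero, h p.1⟩) (fun p _ => ?_)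
    (fun T _ t => by simp)
  · obtain ⟨C, hC⟩ := hb
    refine ⟨C * ‖(1 : L X)‖, fun t => ?_⟩
    rw [norm_smul]
    exact mul_le_mul_of_nonneg_right (hC t) (norm_nonneg _)
  · convert IsRapid.zero using 2 with t
    simp

end Families

end QuantumSphere


namespace QuantumSphere

open Filter Topology MeasureTheory

/-! ### Integrals and sums of families -/

section Averages

variable {X K ι : Type} [TopologicalSpace K] [TopologicalSpace ι] [MeasurableSpace ι]
  {μ : Measure ι} {g : ι → ℂ}

/-- The matrix coefficient `a ↦ ⟨e_x, a e_y⟩` as a continuous functional. -/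
noncomputable def coefL (x y : X) : L X →L[ℂ] ℂ :=
  (innerSL ℂ (e x)).comp (ContinuousLinearMap.apply ℂ (H X) (e y))

theorem coefL_apply (x y : X) (a : L X) : coefL x y a = a (e y) x := inner_e x _

/-- Continuity in the integration variable is used up by the integral. The remaining parameter is
discrete, so only a uniform bound is at stake. -/
theorem IsBC.average [DiscreteTopology K] {u : K × ι → L X} (hu : IsBC u) (hg : Integrable g μ) :
    IsBC fun t => ∫ i, g i • u (t, i) ∂μ := by
  refine ⟨continuous_of_discreteTopology, ?_⟩
  obtain ⟨C, hC⟩ := hu.2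
  refine ⟨∫ i, ‖g i‖ * C ∂μ, fun t => norm_integral_le_of_norm_le (hg.norm.mul_const C)
    (Eventually.of_forall fun i => ?_)⟩
  rw [norm_smul]
  exact mul_le_mul_of_nonneg_left (hC _) (norm_nonneg _)

variable [SecondCountableTopology ι] [OpensMeasurableSpace ι]

theorem IsBC.integrable {u : K × ι → L X} (hu : IsBC u) (hg : Integrable g μ) (t : K) :
    Integrable (fun i => g i • u (t, i)) μ := by
  obtain ⟨h, C, hC⟩ := hu
  have h' : AEStronglyMeasurable (fun i => u (t, i)) μ :=
    Continuous.aestronglyMeasurable (by fun_prop)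
  exact hg.smul_bdd C h' (Eventually.of_forall fun i => hC _)

theorem coef_average {u : K × ι → L X} (hu : IsBC u) (hg : Integrable g μ) (t : K) (x y : X) :
    (∫ i, g i • u (t, i) ∂μ) (e y) x = ∫ i, g i * u (t, i) (e y) x ∂μ := by
  rw [← coefL_apply, ← (coefL x y).integral_comp_comm (hu.integrable hg t)]
  simp only [map_smul, coefL_apply, smul_eq_mul]

theorem IsAd.average {d : X → ℝ} {u u' : K × ι → L X} (hu : IsBC u) (hu' : IsBC u')
    (hg : Integrable g μ) (h : ∀ s, IsAd d (u s) (u' s)) (t : K) :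
    IsAd d (∫ i, g i • u (t, i) ∂μ) (∫ i, g i • u' (t, i) ∂μ) := fun x y => by
  rw [coef_average hu hg, coef_average hu' hg, ← integral_const_mul]
  refine integral_congr_ae (Eventually.of_forall fun i => ?_)
  simp only [h (t, i) x y]
  ring

theorem IsLeft.average {d : X → ℝ} {u u' : K × ι → L X} (hu : IsBC u) (hu' : IsBC u')
    (hg : Integrable g μ) (h : ∀ s, IsLeft d (u s) (u' s)) (t : K) :
    IsLeft d (∫ i, g i • u (t, i) ∂μ) (∫ i, g i • u' (t, i) ∂μ) := fun x y => by
  rw [coef_average hu hg, coef_average hu' hg, ← integral_const_mul]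
  refine integral_congr_ae (Eventually.of_forall fun i => ?_)
  simp only [h (t, i) x y]
  ring

theorem integral_commutator {u : K × ι → L X} (hu : IsBC u) (hg : Integrable g μ) (T : L X)
    (t : K) : T * (∫ i, g i • u (t, i) ∂μ) - (∫ i, g i • u (t, i) ∂μ) * T =
      ∫ i, g i • (T * u (t, i) - u (t, i) * T) ∂μ := by
  have h := hu.integrable hg t
  let Λ : L X →L[ℂ] L X := ContinuousLinearMap.mul ℂ (L X) T -
    (ContinuousLinearMap.mul ℂ (L X)).flip T
  have := Λ.integral_comp_comm h
  simp only [map_smul] at this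
  exact this.symm

variable {G W : Set (X → ℝ)}

variable [DiscreteTopology K]

theorem AdSmooth.average (hg : Integrable g μ) : ∀ {n : ℕ} {u : K × ι → L X}, AdSmooth G n u →
    AdSmooth G n fun t => ∫ i, g i • u (t, i) ∂μ
  | 0, _, hu => IsBC.average hu hg
  | _ + 1, _, hu => ⟨hu.1.average hg, fun d hd => by
      obtain ⟨u', h, h'⟩ := hu.2 d hd
      exact ⟨_, h.average hg, IsAd.average hu.1 h.isBC hg h'⟩⟩

theorem IsSmooth.average {u : K × ι → L X} (hu : IsSmooth G u) (hg : Integrable g μ) :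
    IsSmooth G fun t => ∫ i, g i • u (t, i) ∂μ := fun n => (hu n).average hg

theorem LeftDecay.average (hg : Integrable g μ) : ∀ {n : ℕ} {u : K × ι → L X},
    LeftDecay G W n u → LeftDecay G W n fun t => ∫ i, g i • u (t, i) ∂μ
  | 0, _, hu => IsSmooth.average hu hg
  | _ + 1, _, hu => ⟨hu.1.average hg, fun d hd => by
      obtain ⟨u', h, h'⟩ := hu.2 d hd
      exact ⟨_, h.average hg, IsLeft.average (hu.1 0) (h.isSmooth 0) hg h'⟩⟩

theorem IsRapid.average {u : K × ι → L X} (hu : IsRapid G W u) (hg : Integrable g μ) :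
    IsRapid G W fun t => ∫ i, g i • u (t, i) ∂μ := fun n => (hu n).average hg

/-- The conditions of a frame are stable under averages. -/
theorem Frame.Mem.average {F : Frame X} {u : K × ι → L X} (hu : F.Mem u) (hg : Integrable g μ) :
    F.Mem fun t => ∫ i, g i • u (t, i) ∂μ where
  smooth := hu.smooth.average hg
  ad p hp := by
    obtain ⟨u', h, h'⟩ := hu.ad p hp
    exact ⟨_, h.average hg, IsAd.average (hu.smooth 0) (h.isSmooth 0) hg h'⟩
  comm p hp := by
    have := (hu.comm p hp).average hg
    convert this using 2 with t
    exact integral_commutator (hu.smooth 0) hg p.1 t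
  rigid T hT t := by
    rw [← sub_eq_zero, integral_commutator (hu.smooth 0) hg]
    simp [hu.rigid T hT]

end Averages

/-- The conditions of a frame are stable under sums with summable coefficients. -/
theorem Frame.Mem.tsum {X K ι : Type} [TopologicalSpace K] [DiscreteTopology K] {F : Frame X}
    [Countable ι] [TopologicalSpace ι]
    [DiscreteTopology ι] {u : K × ι → L X} (hu : F.Mem u) {g : ι → ℂ}
    (hg : Summable g) : F.Mem fun t => ∑' i, g i • u (t, i) := by
  let _ : MeasurableSpace ι := ⊤
  have _ : DiscreteMeasurableSpace ι := ⟨fun _ => trivial⟩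
  -- A sum with summable coefficients is an average against counting measure.
  have hg' : Integrable g Measure.count := integrable_count_iff.2 hg.norm
  have := hu.average hg'
  convert this using 2 with t
  rw [integral_countable (IsBC.integrable (hu.smooth 0) hg' t)]
  simp

end QuantumSphere


namespace QuantumSphere

open Filter Topology

/-! ### Block matrices on `ℓ²(ℕ) ⊗ ℓ²(Y)` -/

noncomputable section Entries

variable {Y : Type}

theorem norm_slice_le (k : ℕ) : ‖(slice k : H (ℕ × Y) →L[ℂ] H Y)‖ ≤ 1 := by
  unfold slice pull
  exact LinearMap.mkContinuous_norm_le _ zero_le_one _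

/-- The embedding `v ↦ e_k ⊗ v`. -/
def inc (k : ℕ) : H Y →L[ℂ] H (ℕ × Y) := ContinuousLinearMap.adjoint (slice k)

theorem norm_inc_le (k : ℕ) : ‖(inc k : H Y →L[ℂ] H (ℕ × Y))‖ ≤ 1 := by
  rw [inc, LinearIsometryEquiv.norm_map]
  exact norm_slice_le k

theorem slice_inc (j k : ℕ) (v : H Y) : slice j (inc k v) = if j = k then v else 0 := by
  classical
  ext y
  rw [slice_apply, ← inner_e, inc, ContinuousLinearMap.adjoint_inner_right, slice_e]
  by_cases h : j = k
  · subst h; simp [inner_e]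
  · simp [h, Ne.symm h]

theorem inc_apply (j k : ℕ) (y : Y) (v : H Y) : inc k v (j, y) = if j = k then v y else 0 := by
  rw [← slice_apply, slice_inc]
  split_ifs <;> rfl

theorem inc_e (k : ℕ) (y : Y) : inc k (e y) = e (k, y) := by
  classical
  ext ⟨j, z⟩
  rw [inc_apply, e_apply, e_apply]
  simp only [Prod.mk.injEq, ite_and]

/-- The `(j, k)`-th entry of an operator on `ℓ²(ℕ) ⊗ ℓ²(Y)`. -/
def entry (j k : ℕ) : L (ℕ × Y) →L[ℂ] L Y :=
  LinearMap.mkContinuous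
    { toFun := fun a => slice j ∘L a ∘L inc k
      map_add' := fun a b => by ext; rfl
      map_smul' := fun c a => by ext; rfl } 1 (fun a => by
        change ‖slice j ∘L a ∘L inc k‖ ≤ 1 * ‖a‖
        refine (ContinuousLinearMap.opNorm_comp_le _ _).trans ?_
        refine mul_le_mul (norm_slice_le j) ?_ (norm_nonneg _) zero_le_one
        refine (ContinuousLinearMap.opNorm_comp_le _ _).trans ?_
        exact mul_le_of_le_one_right (norm_nonneg _) (norm_inc_le k))

theorem norm_entry_le (j k : ℕ) (a : L (ℕ × Y)) : ‖entry j k a‖ ≤ ‖a‖ := by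
  have : ‖(entry j k : L (ℕ × Y) →L[ℂ] L Y)‖ ≤ 1 := LinearMap.mkContinuous_norm_le _ zero_le_one _
  exact (ContinuousLinearMap.le_of_opNorm_le _ this a).trans_eq (one_mul _)

theorem entry_apply (j k : ℕ) (a : L (ℕ × Y)) (v : H Y) :
    entry j k a v = slice j (a (inc k v)) := rfl

theorem entry_e (j k : ℕ) (a : L (ℕ × Y)) (x y : Y) :
    entry j k a (e y) x = a (e (k, y)) (j, x) := by
  rw [entry_apply, inc_e, slice_apply]

theorem ext_entry {a b : L (ℕ × Y)} (h : ∀ j k, entry j k a = entry j k b) : a = b :=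
  tensor_ext fun k y j x => by rw [← entry_e, ← entry_e, h]

/-- The operator with `(j, k)`-th entry `x` and all the others `0`. -/
def matUnit (j k : ℕ) : L Y →L[ℂ] L (ℕ × Y) :=
  LinearMap.mkContinuous
    { toFun := fun x => inc j ∘L x ∘L slice k
      map_add' := fun a b => by ext v; simp
      map_smul' := fun c a => by ext v; simp } 1 (fun a => by
        change ‖inc j ∘L a ∘L slice k‖ ≤ 1 * ‖a‖
        refine (ContinuousLinearMap.opNorm_comp_le _ _).trans ?_
        refine mul_le_mul (norm_inc_le j) ?_ (norm_nonneg _) zero_le_one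
        refine (ContinuousLinearMap.opNorm_comp_le _ _).trans ?_
        exact mul_le_of_le_one_right (norm_nonneg _) (norm_slice_le k))

theorem norm_matUnit_le (j k : ℕ) (x : L Y) : ‖matUnit j k x‖ ≤ ‖x‖ := by
  have : ‖(matUnit j k : L Y →L[ℂ] L (ℕ × Y))‖ ≤ 1 :=
    LinearMap.mkContinuous_norm_le _ zero_le_one _
  exact (ContinuousLinearMap.le_of_opNorm_le _ this x).trans_eq (one_mul _)

theorem matUnit_apply (j k : ℕ) (x : L Y) (v : H (ℕ × Y)) :
    matUnit j k x v = inc j (x (slice k v)) := rfl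

theorem entry_matUnit (i l j k : ℕ) (x : L Y) :
    entry i l (matUnit j k x) = if i = j ∧ l = k then x else 0 := by
  ext1 v
  rw [entry_apply, matUnit_apply, slice_inc, slice_inc]
  by_cases h1 : i = j <;> by_cases h2 : l = k
  · subst h1 h2; simp
  · simp [h1, h2, Ne.symm h2]
  · simp [h1]
  · simp [h1]

theorem entry_star (j k : ℕ) (a : L (ℕ × Y)) : entry j k (star a) = star (entry k j a) :=
  ext_e fun y => by
    ext x
    rw [entry_e, inner_e_star, inner_e_star, entry_e]

theorem entry_one (j k : ℕ) : entry j k (1 : L (ℕ × Y)) = if j = k then 1 else 0 := by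
  ext1 v
  rw [entry_apply, one_apply_eq_self, slice_inc]
  split_ifs <;> rfl

theorem ampR_inc (T : L Y) (k : ℕ) (v : H Y) : ampR ℕ T (inc k v) = inc k (T v) := by
  ext ⟨j, y⟩
  rw [ampR_apply, slice_inc, inc_apply]
  by_cases h : j = k <;> simp [h]

theorem entry_ampR_mul (T : L Y) (a : L (ℕ × Y)) (j k : ℕ) :
    entry j k (ampR ℕ T * a) = T * entry j k a := rfl

theorem entry_mul_ampR (T : L Y) (a : L (ℕ × Y)) (j k : ℕ) :
    entry j k (a * ampR ℕ T) = entry j k a * T := by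
  ext1 v
  change slice j (a (ampR ℕ T (inc k v))) = slice j (a (inc k (T v)))
  rw [ampR_inc]

theorem ampR_mul_matUnit (T x : L Y) (j k : ℕ) :
    ampR ℕ T * matUnit j k x = matUnit j k (T * x) := by
  ext1 v
  exact ampR_inc T j _

theorem matUnit_mul_ampR (T x : L Y) (j k : ℕ) :
    matUnit j k x * ampR ℕ T = matUnit j k (x * T) := rfl

variable (Y) in
/-- The left shift in the first tensor factor. -/
def shiftL : L (ℕ × Y) := tensor shiftN 1

theorem shiftL_apply (v : H (ℕ × Y)) (n : ℕ) (y : Y) : shiftL Y v (n, y) = v (n + 1, y) := rfl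

theorem shiftL_inc_succ (k : ℕ) (v : H Y) : shiftL Y (inc (k + 1) v) = inc k v := by
  ext ⟨j, y⟩
  rw [shiftL_apply, inc_apply, inc_apply]
  simp

theorem shiftL_inc_zero (v : H Y) : shiftL Y (inc 0 v) = 0 := by
  ext ⟨j, y⟩
  rw [shiftL_apply, inc_apply]
  simp

/-- At `q = 0` the factor `√(1 - q^{2N})` is `1 - p_0`, and the left shift reads only the
coordinates on which it is `1`. -/
theorem alpha_eq (ℓ : ℕ) : alpha ℓ = shiftL (Idx ℓ) := by
  rw [alpha, Y_succ_zero, star_tensor, star_one, star_X]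
  congr 1
  ext v n
  change (((√(1 - (0 : ℝ) ^ (2 * (n + 1))) : ℝ)) : ℂ) * v (n + 1) = v (n + 1)
  simp

theorem norm_shiftL_le : ‖shiftL Y‖ ≤ 1 := by
  have h : shiftL Y = pull (fun p : ℕ × Y => (p.1 + 1, p.2)) (fun p p' h => by
    simpa [Prod.ext_iff] using h) := by
    ext v ⟨n, y⟩; rfl
  rw [h]
  unfold pull
  exact LinearMap.mkContinuous_norm_le _ zero_le_one _

theorem entry_shiftL_mul (a : L (ℕ × Y)) (j k : ℕ) :
    entry j k (shiftL Y * a) = entry (j + 1) k a := rfl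

theorem entry_mul_shiftL_succ (a : L (ℕ × Y)) (j k : ℕ) :
    entry j (k + 1) (a * shiftL Y) = entry j k a := by
  ext1 v
  change slice j (a (shiftL Y (inc (k + 1) v))) = slice j (a (inc k v))
  rw [shiftL_inc_succ]

theorem entry_mul_shiftL_zero (a : L (ℕ × Y)) (j : ℕ) : entry j 0 (a * shiftL Y) = 0 := by
  ext1 v
  change slice j (a (shiftL Y (inc 0 v))) = 0
  rw [shiftL_inc_zero, map_zero, map_zero]

theorem shiftL_mul_matUnit_succ (x : L Y) (j k : ℕ) :
    shiftL Y * matUnit (j + 1) k x = matUnit j k x := by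
  ext1 v
  exact shiftL_inc_succ j _

theorem shiftL_mul_matUnit_zero (x : L Y) (k : ℕ) : shiftL Y * matUnit 0 k x = 0 := by
  ext1 v
  exact shiftL_inc_zero _

theorem matUnit_mul_shiftL (x : L Y) (j k : ℕ) :
    matUnit j k x * shiftL Y = matUnit j (k + 1) x := rfl

theorem entry_shiftL_pow (n j k : ℕ) :
    entry j k (shiftL Y ^ n) = if k = j + n then 1 else 0 := by
  induction n generalizing j with
  | zero => rw [pow_zero, entry_one]; simp only [add_zero, eq_comm]
  | succ n ih =>
    rw [pow_succ', entry_shiftL_mul, ih]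
    simp only [add_assoc, add_comm 1 n]

theorem entry_laurentPow (n : ℤ) (j k : ℕ) :
    entry j k (laurentPow (shiftL Y) n) = if (k : ℤ) - j = n then 1 else 0 := by
  cases n with
  | ofNat n =>
    change entry j k (shiftL Y ^ n) = _
    rw [entry_shiftL_pow]
    congr 1
    simp only [Int.ofNat_eq_natCast, eq_iff_iff]
    omega
  | negSucc n =>
    change entry j k (star (shiftL Y) ^ (n + 1)) = _
    rw [← star_pow, entry_star, entry_shiftL_pow, apply_ite star, star_one, star_zero]
    congr 1
    simp only [eq_iff_iff]
    omega

theorem norm_laurentPow_le {X : Type} {T : L X} (hT : ‖T‖ ≤ 1) (n : ℤ) :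
    ‖laurentPow T n‖ ≤ 1 := by
  have key : ∀ (S : L X), ‖S‖ ≤ 1 → ∀ n : ℕ, ‖S ^ n‖ ≤ 1 := fun S hS n => by
    induction n with
    | zero => exact ContinuousLinearMap.norm_id_le
    | succ n ih =>
      rw [pow_succ]
      exact (norm_mul_le _ _).trans (mul_le_one₀ ih (norm_nonneg _) hS)
  cases n with
  | ofNat n => exact key T hT n
  | negSucc n => exact key _ (by
      rwa [ContinuousLinearMap.star_eq_adjoint, LinearIsometryEquiv.norm_map]) _

theorem matUnit_zero_zero (x : L Y) : matUnit 0 0 x = tensor p0 x := by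
  refine tensor_ext fun k y j z => ?_
  classical
  rw [tensor_e, ← entry_e, entry_matUnit]
  have : p0 (e k) j = if j = 0 ∧ k = 0 then 1 else 0 := by
    change (if j = 0 then (1 : ℂ) else 0) * (e k : H ℕ) j = _
    rw [e_apply]
    by_cases h1 : j = 0 <;> by_cases h2 : k = 0 <;> simp [h1, h2]
    exact Ne.symm h2
  rw [this]
  split_ifs <;> simp

theorem star_matUnit (j k : ℕ) (x : L Y) : star (matUnit j k x) = matUnit k j (star x) := by
  refine ext_entry fun i l => ?_
  rw [entry_star, entry_matUnit, entry_matUnit]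
  by_cases h : l = j ∧ i = k
  · rw [if_pos h, if_pos h.symm]
  · rw [if_neg h, if_neg (fun h' => h h'.symm), star_zero]

theorem star_shiftL_mul_matUnit (j k : ℕ) (x : L Y) :
    star (shiftL Y) * matUnit j k x = matUnit (j + 1) k x := by
  apply star_injective
  rw [star_mul, star_star, star_matUnit, star_matUnit, matUnit_mul_shiftL]

/-- This identifies the terms of the matrix part of an expansion with block matrix units, so that
their coefficients can be read off as entries. -/
theorem matUnit_eq (j k : ℕ) (x : L Y) :
    star (shiftL Y) ^ j * tensor p0 x * shiftL Y ^ k = matUnit j k x := by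
  rw [← matUnit_zero_zero]
  induction k with
  | zero =>
    rw [pow_zero, mul_one]
    induction j with
    | zero => rw [pow_zero, one_mul]
    | succ j ih => rw [pow_succ', mul_assoc, ih, star_shiftL_mul_matUnit]
  | succ k ih => rw [pow_succ, ← mul_assoc, ih, matUnit_mul_shiftL]

theorem IsAd.entry {d : Y → ℝ} {a a' : L (ℕ × Y)} (h : IsAd (fun p : ℕ × Y => d p.2) a a')
    (j k : ℕ) : IsAd d (entry j k a) (entry j k a') := fun x y => by
  rw [entry_e, entry_e, h]

theorem IsLeft.entry {d : Y → ℝ} {a a' : L (ℕ × Y)} (h : IsLeft (fun p : ℕ × Y => d p.2) a a')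
    (j k : ℕ) : IsLeft d (entry j k a) (entry j k a') := fun x y => by
  rw [entry_e, entry_e, h]

variable (Y) in
/-- The first coordinate. -/
def fstCoord : ℕ × Y → ℝ := fun p => p.1

theorem IsAd.entry_fst {a a' : L (ℕ × Y)} (h : IsAd (fstCoord Y) a a')
    (j k : ℕ) : QuantumSphere.entry j k a' =
      ((j : ℂ) - k) • QuantumSphere.entry j k a := ext_e fun y => by
  ext x
  rw [entry_e, h]
  change _ = ((j : ℂ) - k) * (QuantumSphere.entry j k a (e y)) x
  rw [entry_e]
  simp [fstCoord]

theorem IsLeft.entry_fst {a a' : L (ℕ × Y)} (h : IsLeft (fstCoord Y) a a')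
    (j k : ℕ) : QuantumSphere.entry j k a' = (j : ℂ) • QuantumSphere.entry j k a :=
  ext_e fun y => by
    ext x
    rw [entry_e, h]
    change _ = (j : ℂ) * (QuantumSphere.entry j k a (e y)) x
    rw [entry_e]
    simp [fstCoord]

theorem matUnit_e (j k i l : ℕ) (x : L Y) (y z : Y) :
    matUnit j k x (e (l, y)) (i, z) = if i = j ∧ l = k then x (e y) z else 0 := by
  rw [← entry_e, entry_matUnit]
  split_ifs <;> rfl

theorem IsAd.matUnit {d : Y → ℝ} {x x' : L Y} (h : IsAd d x x') (j k : ℕ) :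
    IsAd (fun p : ℕ × Y => d p.2) (matUnit j k x) (matUnit j k x') := by
  rintro ⟨i, z⟩ ⟨l, y⟩
  rw [matUnit_e, matUnit_e]
  split_ifs
  · exact h z y
  · simp

theorem IsLeft.matUnit {d : Y → ℝ} {x x' : L Y} (h : IsLeft d x x') (j k : ℕ) :
    IsLeft (fun p : ℕ × Y => d p.2) (matUnit j k x) (matUnit j k x') := by
  rintro ⟨i, z⟩ ⟨l, y⟩
  rw [matUnit_e, matUnit_e]
  split_ifs
  · exact h z y
  · simp

theorem isAd_fst_matUnit (j k : ℕ) (x : L Y) :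
    IsAd (fstCoord Y) (matUnit j k x) (matUnit j k (((j : ℂ) - k) • x)) := by
  rintro ⟨i, z⟩ ⟨l, y⟩
  rw [matUnit_e, matUnit_e]
  split_ifs with h
  · obtain ⟨rfl, rfl⟩ := h
    simp [fstCoord]
  · simp

theorem isLeft_fst_matUnit (j k : ℕ) (x : L Y) :
    IsLeft (fstCoord Y) (matUnit j k x) (matUnit j k ((j : ℂ) • x)) := by
  rintro ⟨i, z⟩ ⟨l, y⟩
  rw [matUnit_e, matUnit_e]
  split_ifs with h
  · obtain ⟨rfl, rfl⟩ := h
    simp [fstCoord]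
  · simp

theorem isAd_fst_laurentPow (n : ℤ) :
    IsAd (fstCoord Y) (laurentPow (shiftL Y) n) ((-n : ℂ) • laurentPow (shiftL Y) n) := by
  rintro ⟨i, z⟩ ⟨l, y⟩
  change (-n : ℂ) * (laurentPow (shiftL Y) n) (e (l, y)) (i, z) = _
  rw [← entry_e, entry_laurentPow]
  split_ifs with h
  · subst h; simp [fstCoord]
  · simp

theorem isAd_snd_laurentPow (d : Y → ℝ) (n : ℤ) :
    IsAd (fun p : ℕ × Y => d p.2) (laurentPow (shiftL Y) n) 0 := by
  rintro ⟨i, z⟩ ⟨l, y⟩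
  change (0 : ℂ) = _
  rw [← entry_e, entry_laurentPow]
  have := IsAd.one d z y
  split_ifs with h
  · exact this
  · simp

theorem ampR_commute_laurentPow (T : L Y) (n : ℤ) :
    ampR ℕ T * laurentPow (shiftL Y) n = laurentPow (shiftL Y) n * ampR ℕ T := by
  refine ext_entry fun j k => ?_
  rw [entry_ampR_mul, entry_mul_ampR, entry_laurentPow]
  split_ifs <;> simp

/-- Nonnegative powers of `S` commute with `S`. For `m > 0`, `S S^{*m} - S^{*m} S = S^{*(m-1)} (1 -
S^* S) = S^{*(m-1)} p_0`, a single unit in row `m - 1` and column `0`. This is why the Toeplitz part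
of an expansion has a rapidly decreasing commutator with `α_1`. -/
theorem shiftL_commutator_laurentPow (n : ℤ) :
    shiftL Y * laurentPow (shiftL Y) n - laurentPow (shiftL Y) n * shiftL Y =
      if n < 0 then matUnit (-n - 1).toNat 0 1 else 0 := by
  refine ext_entry fun j k => ?_
  rw [map_sub, entry_shiftL_mul]
  rw [apply_ite (entry j k), map_zero, entry_matUnit, entry_laurentPow]
  cases k with
  | zero =>
    rw [entry_mul_shiftL_zero, sub_zero]
    split_ifs <;> first | rfl | omega
  | succ k =>
    have : ((k + 1 : ℕ) : ℤ) - ((j + 1 : ℕ) : ℤ) = k - j := by push_cast; ring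
    rw [entry_mul_shiftL_succ, entry_laurentPow, this, sub_self]
    simp

end Entries

end QuantumSphere


namespace QuantumSphere

open Filter Topology

/-! ### Complete sequences of seminorms and weighted `ℓ¹` spaces -/

section SeminormedFamilies

variable {V V' : Type} [AddCommGroup V] [Module ℂ V] [AddCommGroup V'] [Module ℂ V']

/-- An increasing sequence of seminorms `q` on a subspace `C` that is complete for them. -/
structure IsCompleteFamily (C : Set V) (q : ℕ → V → ℝ) : Prop where
  zero_mem : 0 ∈ C
  add_mem : ∀ {a b}, a ∈ C → b ∈ C → a + b ∈ C
  smul_mem : ∀ (c : ℂ) {a}, a ∈ C → c • a ∈ C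
  nonneg : ∀ m {a}, a ∈ C → 0 ≤ q m a
  add_le : ∀ m {a b}, a ∈ C → b ∈ C → q m (a + b) ≤ q m a + q m b
  smul_eq : ∀ m (c : ℂ) {a}, a ∈ C → q m (c • a) = ‖c‖ * q m a
  mono : ∀ m {a}, a ∈ C → q m a ≤ q (m + 1) a
  complete : ∀ u : ℕ → V, (∀ n, u n ∈ C) →
    (∀ m, ∀ ε > 0, ∃ N, ∀ n ≥ N, ∀ k ≥ N, q m (u n - u k) < ε) →
    ∃ a ∈ C, ∀ m, Tendsto (fun n => q m (u n - a)) atTop (𝓝 0)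

namespace IsCompleteFamily

variable {C : Set V} {q : ℕ → V → ℝ} (h : IsCompleteFamily C q)
include h

theorem neg_mem {a : V} (ha : a ∈ C) : -a ∈ C := by
  simpa using h.smul_mem (-1) ha

theorem sub_mem {a b : V} (ha : a ∈ C) (hb : b ∈ C) : a - b ∈ C := by
  simpa only [sub_eq_add_neg] using h.add_mem ha (h.neg_mem hb)

theorem map_neg (m : ℕ) {a : V} (ha : a ∈ C) : q m (-a) = q m a := by
  simpa using h.smul_eq m (-1) ha

theorem map_zero (m : ℕ) : q m 0 = 0 := by
  simpa using h.smul_eq m 0 h.zero_mem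

theorem sub_le (m : ℕ) {a b : V} (ha : a ∈ C) (hb : b ∈ C) : q m (a - b) ≤ q m a + q m b := by
  rw [sub_eq_add_neg, ← h.map_neg m hb]
  exact h.add_le m ha (h.neg_mem hb)

theorem mono_le {m n : ℕ} (hmn : m ≤ n) {a : V} (ha : a ∈ C) : q m a ≤ q n a :=
  monotone_nat_of_le_succ (f := fun m => q m a) (fun m => h.mono m ha) hmn

end IsCompleteFamily

theorem isCompleteFamily_norm : IsCompleteFamily (Set.univ : Set ℂ) (fun _ c => ‖c‖) where
  zero_mem := trivial
  add_mem _ _ := trivial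
  smul_mem _ _ _ := trivial
  nonneg _ _ _ := norm_nonneg _
  add_le _ _ _ _ _ := norm_add_le _ _
  smul_eq _ c _ _ := norm_smul c _
  mono _ _ _ := le_rfl
  complete u _ hu := by
    have : CauchySeq u := Metric.cauchySeq_iff.2 fun ε hε => by
      simpa [dist_eq_norm] using hu 0 ε hε
    obtain ⟨a, ha⟩ := cauchySeq_tendsto_of_complete this
    exact ⟨a, trivial, fun _ => tendsto_iff_norm_sub_tendsto_zero.1 ha⟩

section Weighted

variable {ι : Type} {w : ι → ℝ} {C : Set V} {q : ℕ → V → ℝ}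

/-- Families in `C` that decrease rapidly with respect to the weight `w`. -/
def WeightedFamily (w : ι → ℝ) (C : Set V) (q : ℕ → V → ℝ) : Set (ι → V) :=
  {x | (∀ p, x p ∈ C) ∧ ∀ m, Summable fun p => w p ^ m * q m (x p)}

/-- The seminorms of a rapidly decreasing family. -/
noncomputable def weightedSum (w : ι → ℝ) (q : ℕ → V → ℝ) (m : ℕ) (x : ι → V) : ℝ :=
  ∑' p, w p ^ m * q m (x p)

/-- Both factors grow with their index, so the mixed exponents `(r, s)` are dominated by the
diagonal ones `(m, m)`. Summability for `r = s = m` therefore carries the whole condition. -/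
theorem weighted_le (h : IsCompleteFamily C q) (hw : ∀ p, 1 ≤ w p) {r s m : ℕ} (hr : r ≤ m)
    (hs : s ≤ m) {a : V} (ha : a ∈ C) (p : ι) : w p ^ r * q s a ≤ w p ^ m * q m a :=
  mul_le_mul (pow_le_pow_right₀ (hw p) hr) (h.mono_le hs ha) (h.nonneg s ha)
    (pow_nonneg (zero_le_one.trans (hw p)) m)

theorem WeightedFamily.nonneg (h : IsCompleteFamily C q) (hw : ∀ p, 1 ≤ w p) (r s : ℕ) {a : V}
    (ha : a ∈ C) (p : ι) : 0 ≤ w p ^ r * q s a :=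
  mul_nonneg (pow_nonneg (zero_le_one.trans (hw p)) r) (h.nonneg s ha)

theorem WeightedFamily.summable (h : IsCompleteFamily C q) (hw : ∀ p, 1 ≤ w p) {x : ι → V}
    (hx : x ∈ WeightedFamily w C q) (r s : ℕ) : Summable fun p => w p ^ r * q s (x p) :=
  Summable.of_nonneg_of_le (fun p => nonneg h hw r s (hx.1 p) p)
    (fun p => weighted_le h hw (le_max_left r s) (le_max_right r s) (hx.1 p) p)
    (hx.2 (max r s))

theorem weightedFamily_add (h : IsCompleteFamily C q) (hw : ∀ p, 1 ≤ w p) {x y : ι → V}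
    (hx : x ∈ WeightedFamily w C q) (hy : y ∈ WeightedFamily w C q) :
    x + y ∈ WeightedFamily w C q ∧
      ∀ m, weightedSum w q m (x + y) ≤ weightedSum w q m x + weightedSum w q m y := by
  have hle : ∀ m p, w p ^ m * q m ((x + y) p) ≤ w p ^ m * q m (x p) + w p ^ m * q m (y p) :=
    fun m p => by
      rw [← mul_add]
      exact mul_le_mul_of_nonneg_left (h.add_le m (hx.1 p) (hy.1 p))
        (pow_nonneg (zero_le_one.trans (hw p)) m)
  have hm : ∀ p, (x + y) p ∈ C := fun p => h.add_mem (hx.1 p) (hy.1 p)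
  have hs : ∀ m, Summable fun p => w p ^ m * q m ((x + y) p) := fun m =>
    Summable.of_nonneg_of_le (fun p => WeightedFamily.nonneg h hw m m (hm p) p) (hle m)
      ((hx.2 m).add (hy.2 m))
  refine ⟨⟨hm, hs⟩, fun m => ?_⟩
  rw [weightedSum, weightedSum, weightedSum, ← (hx.2 m).tsum_add (hy.2 m)]
  exact (hs m).tsum_le_tsum (hle m) ((hx.2 m).add (hy.2 m))

theorem weightedFamily_smul (h : IsCompleteFamily C q) {x : ι → V}
    (hx : x ∈ WeightedFamily w C q) (c : ℂ) : c • x ∈ WeightedFamily w C q ∧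
      ∀ m, weightedSum w q m (c • x) = ‖c‖ * weightedSum w q m x := by
  have heq : ∀ m p, w p ^ m * q m ((c • x) p) = ‖c‖ * (w p ^ m * q m (x p)) := fun m p => by
    rw [Pi.smul_apply, h.smul_eq m c (hx.1 p)]; ring
  refine ⟨⟨fun p => h.smul_mem c (hx.1 p), fun m => ?_⟩, fun m => ?_⟩
  · simp only [heq]; exact (hx.2 m).mul_left _
  · simp only [weightedSum, heq]; exact tsum_mul_left

/-- Rapidly decreasing families in a complete space form a complete space. -/
theorem isCompleteFamily_weighted (h : IsCompleteFamily C q) (hw : ∀ p, 1 ≤ w p) :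
    IsCompleteFamily (WeightedFamily w C q) (weightedSum w q) where
  zero_mem := ⟨fun _ => h.zero_mem, fun m => by simp [h.map_zero, summable_zero]⟩
  add_mem hx hy := (weightedFamily_add h hw hx hy).1
  smul_mem c _ hx := (weightedFamily_smul h hx c).1
  nonneg m x hx := tsum_nonneg fun p => WeightedFamily.nonneg h hw m m (hx.1 p) p
  add_le m x y hx hy := (weightedFamily_add h hw hx hy).2 m
  smul_eq m c x hx := (weightedFamily_smul h hx c).2 m
  mono m x hx := (hx.2 m).tsum_le_tsum
    (fun p => weighted_le h hw (Nat.le_succ m) (Nat.le_succ m) (hx.1 p) p) (hx.2 (m + 1))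
  complete u hu hC := by
    have hsub : ∀ n k, u n - u k ∈ WeightedFamily w C q := fun n k => by
      have := (weightedFamily_add h hw (hu n) (weightedFamily_smul h (hu k) (-1)).1).1
      simpa [sub_eq_add_neg] using this
    have hfin : ∀ m n k (s : Finset ι), ∑ p ∈ s, w p ^ m * q m (u n p - u k p) ≤
        weightedSum w q m (u n - u k) := fun m n k s =>
      ((hsub n k).2 m).sum_le_tsum s
        (fun p _ => WeightedFamily.nonneg h hw m m ((hsub n k).1 p) p)
    have hpt : ∀ p, ∃ a ∈ C, ∀ m, Tendsto (fun n => q m (u n p - a)) atTop (𝓝 0) := fun p => by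
      refine h.complete (fun n => u n p) (fun n => (hu n).1 p) fun m ε hε => ?_
      obtain ⟨N, hN⟩ := hC m ε hε
      refine ⟨N, fun n hn k hk => lt_of_le_of_lt ?_ (hN n hn k hk)⟩
      have h1 := hfin m n k {p}
      rw [Finset.sum_singleton] at h1
      refine le_trans ?_ h1
      exact le_mul_of_one_le_left (h.nonneg m ((hsub n k).1 p)) (one_le_pow₀ (hw p))
    choose x hxC hx using hpt
    have hux : ∀ n p, u n p - x p ∈ C := fun n p => h.sub_mem ((hu n).1 p) (hxC p)
    -- The reverse triangle inequality: the seminorms are continuous along the coordinatewise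
    -- convergence.
    have hconv : ∀ m n p, Tendsto (fun k => q m (u n p - u k p)) atTop (𝓝 (q m (u n p - x p))) := by
      intro m n p
      rw [tendsto_iff_norm_sub_tendsto_zero]
      refine squeeze_zero (fun _ => norm_nonneg _) (fun k => ?_) (hx p m)
      rw [Real.norm_eq_abs, abs_le]
      have hk := hux k p
      have h1 := h.add_le m ((hsub n k).1 p) hk
      have h2 := h.sub_le m (hux n p) hk
      have e1 : (u n - u k) p + (u k p - x p) = u n p - x p := by simp
      have e2 : (u n p - x p) - (u k p - x p) = (u n - u k) p := by simp
      rw [e1] at h1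
      rw [e2] at h2
      simp only [Pi.sub_apply] at h1 h2
      constructor <;> linarith
    -- The Cauchy bound is applied to finite partial sums, in which `k → ∞` is harmless. Since `N`
    -- does not depend on `s`, it then controls the full sum.
    have hbound : ∀ m, ∀ ε > 0, ∃ N, ∀ n ≥ N, ∀ s : Finset ι,
        ∑ p ∈ s, w p ^ m * q m (u n p - x p) ≤ ε := by
      intro m ε hε
      obtain ⟨N, hN⟩ := hC m ε hε
      refine ⟨N, fun n hn s => ?_⟩
      refine le_of_tendsto (tendsto_finsetSum s fun p _ => (hconv m n p).const_mul (w p ^ m)) ?_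
      filter_upwards [eventually_ge_atTop N] with k hk
      exact (hfin m n k s).trans (hN n hn k hk).le
    have hdiff : ∀ m n, Summable fun p => w p ^ m * q m (u n p - x p) := by
      intro m n
      obtain ⟨N, hN⟩ := hbound m 1 one_pos
      have hsN : Summable fun p => w p ^ m * q m (u N p - x p) :=
        summable_of_sum_le (fun p => WeightedFamily.nonneg h hw m m (hux N p) p) (hN N le_rfl)
      refine Summable.of_nonneg_of_le (fun p => WeightedFamily.nonneg h hw m m (hux n p) p)
        (fun p => ?_) (((hsub n N).2 m).add hsN)
      rw [← mul_add]
      refine mul_le_mul_of_nonneg_left ?_ (pow_nonneg (zero_le_one.trans (hw p)) m)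
      have h1 := h.add_le m ((hsub n N).1 p) (hux N p)
      have e1 : (u n - u N) p + (u N p - x p) = u n p - x p := by simp
      rwa [e1] at h1
    have hd0 : ∀ n, u n - x ∈ WeightedFamily w C q := fun n => ⟨hux n, fun m => hdiff m n⟩
    refine ⟨x, ?_, fun m => ?_⟩
    · have := (weightedFamily_add h hw (hu 0) (weightedFamily_smul h (hd0 0) (-1)).1).1
      simpa using this
    · rw [Metric.tendsto_atTop]
      intro ε hε
      obtain ⟨N, hN⟩ := hbound m (ε / 2) (half_pos hε)
      refine ⟨N, fun n hn => ?_⟩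
      have h0 : 0 ≤ weightedSum w q m (u n - x) :=
        tsum_nonneg fun p => WeightedFamily.nonneg h hw m m (hux n p) p
      rw [Real.dist_eq, sub_zero, abs_of_nonneg h0]
      refine lt_of_le_of_lt ?_ (half_lt_self hε)
      exact Summable.tsum_le_of_sum_le (hdiff m n) (hN n hn)

end Weighted

theorem IsCompleteFamily.prod {C : Set V} {q : ℕ → V → ℝ} {C' : Set V'} {q' : ℕ → V' → ℝ}
    (h : IsCompleteFamily C q) (h' : IsCompleteFamily C' q') :
    IsCompleteFamily (C ×ˢ C') (fun m v => q m v.1 + q' m v.2) where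
  zero_mem := ⟨h.zero_mem, h'.zero_mem⟩
  add_mem ha hb := ⟨h.add_mem ha.1 hb.1, h'.add_mem ha.2 hb.2⟩
  smul_mem c _ ha := ⟨h.smul_mem c ha.1, h'.smul_mem c ha.2⟩
  nonneg m _ ha := add_nonneg (h.nonneg m ha.1) (h'.nonneg m ha.2)
  add_le m a b ha hb := by
    have h1 := h.add_le m ha.1 hb.1
    have h2 := h'.add_le m ha.2 hb.2
    simp only [Prod.fst_add, Prod.snd_add]
    linarith
  smul_eq m c a ha := by
    simp only [Prod.smul_fst, Prod.smul_snd, h.smul_eq m c ha.1, h'.smul_eq m c ha.2, mul_add]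
  mono m _ ha := add_le_add (h.mono m ha.1) (h'.mono m ha.2)
  complete u hu hC := by
    have hn : ∀ m n k, 0 ≤ q m ((u n).1 - (u k).1) ∧ 0 ≤ q' m ((u n).2 - (u k).2) :=
      fun m n k => ⟨h.nonneg m (h.sub_mem (hu n).1 (hu k).1),
        h'.nonneg m (h'.sub_mem (hu n).2 (hu k).2)⟩
    obtain ⟨a, ha, hta⟩ := h.complete (fun n => (u n).1) (fun n => (hu n).1) fun m ε hε => by
      obtain ⟨N, hN⟩ := hC m ε hε
      refine ⟨N, fun n hn' k hk => lt_of_le_of_lt ?_ (hN n hn' k hk)⟩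
      exact le_add_of_nonneg_right (hn m n k).2
    obtain ⟨b, hb, htb⟩ := h'.complete (fun n => (u n).2) (fun n => (hu n).2) fun m ε hε => by
      obtain ⟨N, hN⟩ := hC m ε hε
      refine ⟨N, fun n hn' k hk => lt_of_le_of_lt ?_ (hN n hn' k hk)⟩
      exact le_add_of_nonneg_left (hn m n k).1
    exact ⟨(a, b), ⟨ha, hb⟩, fun m => by simpa using (hta m).add (htb m)⟩

/-- Transport of a complete family of seminorms along a linear bijection, given as a relation. -/
theorem IsCompleteFamily.transport {C : Set V} {q : ℕ → V → ℝ} (h : IsCompleteFamily C q)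
    {R : V' → V → Prop} {C' : Set V'} {q' : ℕ → V' → ℝ}
    (hC' : ∀ a, a ∈ C' ↔ ∃ v ∈ C, R a v) (hex : ∀ v ∈ C, ∃ a, R a v)
    (hadd : ∀ {a b v w}, R a v → R b w → R (a + b) (v + w))
    (hsmul : ∀ (c : ℂ) {a v}, R a v → R (c • a) (c • v))
    (hq : ∀ m a v, v ∈ C → R a v → q' m a = q m v) : IsCompleteFamily C' q' where
  zero_mem := by
    obtain ⟨a, ha⟩ := hex 0 h.zero_mem
    exact (hC' 0).2 ⟨0, h.zero_mem, by simpa using hsmul 0 ha⟩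
  add_mem {a b} ha hb := by
    obtain ⟨v, hv, hav⟩ := (hC' a).1 ha
    obtain ⟨w, hw, hbw⟩ := (hC' b).1 hb
    exact (hC' _).2 ⟨_, h.add_mem hv hw, hadd hav hbw⟩
  smul_mem c a ha := by
    obtain ⟨v, hv, hav⟩ := (hC' a).1 ha
    exact (hC' _).2 ⟨_, h.smul_mem c hv, hsmul c hav⟩
  nonneg m a ha := by
    obtain ⟨v, hv, hav⟩ := (hC' a).1 ha
    rw [hq m a v hv hav]
    exact h.nonneg m hv
  add_le m a b ha hb := by
    obtain ⟨v, hv, hav⟩ := (hC' a).1 ha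
    obtain ⟨w, hw, hbw⟩ := (hC' b).1 hb
    rw [hq m a v hv hav, hq m b w hw hbw, hq m _ _ (h.add_mem hv hw) (hadd hav hbw)]
    exact h.add_le m hv hw
  smul_eq m c a ha := by
    obtain ⟨v, hv, hav⟩ := (hC' a).1 ha
    rw [hq m a v hv hav, hq m _ _ (h.smul_mem c hv) (hsmul c hav)]
    exact h.smul_eq m c hv
  mono m a ha := by
    obtain ⟨v, hv, hav⟩ := (hC' a).1 ha
    rw [hq m a v hv hav, hq _ a v hv hav]
    exact h.mono m hv
  complete u hu hCau := by
    choose v hv huv using fun n => (hC' (u n)).1 (hu n)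
    have hsub : ∀ {a b v w}, R a v → R b w → R (a - b) (v - w) := fun h1 h2 => by
      have := hadd h1 (hsmul (-1) h2)
      simpa [sub_eq_add_neg] using this
    obtain ⟨x, hx, hlim⟩ := h.complete v hv fun m ε hε => by
      obtain ⟨N, hN⟩ := hCau m ε hε
      refine ⟨N, fun n hn k hk => ?_⟩
      rw [← hq m _ _ (h.sub_mem (hv n) (hv k)) (hsub (huv n) (huv k))]
      exact hN n hn k hk
    obtain ⟨a, ha⟩ := hex x hx
    refine ⟨a, (hC' a).2 ⟨x, hx, ha⟩, fun m => ?_⟩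
    refine (hlim m).congr fun n => ?_
    exact (hq m _ _ (h.sub_mem (hv n) hx) (hsub (huv n) ha)).symm

end SeminormedFamilies

end QuantumSphere


namespace QuantumSphere

open Filter Topology

/-! ### Expansions, uniqueness of coefficients and completeness -/

section Expansions

/-- The weight of the Fourier coefficients. -/
def intWeight (n : ℤ) : ℝ := 1 + |(n : ℝ)|

/-- The weight of the matrix entries. -/
def natWeight (p : ℕ × ℕ) : ℝ := 1 + p.1 + p.2

theorem one_le_intWeight (n : ℤ) : 1 ≤ intWeight n := le_add_of_nonneg_right (abs_nonneg _)

theorem one_le_natWeight (p : ℕ × ℕ) : 1 ≤ natWeight p := by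
  unfold natWeight
  have h1 : (0 : ℝ) ≤ p.1 := Nat.cast_nonneg _
  have h2 : (0 : ℝ) ≤ p.2 := Nat.cast_nonneg _
  linarith

theorem rapidDecay_iff {c : ℤ → ℂ} :
    RapidDecay c ↔ c ∈ WeightedFamily intWeight Set.univ (fun _ c => ‖c‖) :=
  ⟨fun h => ⟨fun _ => trivial, h⟩, fun h => h.2⟩

theorem isCompleteFamily_rapidDecay : IsCompleteFamily {c | RapidDecay c}
    (weightedSum intWeight fun _ c => ‖c‖) := by
  have := isCompleteFamily_weighted isCompleteFamily_norm one_le_intWeight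
  have h : {c | RapidDecay c} = WeightedFamily intWeight Set.univ (fun _ (c : ℂ) => ‖c‖) :=
    Set.ext fun c => rapidDecay_iff
  rwa [h]

theorem RapidDecay.summable_norm {c : ℤ → ℂ} (hc : RapidDecay c) : Summable fun n => ‖c n‖ := by
  simpa using hc 0

theorem RapidDecay.conj_neg {c : ℤ → ℂ} (hc : RapidDecay c) :
    RapidDecay fun n => star (c (-n)) := fun m => by
  have := (Equiv.neg ℤ).summable_iff.2 (hc m)
  convert this using 2 with n
  simp

theorem weightedSum_conj_neg (c : ℤ → ℂ) (m : ℕ) :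
    weightedSum intWeight (fun _ (c : ℂ) => ‖c‖) m (fun n => star (c (-n))) =
      weightedSum intWeight (fun _ (c : ℂ) => ‖c‖) m c := by
  unfold weightedSum
  rw [← (Equiv.neg ℤ).tsum_eq]
  simp [intWeight]

theorem RapidDecay.summable_smul {X : Type} {T : L X} (hT : ‖T‖ ≤ 1) {c : ℤ → ℂ}
    (hc : RapidDecay c) : Summable fun n => c n • laurentPow T n := by
  refine Summable.of_norm_bounded hc.summable_norm fun n => ?_
  rw [norm_smul]
  exact mul_le_of_le_one_right (norm_nonneg _) (norm_laurentPow_le hT n)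

/-- Reads one coefficient off a norm convergent expansion, by a continuous map that kills all the
other terms. -/
theorem hasSum_map_single {ι E E' : Type} [NormedAddCommGroup E] [NormedSpace ℂ E]
    [NormedAddCommGroup E'] [NormedSpace ℂ E'] {f : ι → E} {s : E} (hf : HasSum f s)
    (φ : E →L[ℂ] E') (i : ι) (hi : ∀ j ≠ i, φ (f j) = 0) : φ s = φ (f i) :=
  (hf.mapL φ).unique (hasSum_single i hi)

/-- A ⋆-invariant complete family of seminorms on a set of bounded operators, for which the
inclusion is continuous. -/
structure SmoothData.IsGood {X : Type} (D : SmoothData X) : Prop where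
  complete : IsCompleteFamily D.carrier D.seminorm
  star_mem : ∀ {a}, a ∈ D.carrier → star a ∈ D.carrier
  star_eq : ∀ m {a}, a ∈ D.carrier → D.seminorm m (star a) = D.seminorm m a
  norm_le : ∀ {a}, a ∈ D.carrier → ‖a‖ ≤ D.seminorm 0 a

section LevelZero

theorem star_shiftZ_e (y : ℤ) : star shiftZ (e y) = e (y + 1) := by
  classical
  ext x
  obtain ⟨z, rfl⟩ : ∃ z : ℤ, z + 1 = x := ⟨x - 1, by ring⟩
  rw [star_shiftZ_succ, e_apply, e_apply]
  simp

theorem shiftZ_e (y : ℤ) : shiftZ (e y) = e (y - 1) := by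
  classical
  ext x
  change (e y : H ℤ) (x + 1) = _
  rw [e_apply, e_apply]
  simp only [eq_sub_iff_add_eq]

theorem norm_star_shiftZ_le : ‖star shiftZ‖ ≤ 1 := by
  rw [ContinuousLinearMap.star_eq_adjoint, LinearIsometryEquiv.norm_map]
  unfold shiftZ pull
  exact LinearMap.mkContinuous_norm_le _ zero_le_one _

theorem laurentPow_star_shiftZ_e (n y : ℤ) : laurentPow (star shiftZ) n (e y) = e (y + n) := by
  cases n with
  | ofNat n =>
    change (star shiftZ ^ n) (e y) = _
    induction n with
    | zero => simp
    | succ n ih =>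
      rw [pow_succ', mul_apply_eq_comp, ih, star_shiftZ_e]
      congr 1
      simp [add_assoc]
  | negSucc n =>
    change (star (star shiftZ) ^ (n + 1)) (e y) = _
    rw [star_star]
    induction n with
    | zero => rw [zero_add, pow_one, shiftZ_e]; rfl
    | succ n ih =>
      rw [pow_succ', mul_apply_eq_comp, ih, shiftZ_e]
      congr 1
      simp only [Int.negSucc_eq]
      push_cast
      ring

theorem laurentPow_star_shiftZ_coef (n x y : ℤ) :
    laurentPow (star shiftZ) n (e y) x = if x - y = n then 1 else 0 := by
  classical
  rw [laurentPow_star_shiftZ_e, e_apply]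
  congr 1
  simp only [eq_iff_iff]
  omega

/-- The operator `a` has the Fourier coefficients `c`. -/
def IsFourierMatrix (a : L ℤ) (c : ℤ → ℂ) : Prop := ∀ x y, a (e y) x = c (x - y)

theorem coef_hasSum_laurent {c : ℤ → ℂ} {a : L ℤ}
    (h : HasSum (fun n : ℤ => c n • laurentPow (star shiftZ) n) a) : IsFourierMatrix a c := by
  intro x y
  have := hasSum_map_single h (coefL x y) (x - y) (fun n hn => by
    rw [map_smul, coefL_apply, laurentPow_star_shiftZ_coef, if_neg (Ne.symm hn), smul_zero])
  rw [coefL_apply, map_smul, coefL_apply, laurentPow_star_shiftZ_coef, if_pos rfl] at this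
  simpa using this

theorem isFourierExpansion_iff {c : ℤ → ℂ} {a : L ℤ} :
    IsFourierExpansion c a ↔ RapidDecay c ∧ IsFourierMatrix a c := by
  refine ⟨fun h => ⟨h.1, coef_hasSum_laurent h.2⟩, fun h => ⟨h.1, ?_⟩⟩
  have hs := (h.1.summable_smul norm_star_shiftZ_le).hasSum
  have h' := coef_hasSum_laurent hs
  have : a = ∑' n, c n • laurentPow (star shiftZ) n := ext_e fun y => by
    ext x
    rw [h.2, h']
  rwa [← this] at hs

theorem IsFourierMatrix.unique {a : L ℤ} {c c' : ℤ → ℂ} (h : IsFourierMatrix a c)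
    (h' : IsFourierMatrix a c') : c = c' := funext fun n => by
  rw [← sub_zero n, ← h, h']

theorem smoothData_zero_seminorm {a : L ℤ} {c : ℤ → ℂ} (hc : RapidDecay c)
    (h : IsFourierMatrix a c) (m : ℕ) :
    (smoothData 0).seminorm m a = weightedSum intWeight (fun _ c => ‖c‖) m c := by
  have : {r | ∃ c, IsFourierExpansion c a ∧ r = ∑' n : ℤ, (1 + |(n : ℝ)|) ^ m * ‖c n‖} =
      {weightedSum intWeight (fun _ c => ‖c‖) m c} := by
    ext r
    constructor
    · rintro ⟨c', hc', rfl⟩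
      rw [(isFourierExpansion_iff.1 hc').2.unique h]
      rfl
    · rintro rfl
      exact ⟨c, isFourierExpansion_iff.2 ⟨hc, h⟩, rfl⟩
  change sInf _ = _
  rw [this, csInf_singleton]

theorem mem_smoothData_zero {a : L ℤ} :
    a ∈ (smoothData 0).carrier ↔ ∃ c ∈ {c | RapidDecay c}, IsFourierMatrix a c :=
  exists_congr fun _ => isFourierExpansion_iff

theorem isGood_zero : (smoothData 0).IsGood where
  complete := isCompleteFamily_rapidDecay.transport (R := IsFourierMatrix)
    (fun _ => mem_smoothData_zero)
    (fun c hc => ⟨_, coef_hasSum_laurent (hc.summable_smul norm_star_shiftZ_le).hasSum⟩)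
    (fun {a b v w} h h' x y => congrArg₂ (· + ·) (h x y) (h' x y))
    (fun c a v h x y => congrArg (c * ·) (h x y))
    (fun m a v hv h => smoothData_zero_seminorm hv h m)
  star_mem {a} ha := by
    obtain ⟨c, hc, h⟩ := mem_smoothData_zero.1 ha
    refine mem_smoothData_zero.2 ⟨_, RapidDecay.conj_neg hc, fun x y => ?_⟩
    rw [inner_e_star, h]
    simp
  star_eq m a ha := by
    obtain ⟨c, hc, h⟩ := mem_smoothData_zero.1 ha
    rw [smoothData_zero_seminorm hc h, ← weightedSum_conj_neg]
    refine smoothData_zero_seminorm (RapidDecay.conj_neg hc) (fun x y => ?_) m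
    rw [inner_e_star, h]
    simp
  norm_le {a} ha := by
    obtain ⟨c, hc, h⟩ := mem_smoothData_zero.1 ha
    rw [smoothData_zero_seminorm hc h]
    have hs := (isFourierExpansion_iff.2 ⟨hc, h⟩).2
    rw [← hs.tsum_eq]
    refine (norm_tsum_le_tsum_norm ?_).trans ?_
    · refine Summable.of_nonneg_of_le (fun _ => norm_nonneg _) (fun n => ?_) hc.summable_norm
      rw [norm_smul]
      exact mul_le_of_le_one_right (norm_nonneg _) (norm_laurentPow_le norm_star_shiftZ_le n)
    · unfold weightedSum
      simp only [pow_zero, one_mul]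
      refine Summable.tsum_le_tsum (fun n => ?_) ?_ hc.summable_norm
      · rw [norm_smul]
        exact mul_le_of_le_one_right (norm_nonneg _) (norm_laurentPow_le norm_star_shiftZ_le n)
      · refine Summable.of_nonneg_of_le (fun _ => norm_nonneg _) (fun n => ?_) hc.summable_norm
        rw [norm_smul]
        exact mul_le_of_le_one_right (norm_nonneg _) (norm_laurentPow_le norm_star_shiftZ_le n)

end LevelZero

section Step

variable {ℓ : ℕ} {D : SmoothData (Idx ℓ)}

/-- Rapidly decreasing coefficients with matrix part in `D`. -/
def expansionCoeffs (D : SmoothData (Idx ℓ)) : Set ((ℕ × ℕ → L (Idx ℓ)) × (ℤ → ℂ)) :=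
  WeightedFamily natWeight D.carrier D.seminorm ×ˢ {c | RapidDecay c}

/-- The operator with the entries `x_{jk} + c_{k-j}`. -/
def IsExpansionMatrix (a : L (ℕ × Idx ℓ)) (v : (ℕ × ℕ → L (Idx ℓ)) × (ℤ → ℂ)) : Prop :=
  ∀ j k : ℕ, entry j k a = v.1 (j, k) + v.2 ((k : ℤ) - j) • (1 : L (Idx ℓ))

theorem norm_matUnit_le_weight (hD : D.IsGood) {x : ℕ × ℕ → L (Idx ℓ)}
    (hx : x ∈ WeightedFamily natWeight D.carrier D.seminorm) (p : ℕ × ℕ) :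
    ‖matUnit p.1 p.2 (x p)‖ ≤ natWeight p ^ 0 * D.seminorm 0 (x p) := by
  rw [pow_zero, one_mul]
  exact (norm_matUnit_le _ _ _).trans (hD.norm_le (hx.1 p))

theorem summable_matUnit (hD : D.IsGood) {x : ℕ × ℕ → L (Idx ℓ)}
    (hx : x ∈ WeightedFamily natWeight D.carrier D.seminorm) :
    Summable fun p : ℕ × ℕ => matUnit p.1 p.2 (x p) :=
  Summable.of_norm_bounded (hx.2 0) (norm_matUnit_le_weight hD hx)

theorem entry_hasSum_matUnit {x : ℕ × ℕ → L (Idx ℓ)} {b : L (ℕ × Idx ℓ)}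
    (h : HasSum (fun p : ℕ × ℕ => matUnit p.1 p.2 (x p)) b) (j k : ℕ) :
    entry j k b = x (j, k) := by
  have := hasSum_map_single h (entry j k) (j, k) (fun p hp => by
    rw [entry_matUnit, if_neg]
    rintro ⟨h1, h2⟩
    exact hp (Prod.ext h1.symm h2.symm))
  rw [this, entry_matUnit]
  simp

theorem entry_hasSum_laurent {c : ℤ → ℂ} {t : L (ℕ × Idx ℓ)}
    (h : HasSum (fun n : ℤ => c n • laurentPow (shiftL (Idx ℓ)) n) t) (j k : ℕ) :
    entry j k t = c ((k : ℤ) - j) • (1 : L (Idx ℓ)) := by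
  have := hasSum_map_single h (entry j k) ((k : ℤ) - j) (fun n hn => by
    rw [map_smul, entry_laurentPow, if_neg (Ne.symm hn), smul_zero])
  rw [this, map_smul, entry_laurentPow, if_pos rfl]

theorem expansion_hasSum (hD : D.IsGood) {v : (ℕ × ℕ → L (Idx ℓ)) × (ℤ → ℂ)}
    (hv : v ∈ expansionCoeffs D) {a : L (ℕ × Idx ℓ)} (ha : IsExpansionMatrix a v) :
    a = ∑' p : ℕ × ℕ, matUnit p.1 p.2 (v.1 p) +
      ∑' n : ℤ, v.2 n • laurentPow (shiftL (Idx ℓ)) n :=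
  ext_entry fun j k => by
    rw [map_add, entry_hasSum_matUnit (summable_matUnit hD hv.1).hasSum,
      entry_hasSum_laurent (RapidDecay.summable_smul norm_shiftL_le hv.2).hasSum, ha]

/-- For admissible coefficients both series converge absolutely, and entries determine an operator;
so being an expansion is a condition on entries alone. -/
theorem isExpansion_iff (hD : D.IsGood) {x : ℕ × ℕ → L (Idx ℓ)} {c : ℤ → ℂ}
    {a : L (ℕ × Idx ℓ)} :
    IsExpansion D x c a ↔ (x, c) ∈ expansionCoeffs D ∧ IsExpansionMatrix a (x, c) := by
  simp only [IsExpansion, alpha_eq, matUnit_eq]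
  constructor
  · rintro ⟨hx, hs, hc, b, t, hb, ht, rfl⟩
    refine ⟨⟨⟨hx, fun m => hs m m⟩, hc⟩, fun j k => ?_⟩
    rw [map_add, entry_hasSum_matUnit hb, entry_hasSum_laurent ht]
  · rintro ⟨hv, ha⟩
    exact ⟨hv.1.1, fun n m => WeightedFamily.summable hD.complete one_le_natWeight hv.1 n m, hv.2,
      _, _, (summable_matUnit hD hv.1).hasSum,
      (RapidDecay.summable_smul norm_shiftL_le hv.2).hasSum, expansion_hasSum hD hv ha⟩

theorem IsExpansionMatrix.norm_le (hD : D.IsGood) {v : (ℕ × ℕ → L (Idx ℓ)) × (ℤ → ℂ)}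
    (hv : v ∈ expansionCoeffs D) {a : L (ℕ × Idx ℓ)} (ha : IsExpansionMatrix a v) :
    ‖a‖ ≤ weightedSum natWeight D.seminorm 0 v.1 + weightedSum intWeight (fun _ c => ‖c‖) 0 v.2 := by
  rw [expansion_hasSum hD hv ha]
  refine (norm_add_le _ _).trans (add_le_add ?_ ?_)
  · exact tsum_of_norm_bounded (hv.1.2 0).hasSum (norm_matUnit_le_weight hD hv.1)
  · refine tsum_of_norm_bounded (hv.2 0).hasSum fun n => ?_
    rw [norm_smul, pow_zero, one_mul]
    exact mul_le_of_le_one_right (norm_nonneg _) (norm_laurentPow_le norm_shiftL_le n)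

/-- The matrix part is summable, hence tends to `0` along every diagonal, while the Toeplitz part is
constant there. So the operator determines `λ_n`, and then also the matrix part. -/
theorem IsExpansionMatrix.tendsto (hD : D.IsGood) {v : (ℕ × ℕ → L (Idx ℓ)) × (ℤ → ℂ)}
    (hv : v ∈ expansionCoeffs D) {a : L (ℕ × Idx ℓ)} (ha : IsExpansionMatrix a v) (n : ℤ) :
    Tendsto (fun i : ℕ => entry ((-n).toNat + i) (n.toNat + i) a) atTop
      (𝓝 (v.2 n • (1 : L (Idx ℓ)))) := by
  -- The diagonal `k - j = n` starts at row `max (-n) 0` and column `max n 0`.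
  have h1 : ∀ i : ℕ, entry ((-n).toNat + i) (n.toNat + i) a =
      v.1 ((-n).toNat + i, n.toNat + i) + v.2 n • (1 : L (Idx ℓ)) := fun i => by
    have : ((n.toNat + i : ℕ) : ℤ) - ((-n).toNat + i : ℕ) = n := by omega
    rw [ha, this]
  simp only [h1]
  have h2 : Summable fun p => v.1 p := Summable.of_norm_bounded (hv.1.2 0) fun p => by
    rw [pow_zero, one_mul]
    exact hD.norm_le (hv.1.1 p)
  have h3 : Function.Injective fun i : ℕ => ((-n).toNat + i, n.toNat + i) := fun i j h => by
    simpa using congrArg Prod.fst h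
  have := (h2.comp_injective h3).tendsto_atTop_zero
  simpa using this.add_const (v.2 n • (1 : L (Idx ℓ)))

theorem one_ne_zero_L (ℓ : ℕ) : (1 : L (Idx ℓ)) ≠ 0 := fun h => by
  classical
  have x := (instNonemptyIdx ℓ).some
  have h1 : (1 : L (Idx ℓ)) (e x) x = (0 : L (Idx ℓ)) (e x) x := by rw [h]
  simp [e_apply] at h1

theorem IsExpansionMatrix.unique (hD : D.IsGood) {v v' : (ℕ × ℕ → L (Idx ℓ)) × (ℤ → ℂ)}
    (hv : v ∈ expansionCoeffs D) (hv' : v' ∈ expansionCoeffs D) {a : L (ℕ × Idx ℓ)}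
    (ha : IsExpansionMatrix a v) (ha' : IsExpansionMatrix a v') : v = v' := by
  have h2 : v.2 = v'.2 := funext fun n =>
    smul_left_injective ℂ (one_ne_zero_L ℓ)
      (tendsto_nhds_unique (ha.tendsto hD hv n) (ha'.tendsto hD hv' n))
  refine Prod.ext (funext fun p => ?_) h2
  have := (ha p.1 p.2).symm.trans (ha' p.1 p.2)
  rwa [h2, add_left_inj] at this

/-- By monotonicity in both indices the maximum over `r, s ≤ m` is attained at `r = s = m`. -/
theorem IsCompleteFamily.iSup_weightedSum {V ι : Type} [AddCommGroup V] [Module ℂ V] {C : Set V}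
    {q : ℕ → V → ℝ} (h : IsCompleteFamily C q) {w : ι → ℝ} (hw : ∀ p, 1 ≤ w p) {x : ι → V}
    (hx : x ∈ WeightedFamily w C q) (m : ℕ) :
    (⨆ rs : Fin (m + 1) × Fin (m + 1), ∑' p, w p ^ (rs.1 : ℕ) * q rs.2 (x p)) =
      weightedSum w q m x := by
  apply le_antisymm
  · refine ciSup_le fun rs => ?_
    exact (WeightedFamily.summable h hw hx _ _).tsum_le_tsum (fun p => weighted_le h hw
      (Nat.lt_succ_iff.1 rs.1.2) (Nat.lt_succ_iff.1 rs.2.2) (hx.1 p) p) (hx.2 m)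
  · exact le_ciSup (f := fun rs : Fin (m + 1) × Fin (m + 1) =>
      ∑' p, w p ^ (rs.1 : ℕ) * q rs.2 (x p)) (Set.finite_range _).bddAbove
      (Fin.last m, Fin.last m)

theorem smoothData_succ_seminorm (hD : (smoothData ℓ).IsGood)
    {v : (ℕ × ℕ → L (Idx ℓ)) × (ℤ → ℂ)} (hv : v ∈ expansionCoeffs (smoothData ℓ))
    {a : L (ℕ × Idx ℓ)} (ha : IsExpansionMatrix a v) (m : ℕ) :
    (smoothData (ℓ + 1)).seminorm m a = weightedSum natWeight (smoothData ℓ).seminorm m v.1 +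
      weightedSum intWeight (fun _ c => ‖c‖) m v.2 := by
  have : {r | ∃ x c, IsExpansion (smoothData ℓ) x c a ∧
      r = (⨆ rs : Fin (m + 1) × Fin (m + 1), ∑' p : ℕ × ℕ,
          (1 + p.1 + p.2 : ℝ) ^ (rs.1 : ℕ) * (smoothData ℓ).seminorm rs.2 (x p)) +
        ∑' k : ℤ, (1 + |(k : ℝ)|) ^ m * ‖c k‖} =
      {weightedSum natWeight (smoothData ℓ).seminorm m v.1 +
        weightedSum intWeight (fun _ c => ‖c‖) m v.2} := by
    ext r
    have hsup := hD.complete.iSup_weightedSum one_le_natWeight hv.1 m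
    constructor
    · rintro ⟨x, c, hxc, rfl⟩
      obtain ⟨h1, h2⟩ := (isExpansion_iff hD).1 hxc
      obtain rfl := ha.unique hD hv h1 h2
      rw [← hsup]
      rfl
    · rintro rfl
      refine ⟨v.1, v.2, (isExpansion_iff hD).2 ⟨hv, ha⟩, ?_⟩
      rw [← hsup]
      rfl
  change sInf _ = _
  rw [this, csInf_singleton]

theorem mem_smoothData_succ (hD : (smoothData ℓ).IsGood) {a : L (ℕ × Idx ℓ)} :
    a ∈ (smoothData (ℓ + 1)).carrier ↔
      ∃ v ∈ expansionCoeffs (smoothData ℓ), IsExpansionMatrix a v := by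
  constructor
  · rintro ⟨x, c, h⟩
    exact ⟨(x, c), (isExpansion_iff hD).1 h⟩
  · rintro ⟨v, hv, ha⟩
    exact ⟨v.1, v.2, (isExpansion_iff hD).2 ⟨hv, ha⟩⟩

/-- The coefficients of the adjoint. -/
noncomputable def starCoeffs (v : (ℕ × ℕ → L (Idx ℓ)) × (ℤ → ℂ)) : (ℕ × ℕ → L (Idx ℓ)) × (ℤ → ℂ) :=
  (fun p => star (v.1 p.swap), fun n => star (v.2 (-n)))

theorem IsExpansionMatrix.star {v : (ℕ × ℕ → L (Idx ℓ)) × (ℤ → ℂ)} {a : L (ℕ × Idx ℓ)}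
    (ha : IsExpansionMatrix a v) : IsExpansionMatrix (star a) (starCoeffs v) := fun j k => by
  rw [entry_star, ha, star_add, star_smul, star_one]
  simp [starCoeffs]

theorem weight_starCoeffs (hD : D.IsGood) {v : (ℕ × ℕ → L (Idx ℓ)) × (ℤ → ℂ)}
    (hv : v ∈ expansionCoeffs D) (m : ℕ) (p : ℕ × ℕ) :
    natWeight p ^ m * D.seminorm m ((starCoeffs v).1 p) =
      natWeight p.swap ^ m * D.seminorm m (v.1 p.swap) := by
  have : natWeight p = natWeight p.swap := by
    simp only [natWeight, Prod.fst_swap, Prod.snd_swap]; ring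
  rw [this]
  congr 1
  exact hD.star_eq m (hv.1.1 _)

theorem starCoeffs_mem (hD : D.IsGood) {v : (ℕ × ℕ → L (Idx ℓ)) × (ℤ → ℂ)}
    (hv : v ∈ expansionCoeffs D) : starCoeffs v ∈ expansionCoeffs D := by
  refine ⟨⟨fun p => hD.star_mem (hv.1.1 _), fun m => ?_⟩, RapidDecay.conj_neg hv.2⟩
  simp only [weight_starCoeffs hD hv]
  exact (Equiv.prodComm ℕ ℕ).summable_iff.2 (hv.1.2 m)

theorem exists_isExpansionMatrix (hD : D.IsGood) {v : (ℕ × ℕ → L (Idx ℓ)) × (ℤ → ℂ)}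
    (hv : v ∈ expansionCoeffs D) : ∃ a, IsExpansionMatrix a v := by
  refine ⟨∑' p : ℕ × ℕ, matUnit p.1 p.2 (v.1 p) +
      ∑' n : ℤ, v.2 n • laurentPow (shiftL (Idx ℓ)) n, fun j k => ?_⟩
  rw [map_add, entry_hasSum_matUnit (summable_matUnit hD hv.1).hasSum,
    entry_hasSum_laurent (RapidDecay.summable_smul norm_shiftL_le hv.2).hasSum]

/-- The coefficient space is a product of weighted `ℓ¹` spaces, complete by induction, and the
passage from coefficients to operators is a linear bijection that matches the seminorms. Adjoints
transpose the matrix part and reflect the sequence `λ`, under which the weights are symmetric. -/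
theorem isGood_succ (hD : (smoothData ℓ).IsGood) : (smoothData (ℓ + 1)).IsGood where
  complete := ((isCompleteFamily_weighted hD.complete one_le_natWeight).prod
    isCompleteFamily_rapidDecay).transport (R := IsExpansionMatrix)
    (fun _ => mem_smoothData_succ hD) (fun v hv => exists_isExpansionMatrix hD hv)
    (fun {a b v w} h h' j k => by
      rw [map_add, h, h']
      simp only [Prod.fst_add, Prod.snd_add, Pi.add_apply, add_smul]
      abel)
    (fun c a v h j k => by
      rw [map_smul, h]
      simp only [Prod.smul_fst, Prod.smul_snd, Pi.smul_apply, smul_add, smul_smul, smul_eq_mul])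
    (fun m a v hv h => smoothData_succ_seminorm hD hv h m)
  star_mem {a} ha := by
    obtain ⟨v, hv, h⟩ := (mem_smoothData_succ hD).1 ha
    exact (mem_smoothData_succ hD).2 ⟨_, starCoeffs_mem hD hv, h.star⟩
  star_eq m a ha := by
    obtain ⟨v, hv, h⟩ := (mem_smoothData_succ hD).1 ha
    rw [smoothData_succ_seminorm hD hv h]
    refine (smoothData_succ_seminorm hD (starCoeffs_mem hD hv) h.star m).trans ?_
    congr 1
    · unfold weightedSum
      simp only [weight_starCoeffs hD hv]
      exact (Equiv.prodComm ℕ ℕ).tsum_eq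
        (fun p => natWeight p ^ m * (smoothData ℓ).seminorm m (v.1 p))
    · exact weightedSum_conj_neg v.2 m
  norm_le {a} ha := by
    obtain ⟨v, hv, h⟩ := (mem_smoothData_succ hD).1 ha
    rw [smoothData_succ_seminorm hD hv h]
    exact h.norm_le hD hv

theorem isGood_smoothData : ∀ ℓ, (smoothData ℓ).IsGood
  | 0 => isGood_zero
  | ℓ + 1 => isGood_succ (isGood_smoothData ℓ)

end Step

end Expansions

end QuantumSphere


namespace QuantumSphere

open Filter Topology

/-! ### The frames, their commutant and the entries of rapid families -/

section Frames

variable {Y K : Type} [TopologicalSpace K]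

/-- A function on `Y` as a function on `ℕ × Y`. -/
def liftCoord (d : Y → ℝ) : ℕ × Y → ℝ := fun p => d p.2

/-- The functions in `W` as functions on `ℕ × Y`, together with the first coordinate. -/
def liftWeights (W : Set (Y → ℝ)) : Set (ℕ × Y → ℝ) := insert (fstCoord Y) (liftCoord '' W)

theorem fst_mem_liftWeights (W : Set (Y → ℝ)) : fstCoord Y ∈ liftWeights W :=
  Set.mem_insert _ _

theorem lift_mem_liftWeights {W : Set (Y → ℝ)} {d : Y → ℝ} (hd : d ∈ W) :
    liftCoord d ∈ liftWeights W := Set.mem_insert_of_mem _ (Set.mem_image_of_mem _ hd)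

theorem liftWeights_mono {W W' : Set (Y → ℝ)} (h : W ⊆ W') : liftWeights W ⊆ liftWeights W' :=
  Set.insert_subset_insert (Set.image_mono h)

/-- The frame of the circle. -/
def Frame.circle : Frame ℤ where
  ad := {((fun n : ℤ => (n : ℝ)), ∅)}
  comm := ∅
  rigid := {shiftZ}

/-- The frame of the next sphere. -/
def Frame.step (F : Frame Y) : Frame (ℕ × Y) where
  ad := insert (fstCoord Y, ∅) ((fun p => (liftCoord p.1, liftWeights p.2)) '' F.ad)
  comm := insert (shiftL Y, liftWeights ∅) ((fun p => (ampR ℕ p.1, liftWeights p.2)) '' F.comm)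
  rigid := ampR ℕ '' F.rigid

/-- The frame whose conditions describe `𝒜_ℓ^∞`. -/
def frame : (ℓ : ℕ) → Frame (Idx ℓ)
  | 0 => Frame.circle
  | ℓ + 1 => (frame ℓ).step

theorem Frame.step_coords (F : Frame Y) : F.step.coords = liftWeights F.coords := by
  rw [coords, coords, step, Set.image_insert_eq, liftWeights, Set.image_image, Set.image_image]

theorem Frame.Good.step {F : Frame Y} (hF : F.Good) : F.step.Good where
  ad := by
    rw [F.step_coords]
    rintro _ (rfl | ⟨p, hp, rfl⟩)
    · exact Set.empty_subset _
    · exact liftWeights_mono (hF.ad p hp)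
  comm := by
    rw [F.step_coords]
    rintro _ (rfl | ⟨p, hp, rfl⟩)
    · exact liftWeights_mono (Set.empty_subset _)
    · exact liftWeights_mono (hF.comm p hp)

theorem frame_good : ∀ ℓ, (frame ℓ).Good
  | 0 => ⟨by rintro _ rfl; exact Set.empty_subset _, fun _ h => h.elim⟩
  | ℓ + 1 => (frame_good ℓ).step

/-- Commutation with the bilateral shift makes the coefficients constant along diagonals; induction
on `y` in both directions moves the column to `0`. -/
theorem isFourierMatrix_of_commute {T : L ℤ} (hT : shiftZ * T = T * shiftZ) :
    IsFourierMatrix T fun n => T (e 0) n := by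
  have h1 : ∀ x y : ℤ, T (e (y + 1)) (x + 1) = T (e y) x := fun x y => by
    have : (shiftZ * T) (e (y + 1)) x = (T * shiftZ) (e (y + 1)) x := by rw [hT]
    rw [mul_apply_eq_comp, mul_apply_eq_comp, shiftZ_e, add_sub_cancel_right] at this
    exact this
  intro x y
  induction y using Int.induction_on generalizing x with
  | zero => rw [sub_zero]
  | succ i ih =>
    have := h1 (x - 1) i
    rw [sub_add_cancel] at this
    rw [this, ih]
    congr 1
    ring
  | pred i ih =>
    have := h1 x (-(i : ℤ) - 1)
    rw [sub_add_cancel] at this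
    rw [← this, ih]
    congr 1
    ring

/-- An operator that commutes with all operators of the frame is a scalar. -/
theorem exists_eq_smul_one : ∀ (ℓ : ℕ) {T : L (Idx ℓ)}, (∀ p ∈ (frame ℓ).ad, IsAd p.1 T 0) →
    (∀ p ∈ (frame ℓ).comm, p.1 * T = T * p.1) → (∀ S ∈ (frame ℓ).rigid, S * T = T * S) →
    ∃ c : ℂ, T = c • (1 : L (Idx ℓ))
  | 0, T, h1, _, h3 => by
    have hT := isFourierMatrix_of_commute (h3 shiftZ rfl)
    have h0 := h1 _ rfl
    refine ⟨T (e 0) 0, ext_e fun y => ?_⟩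
    ext x
    have h := h0 x y
    change (0 : ℂ) = ((x - y : ℝ) : ℂ) * _ at h
    change _ = T (e 0) 0 * (e y : H ℤ) x
    classical
    rw [e_apply]
    split_ifs with hxy
    · subst hxy
      rw [hT, sub_self, mul_one]
    · rw [mul_zero]
      refine (mul_eq_zero.1 h.symm).resolve_left ?_
      exact_mod_cast sub_ne_zero.2 (Int.cast_injective.ne hxy)
  | ℓ + 1, T, h1, h2, h3 => by
    -- Commuting with `N` kills the off-diagonal blocks and commuting with the shift makes the
    -- diagonal blocks equal. The common block commutes with the previous frame.
    have hoff : ∀ j k : ℕ, j ≠ k → entry j k T = 0 := fun j k hjk => by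
      have := (h1 (fstCoord _, ∅) (Set.mem_insert _ _)).entry_fst j k
      rw [map_zero] at this
      refine (smul_eq_zero.1 this.symm).resolve_left ?_
      exact sub_ne_zero.2 (Nat.cast_injective.ne hjk)
    have hdiag : ∀ j : ℕ, entry j j T = entry 0 0 T := fun j => by
      induction j with
      | zero => rfl
      | succ j ih =>
        rw [← ih, ← entry_shiftL_mul, h2 (shiftL _, liftWeights ∅) (Set.mem_insert _ _)]
        exact entry_mul_shiftL_succ T j j
    obtain ⟨c, hc⟩ := exists_eq_smul_one ℓ (T := entry 0 0 T)
      (fun p hp => by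
        have := (h1 _ (Set.mem_insert_of_mem _ (Set.mem_image_of_mem _ hp))).entry 0 0
        simpa using this)
      (fun p hp => by
        have := h2 _ (Set.mem_insert_of_mem _ (Set.mem_image_of_mem _ hp))
        rw [← entry_ampR_mul, this, entry_mul_ampR])
      (fun S hS => by
        rw [← entry_ampR_mul, h3 _ (Set.mem_image_of_mem _ hS), entry_mul_ampR])
    refine ⟨c, ext_entry fun j k => ?_⟩
    rw [map_smul]
    have h1 := entry_one (Y := Idx ℓ) j k
    rw [h1]
    split_ifs with hjk
    · subst hjk
      rw [hdiag, hc]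
    · rw [hoff j k hjk, smul_zero]

variable [DiscreteTopology K]

/-- The family of all entries of a family of operators. -/
noncomputable def entries (a : K → L (ℕ × Y)) : K × ℕ × ℕ → L Y :=
  fun s => entry s.2.1 s.2.2 (a s.1)

theorem IsBC.entries {a : K → L (ℕ × Y)} (ha : IsBC a) : IsBC (entries a) := by
  obtain ⟨-, C, hC⟩ := ha
  exact ⟨continuous_of_discreteTopology, C, fun s => (norm_entry_le _ _ _).trans (hC _)⟩

variable {G W : Set (Y → ℝ)}

theorem AdSmooth.entries : ∀ {n : ℕ} {a : K → L (ℕ × Y)}, AdSmooth (liftWeights G) n a →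
    AdSmooth G n (entries a)
  | 0, _, ha => IsBC.entries ha
  | _ + 1, _, ha => ⟨ha.1.entries, fun d hd => by
      obtain ⟨a', h, h'⟩ := ha.2 _ (lift_mem_liftWeights hd)
      exact ⟨_, h.entries, fun s => (h' s.1).entry _ _⟩⟩

theorem IsSmooth.entries {a : K → L (ℕ × Y)} (ha : IsSmooth (liftWeights G) a) :
    IsSmooth G (entries a) := fun n => (ha n).entries

theorem LeftDecay.entries : ∀ {n : ℕ} {a : K → L (ℕ × Y)},
    LeftDecay (liftWeights G) (liftWeights W) n a → LeftDecay G W n (entries a)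
  | 0, _, ha => IsSmooth.entries ha
  | _ + 1, _, ha => ⟨ha.1.entries, fun d hd => by
      obtain ⟨a', h, h'⟩ := ha.2 _ (lift_mem_liftWeights hd)
      exact ⟨_, h.entries, fun s => (h' s.1).entry _ _⟩⟩

theorem IsRapid.entries {a : K → L (ℕ × Y)} (ha : IsRapid (liftWeights G) (liftWeights W) a) :
    IsRapid G W (entries a) := fun n => (ha n).entries

-- Since `1 + j + k = 1 + 2j - (j - k)`, the weight is obtained from left multiplication by `N`,
-- which gives `j`, and from the commutator with `N`, which gives `j - k`. Decay in the rows thus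
-- implies decay in the columns.
omit [DiscreteTopology K] in
theorem IsRapid.exists_weight {a : K → L (ℕ × Y)}
    (ha : IsRapid (liftWeights G) (liftWeights W) a) (n : ℕ) :
    ∃ b : K → L (ℕ × Y), IsRapid (liftWeights G) (liftWeights W) b ∧ ∀ t j k,
      entry j k (b t) = ((natWeight (j, k) ^ n : ℝ) : ℂ) • entry j k (a t) := by
  induction n with
  | zero => exact ⟨a, ha, fun t j k => by simp⟩
  | succ n ih =>
    obtain ⟨b, hb, h⟩ := ih
    obtain ⟨b', hb', h'⟩ := hb.exists_left (fst_mem_liftWeights W)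
    obtain ⟨b'', -, h''⟩ := hb.isSmooth.exists_ad (fst_mem_liftWeights G)
    refine ⟨_, (hb.add (hb'.smul 2)).sub (hb.ad (fst_mem_liftWeights G) h''), fun t j k => ?_⟩
    rw [map_sub, map_add, map_smul, (h' t).entry_fst, (h'' t).entry_fst, h]
    simp only [smul_smul, ← add_smul, ← sub_smul]
    congr 1
    simp only [natWeight]
    push_cast
    ring

/-- The entries of an operator that decreases in the first coordinate decrease rapidly. -/
theorem IsRapid.entries_weight {a : K → L (ℕ × Y)}
    (ha : IsRapid (liftWeights G) (liftWeights W) a) (n : ℕ) :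
    IsRapid G W fun s : K × ℕ × ℕ =>
      ((natWeight s.2 ^ n : ℝ) : ℂ) • entry s.2.1 s.2.2 (a s.1) := by
  obtain ⟨b, hb, h⟩ := ha.exists_weight n
  convert hb.entries using 2 with s
  exact (h _ _ _).symm

theorem IsRapid.exists_entry_bound {a : K → L (ℕ × Y)}
    (ha : IsRapid (liftWeights G) (liftWeights W) a) (n : ℕ) :
    ∃ C : ℝ, 0 ≤ C ∧ ∀ t j k, natWeight (j, k) ^ n * ‖entry j k (a t)‖ ≤ C := by
  obtain ⟨C, hC⟩ := ((ha.entries_weight n).isSmooth 0).2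
  refine ⟨max C 0, le_max_right _ _, fun t j k => ?_⟩
  have := hC (t, j, k)
  rw [norm_smul, Complex.norm_real, Real.norm_of_nonneg
    (pow_nonneg (zero_le_one.trans (one_le_natWeight _)) n)] at this
  exact this.trans (le_max_left _ _)

theorem IsRapid.tendsto_entry {a : K → L (ℕ × Y)}
    (ha : IsRapid (liftWeights G) (liftWeights W) a) (t : K) (j k : ℕ) :
    Tendsto (fun i : ℕ => entry (j + i) (k + i) (a t)) atTop (𝓝 0) := by
  obtain ⟨C, hC0, hC⟩ := ha.exists_entry_bound 1
  have hlim : Tendsto (fun i : ℕ => C / ((i : ℝ) + 1)) atTop (𝓝 0) :=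
    tendsto_const_div_atTop_nhds_zero_nat C |>.comp (tendsto_add_atTop_nat 1) |>.congr
      fun i => by simp
  refine squeeze_zero_norm (fun i => ?_) hlim
  have h := hC t (j + i) (k + i)
  rw [pow_one] at h
  have hi : (0 : ℝ) < (i : ℝ) + 1 := by positivity
  rw [le_div_iff₀ hi, mul_comm]
  refine le_trans (mul_le_mul_of_nonneg_right ?_ (norm_nonneg _)) h
  simp only [natWeight]
  push_cast
  have h1 : (0 : ℝ) ≤ j := Nat.cast_nonneg _
  have h2 : (0 : ℝ) ≤ k := Nat.cast_nonneg _
  have h3 : (0 : ℝ) ≤ i := Nat.cast_nonneg _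
  linarith

end Frames

end QuantumSphere


namespace QuantumSphere

open Filter Topology

/-! ### From the frame conditions to expansions -/

section FrameToSmooth

variable {K : Type}

theorem summable_sq_inv : Summable fun i : ℕ => (((i : ℝ) + 1) ^ 2)⁻¹ := by
  have := (summable_nat_add_iff 1).2 (Real.summable_nat_pow_inv.2 (one_lt_two))
  simpa using this

theorem summable_intWeight : Summable fun n : ℤ => (intWeight n ^ 2)⁻¹ := by
  have h : ∀ n : ℕ, (((n : ℝ) + 1) ^ 2)⁻¹ = (intWeight n ^ 2)⁻¹ := fun n => by
    simp [intWeight, add_comm]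
  have h' : ∀ n : ℕ, (((n : ℝ) + 1) ^ 2)⁻¹ = (intWeight (-n) ^ 2)⁻¹ := fun n => by
    simp [intWeight, add_comm]
  exact Summable.of_nat_of_neg (summable_sq_inv.congr h) (summable_sq_inv.congr h')

/-- Comparison with a product of two convergent series: `(1 + j + k)^4 ≥ (1 + j)^2 (1 + k)^2`. -/
theorem summable_natWeight : Summable fun p : ℕ × ℕ => (natWeight p ^ 4)⁻¹ := by
  have h2 := summable_sq_inv.mul_of_nonneg summable_sq_inv (fun _ => by positivity) (fun _ => by positivity)
  refine Summable.of_nonneg_of_le (fun p => ?_) (fun p => ?_) h2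
  · have := one_le_natWeight p
    positivity
  · rw [← mul_inv]
    have h1 : (0 : ℝ) ≤ p.1 := Nat.cast_nonneg _
    have h3 : (0 : ℝ) ≤ p.2 := Nat.cast_nonneg _
    apply inv_anti₀ (by positivity)
    have e : natWeight p ^ 4 = natWeight p ^ 2 * natWeight p ^ 2 := by ring
    rw [e]
    unfold natWeight
    refine mul_le_mul (pow_le_pow_left₀ ?_ ?_ 2) (pow_le_pow_left₀ ?_ ?_ 2) ?_ ?_ <;>
      first | positivity | linarith

/-- Uniform bounds for all powers of the weight are as good as `ℓ¹` bounds: `r` extra powers pay for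
summability. -/
theorem weightedFamily_of_bounded {V ι : Type} [AddCommGroup V] [Module ℂ V] {C : Set V}
    {q : ℕ → V → ℝ} (h : IsCompleteFamily C q) {w : ι → ℝ} (hw : ∀ p, 1 ≤ w p) {r : ℕ}
    (hr : Summable fun p => (w p ^ r)⁻¹) {x : K → ι → V} (hx : ∀ t p, x t p ∈ C)
    (hb : ∀ n m, ∃ B : ℝ, ∀ t p, w p ^ n * q m (x t p) ≤ B) :
    (∀ t, x t ∈ WeightedFamily w C q) ∧ ∀ m, ∃ B : ℝ, ∀ t, weightedSum w q m (x t) ≤ B := by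
  have key : ∀ m, ∃ B : ℝ, ∀ t p, w p ^ m * q m (x t p) ≤ B * (w p ^ r)⁻¹ := fun m => by
    obtain ⟨B, hB⟩ := hb (m + r) m
    refine ⟨B, fun t p => ?_⟩
    have hpos : 0 < w p ^ r := pow_pos (zero_lt_one.trans_le (hw p)) r
    rw [← div_eq_mul_inv, le_div_iff₀ hpos]
    refine le_trans (le_of_eq ?_) (hB t p)
    ring
  have hs : ∀ m t, Summable fun p => w p ^ m * q m (x t p) := fun m t => by
    obtain ⟨B, hB⟩ := key m
    exact Summable.of_nonneg_of_le (fun p => WeightedFamily.nonneg h hw m m (hx t p) p) (hB t)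
      (hr.mul_left B)
  refine ⟨fun t => ⟨hx t, fun m => hs m t⟩, fun m => ?_⟩
  obtain ⟨B, hB⟩ := key m
  exact ⟨_, fun t => (hs m t).tsum_le_tsum (hB t) (hr.mul_left B)⟩

theorem rapidDecay_of_bounded {c : K → ℤ → ℂ}
    (h : ∀ n : ℕ, ∃ B : ℝ, ∀ t (k : ℤ), |(k : ℝ)| ^ n * ‖c t k‖ ≤ B) :
    (∀ t, RapidDecay (c t)) ∧
      ∀ m, ∃ B : ℝ, ∀ t, weightedSum intWeight (fun _ (c : ℂ) => ‖c‖) m (c t) ≤ B := by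
  have := weightedFamily_of_bounded isCompleteFamily_norm one_le_intWeight summable_intWeight
    (x := c) (fun _ _ => trivial) (fun n m => by
      obtain ⟨B, hB⟩ := h 0
      obtain ⟨B', hB'⟩ := h n
      refine ⟨2 ^ (n - 1) * (B + B'), fun t k => ?_⟩
      have h1 := add_pow_le zero_le_one (abs_nonneg (k : ℝ)) n
      have h2 := hB t k
      have h3 := hB' t k
      rw [pow_zero, one_mul] at h2
      rw [one_pow] at h1
      calc intWeight k ^ n * ‖c t k‖ ≤ 2 ^ (n - 1) * (1 + |(k : ℝ)| ^ n) * ‖c t k‖ :=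
            mul_le_mul_of_nonneg_right h1 (norm_nonneg _)
        _ = 2 ^ (n - 1) * (‖c t k‖ + |(k : ℝ)| ^ n * ‖c t k‖) := by ring
        _ ≤ _ := by gcongr)
  exact ⟨fun t => rapidDecay_iff.2 (this.1 t), this.2⟩

/-- Families in `𝒜_ℓ^∞` on which all the seminorms are bounded. -/
def IsBoundedFamily (ℓ : ℕ) (a : K → L (Idx ℓ)) : Prop :=
  (∀ t, a t ∈ (smoothData ℓ).carrier) ∧ ∀ m, ∃ B : ℝ, ∀ t, (smoothData ℓ).seminorm m (a t) ≤ B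

variable [TopologicalSpace K]

theorem IsSmooth.exists_ad_pow {X : Type} {G : Set (X → ℝ)} {d : X → ℝ} (hd : d ∈ G)
    {a : K → L X} (ha : IsSmooth G a) (n : ℕ) : ∃ b : K → L X, IsSmooth G b ∧
      ∀ t x y, b t (e y) x = (((d x - d y) ^ n : ℝ) : ℂ) * a t (e y) x := by
  induction n with
  | zero => exact ⟨a, ha, fun t x y => by simp⟩
  | succ n ih =>
    obtain ⟨b, hb, h⟩ := ih
    obtain ⟨b', hb', h'⟩ := hb.exists_ad hd
    refine ⟨b', hb', fun t x y => ?_⟩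
    rw [h' t x y, h, pow_succ', Complex.ofReal_mul, mul_assoc]

theorem norm_e {X : Type} (x : X) : ‖(e x : H X)‖ = 1 := by
  classical
  rw [e, lp.norm_single]
  · simp
  · norm_num

theorem norm_coef_le {X : Type} (a : L X) (x y : X) : ‖a (e y) x‖ ≤ ‖a‖ := by
  refine (lp.norm_apply_le_norm (p := 2) (by norm_num) (a (e y)) x).trans ?_
  have := a.le_opNorm (e y)
  rwa [norm_e, mul_one] at this

/-- An operator commuting with the shift is given by Fourier coefficients, and the `n`-fold
commutator with the number operator multiplies the `k`-th of them by `k ^ n`. -/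
theorem isBoundedFamily_zero {a : K → L ℤ} (ha : (frame 0).Mem a) : IsBoundedFamily 0 a := by
  have hm : ∀ t, IsFourierMatrix (a t) fun n => a t (e 0) n := fun t =>
    isFourierMatrix_of_commute (ha.rigid shiftZ rfl t)
  obtain ⟨h1, h2⟩ := rapidDecay_of_bounded (c := fun t n => a t (e 0) n) fun n => by
    have hd : (fun n : ℤ => (n : ℝ)) ∈ (frame 0).coords := ⟨_, rfl, rfl⟩
    obtain ⟨b, hb, h⟩ := ha.smooth.exists_ad_pow hd n
    obtain ⟨C, hC⟩ := (hb 0).2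
    refine ⟨C, fun t k => ?_⟩
    have h3 := (norm_coef_le (b t) k 0).trans (hC t)
    rw [h, norm_mul, Complex.norm_real] at h3
    simpa using h3
  refine ⟨fun t => mem_smoothData_zero.2 ⟨_, h1 t, hm t⟩, fun m => ?_⟩
  obtain ⟨B, hB⟩ := h2 m
  exact ⟨B, fun t => (smoothData_zero_seminorm (h1 t) (hm t) m).trans_le (hB t)⟩

section Step

variable [DiscreteTopology K] {ℓ : ℕ} {a : K → L (ℕ × Idx ℓ)}

/-- The entries are rapidly convergent along the diagonals. -/
theorem exists_entry_diff_bound (ha : (frame (ℓ + 1)).Mem a) (n : ℕ) :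
    ∃ B : ℝ, 0 ≤ B ∧ ∀ t j k, ∀ i : ℕ, natWeight (j, k) ^ n *
      dist (entry (j + i) (k + i) (a t)) (entry (j + (i + 1)) (k + (i + 1)) (a t)) ≤
        B * (((i : ℝ) + 1) ^ 2)⁻¹ := by
  have h := ha.comm (shiftL _, liftWeights ∅) (Set.mem_insert _ _)
  have h' : IsRapid (liftWeights (frame ℓ).coords) (liftWeights ∅)
      fun t => shiftL _ * a t - a t * shiftL _ := by
    rw [← Frame.step_coords]; exact h
  -- Two of the `n + 2` powers of the weight are spent on the summable factor `(i + 1)⁻²`.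
  obtain ⟨B, hB0, hB⟩ := h'.exists_entry_bound (n + 2)
  refine ⟨B, hB0, fun t j k i => ?_⟩
  -- The entry of `[α_1, a]` in row `j + i` and column `k + i + 1` is the difference of two
  -- consecutive entries on the diagonal.
  have h1 := hB t (j + i) (k + i + 1)
  rw [map_sub, entry_shiftL_mul, entry_mul_shiftL_succ] at h1
  have hi : 0 < ((i : ℝ) + 1) ^ 2 := by positivity
  rw [← div_eq_mul_inv, le_div_iff₀ hi, dist_comm, dist_eq_norm]
  refine le_trans ?_ h1
  rw [mul_right_comm, pow_add]
  have hj : (0 : ℝ) ≤ j := Nat.cast_nonneg _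
  have hk : (0 : ℝ) ≤ k := Nat.cast_nonneg _
  have hi' : (0 : ℝ) ≤ i := Nat.cast_nonneg _
  have hw : 0 ≤ natWeight (j, k) := zero_le_one.trans (one_le_natWeight _)
  have e1 : natWeight (j, k) ≤ natWeight (j + i, k + i + 1) := by
    simp only [natWeight]; push_cast; linarith
  have e2 : (i : ℝ) + 1 ≤ natWeight (j + i, k + i + 1) := by
    simp only [natWeight]; push_cast; linarith
  refine mul_le_mul_of_nonneg_right ?_ (norm_nonneg _)
  exact mul_le_mul (pow_le_pow_left₀ hw e1 n) (pow_le_pow_left₀ (by positivity) e2 2)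
    (by positivity) (pow_nonneg (hw.trans e1) n)

/-- Consecutive entries on a diagonal have summable distances, so they converge. All commutators
tested by the previous frame decay along the diagonal, so the limit commutes with that frame and is
a scalar. -/
theorem exists_symbol (ha : (frame (ℓ + 1)).Mem a) : ∃ c : K → ℤ → ℂ, ∀ t (j k : ℕ),
    Tendsto (fun i : ℕ => entry (j + i) (k + i) (a t)) atTop
      (𝓝 (c t ((k : ℤ) - j) • (1 : L (Idx ℓ)))) := by
  have hlim : ∀ t j k, ∃ T, Tendsto (fun i : ℕ => entry (j + i) (k + i) (a t)) atTop (𝓝 T) := by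
    intro t j k
    obtain ⟨B, -, hB⟩ := exists_entry_diff_bound ha 0
    refine cauchySeq_tendsto_of_complete ?_
    refine cauchySeq_of_summable_dist (Summable.of_nonneg_of_le (fun _ => dist_nonneg)
      (fun i => ?_) (summable_sq_inv.mul_left B))
    simpa using hB t j k i
  have hscal : ∀ t j k, ∃ c : ℂ, Tendsto (fun i : ℕ => entry (j + i) (k + i) (a t)) atTop
      (𝓝 (c • (1 : L (Idx ℓ)))) := by
    intro t j k
    obtain ⟨T, hT⟩ := hlim t j k
    obtain ⟨c, rfl⟩ := exists_eq_smul_one ℓ (T := T) (fun p hp x y => by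
        obtain ⟨a', h, h'⟩ := ha.ad _ (Set.mem_insert_of_mem _ (Set.mem_image_of_mem _ hp))
        have h'' : IsRapid (liftWeights (frame ℓ).coords) (liftWeights p.2) a' := by
          rw [← Frame.step_coords]; exact h
        have h0 := ((coefL x y).continuous.tendsto _).comp (h''.tendsto_entry t j k)
        have h1 := (((coefL x y).continuous.tendsto _).comp hT).const_mul
          (((p.1 x - p.1 y : ℝ)) : ℂ)
        simp only [Function.comp_def, coefL_apply] at h0 h1
        exact tendsto_nhds_unique h0
          (h1.congr fun i => (((h' t).entry (j + i) (k + i)) x y).symm))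
      (fun p hp => by
        have h := ha.comm _ (Set.mem_insert_of_mem _ (Set.mem_image_of_mem _ hp))
        have h' : IsRapid (liftWeights (frame ℓ).coords) (liftWeights p.2)
            fun t => ampR ℕ p.1 * a t - a t * ampR ℕ p.1 := by
          rw [← Frame.step_coords]; exact h
        have h0 := h'.tendsto_entry t j k
        have h1 := (hT.const_mul p.1).sub (hT.mul_const p.1)
        rw [← sub_eq_zero]
        refine tendsto_nhds_unique h1 (h0.congr fun i => ?_)
        rw [map_sub, entry_ampR_mul, entry_mul_ampR])
      (fun S hS => by
        have h := ha.rigid _ (Set.mem_image_of_mem _ hS) t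
        refine tendsto_nhds_unique (hT.const_mul S) ((hT.mul_const S).congr fun i => ?_)
        rw [← entry_mul_ampR, ← entry_ampR_mul]
        exact congrArg _ h.symm)
    exact ⟨c, hT⟩
  choose c hc using hscal
  -- The limit depends only on `k - j`: sequences started at different points of a diagonal share
  -- their tails. The first point of the diagonal serves as representative.
  refine ⟨fun t n => c t (-n).toNat n.toNat, fun t j k => ?_⟩
  have h := hc t (-((k : ℤ) - j)).toNat ((k : ℤ) - j).toNat
  obtain ⟨i0, h1, h2⟩ : ∃ i0 : ℕ, j = (-((k : ℤ) - j)).toNat + i0 ∧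
      k = ((k : ℤ) - j).toNat + i0 := ⟨min j k, by omega, by omega⟩
  refine (h.comp (tendsto_add_atTop_nat i0)).congr fun i => ?_
  simp only [Function.comp_def]
  congr 2
  · rw [← add_assoc, add_right_comm, ← h1]
  · rw [← add_assoc, add_right_comm, ← h2]

-- The `n`-fold commutator with `N` has the entries `(j - k)^n a_{jk}`, uniformly bounded by its
-- norm. The bound passes to the limit along the diagonal `k - j`.
omit [DiscreteTopology K] in
theorem symbol_bound (ha : (frame (ℓ + 1)).Mem a) {c : K → ℤ → ℂ}
    (hc : ∀ t (j k : ℕ), Tendsto (fun i : ℕ => entry (j + i) (k + i) (a t)) atTop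
      (𝓝 (c t ((k : ℤ) - j) • (1 : L (Idx ℓ))))) (n : ℕ) :
    ∃ B : ℝ, ∀ t (k : ℤ), |(k : ℝ)| ^ n * ‖c t k‖ ≤ B := by
  have hd : fstCoord (Idx ℓ) ∈ (frame (ℓ + 1)).coords := ⟨_, Set.mem_insert _ _, rfl⟩
  obtain ⟨b, hb, h⟩ := ha.smooth.exists_ad_pow hd n
  obtain ⟨B, hB⟩ := (hb 0).2
  have hn : 0 < ‖(1 : L (Idx ℓ))‖ := norm_pos_iff.2 (one_ne_zero_L ℓ)
  have hent : ∀ t j k, entry j k (b t) = (((((j : ℝ) - k) ^ n : ℝ)) : ℂ) • entry j k (a t) :=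
    fun t j k => ext_e fun y => by
      ext x
      change _ = _ * (entry j k (a t) (e y)) x
      rw [entry_e, entry_e, h]
      rfl
  refine ⟨B / ‖(1 : L (Idx ℓ))‖, fun t k => ?_⟩
  rw [le_div_iff₀ hn]
  have hk : ((k.toNat : ℤ)) - ((-k).toNat : ℤ) = k := by omega
  have h1 := hc t (-k).toNat k.toNat
  rw [hk] at h1
  have h2 := (h1.norm.const_mul (|(k : ℝ)| ^ n))
  rw [norm_smul, ← mul_assoc] at h2
  refine le_of_tendsto h2 (Eventually.of_forall fun i => ?_)
  refine le_trans (le_of_eq ?_) ((norm_entry_le ((-k).toNat + i) (k.toNat + i) (b t)).trans (hB t))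
  rw [hent, norm_smul, Complex.norm_real, norm_pow, Real.norm_eq_abs]
  congr 2
  rw [abs_sub_comm]
  congr 1
  have : ((k.toNat + i : ℕ) : ℤ) - ((-k).toNat + i : ℕ) = k := by omega
  conv_lhs => rw [← this]
  push_cast
  rfl

/-- Telescoping along the diagonal from `(j, k)` to the limit, with the weight of the starting point
divided out of each step. -/
theorem entry_sub_symbol_bound (ha : (frame (ℓ + 1)).Mem a) {c : K → ℤ → ℂ}
    (hc : ∀ t (j k : ℕ), Tendsto (fun i : ℕ => entry (j + i) (k + i) (a t)) atTop
      (𝓝 (c t ((k : ℤ) - j) • (1 : L (Idx ℓ))))) (n : ℕ) :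
    ∃ B : ℝ, ∀ t (j k : ℕ), natWeight (j, k) ^ n *
      ‖entry j k (a t) - c t ((k : ℤ) - j) • (1 : L (Idx ℓ))‖ ≤ B := by
  obtain ⟨B, hB0, hB⟩ := exists_entry_diff_bound ha n
  refine ⟨∑' i : ℕ, B * (((i : ℝ) + 1) ^ 2)⁻¹, fun t j k => ?_⟩
  have hw : 0 < natWeight (j, k) ^ n := pow_pos (zero_lt_one.trans_le (one_le_natWeight _)) n
  have h1 := dist_le_tsum_of_dist_le_of_tendsto₀
    (f := fun i : ℕ => entry (j + i) (k + i) (a t))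
    (fun i : ℕ => B * (((i : ℝ) + 1) ^ 2)⁻¹ / natWeight (j, k) ^ n)
    (fun i => by rw [le_div_iff₀ hw, mul_comm]; exact hB t j k i)
    ((summable_sq_inv.mul_left B).div_const _) (hc t j k)
  rw [tsum_div_const, le_div_iff₀ hw, mul_comm, dist_eq_norm] at h1
  exact h1

/-- Subtracting a scalar changes no commutator. So the differences `a_{jk} - λ_{k-j}`, with any
power of the weight, form one family over `K × ℕ × ℕ` that satisfies the previous frame. The
induction hypothesis for this larger index set bounds all seminorms uniformly in `j, k`, which is
the rapid decay of the matrix part. -/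
theorem isBoundedFamily_step
    (ih : ∀ u : K × ℕ × ℕ → L (Idx ℓ), (frame ℓ).Mem u → IsBoundedFamily ℓ u)
    (ha : (frame (ℓ + 1)).Mem a) : IsBoundedFamily (ℓ + 1) a := by
  obtain ⟨c, hc⟩ := exists_symbol ha
  obtain ⟨hc1, hc2⟩ := rapidDecay_of_bounded (symbol_bound ha hc)
  let x : K → ℕ × ℕ → L (Idx ℓ) := fun t p =>
    entry p.1 p.2 (a t) - c t ((p.2 : ℤ) - p.1) • (1 : L (Idx ℓ))
  have hmem : ∀ n : ℕ, (frame ℓ).Mem fun s : K × ℕ × ℕ =>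
      ((natWeight s.2 ^ n : ℝ) : ℂ) • x s.1 s.2 := fun n => by
    have hsub : ∀ z : ℂ, ∀ T b : L (Idx ℓ), ∀ r : ℂ, T * (r • (b - z • 1)) - r • (b - z • 1) * T =
        r • (T * b - b * T) := fun z T b r => by
      simp only [mul_smul_comm, smul_mul_assoc, mul_sub, sub_mul, mul_one, one_mul, smul_sub]
      abel
    refine .of_ad ⟨continuous_of_discreteTopology, ?_⟩ (fun p hp => ?_) (fun p hp => ?_)
      (fun S hS s => ?_)
    · obtain ⟨B, hB⟩ := entry_sub_symbol_bound ha hc n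
      refine ⟨B, fun s => ?_⟩
      rw [norm_smul, Complex.norm_real, Real.norm_of_nonneg
        (pow_nonneg (zero_le_one.trans (one_le_natWeight _)) n)]
      exact hB s.1 s.2.1 s.2.2
    · obtain ⟨a', h, h'⟩ := ha.ad _ (Set.mem_insert_of_mem _ (Set.mem_image_of_mem _ hp))
      have h'' : IsRapid (liftWeights (frame ℓ).coords) (liftWeights p.2) a' := by
        rw [← Frame.step_coords]; exact h
      refine ⟨_, h''.entries_weight n, fun s => ?_⟩
      refine IsAd.smul _ ?_
      have := ((h' s.1).entry s.2.1 s.2.2).add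
        ((IsAd.one p.1).smul (-c s.1 ((s.2.2 : ℤ) - s.2.1)))
      simpa only [smul_zero, add_zero, neg_smul, ← sub_eq_add_neg] using this
    · have h := ha.comm _ (Set.mem_insert_of_mem _ (Set.mem_image_of_mem _ hp))
      have h' : IsRapid (liftWeights (frame ℓ).coords) (liftWeights p.2)
          fun t => ampR ℕ p.1 * a t - a t * ampR ℕ p.1 := by
        rw [← Frame.step_coords]; exact h
      convert h'.entries_weight n using 2 with s
      rw [hsub, map_sub, entry_ampR_mul, entry_mul_ampR]
    · have h := ha.rigid _ (Set.mem_image_of_mem _ hS) s.1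
      rw [← sub_eq_zero, hsub, ← entry_ampR_mul, ← entry_mul_ampR, ← map_sub, sub_eq_zero.2 h,
        map_zero, smul_zero]
  have hD := isGood_smoothData ℓ
  have hxC : ∀ t p, x t p ∈ (smoothData ℓ).carrier := fun t p => by
    simpa using (ih _ (hmem 0)).1 (t, p)
  obtain ⟨hx1, hx2⟩ := weightedFamily_of_bounded hD.complete one_le_natWeight summable_natWeight
    (x := x) hxC fun n m => by
      obtain ⟨B, hB⟩ := (ih _ (hmem n)).2 m
      refine ⟨B, fun t p => ?_⟩
      have := hB (t, p)
      rwa [hD.complete.smul_eq m _ (hxC t p), Complex.norm_real, Real.norm_of_nonneg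
        (pow_nonneg (zero_le_one.trans (one_le_natWeight _)) n)] at this
  have hv : ∀ t, (x t, c t) ∈ expansionCoeffs (smoothData ℓ) := fun t => ⟨hx1 t, hc1 t⟩
  have hM : ∀ t, IsExpansionMatrix (a t) (x t, c t) := fun t j k => by simp [x]
  refine ⟨fun t => (mem_smoothData_succ hD).2 ⟨_, hv t, hM t⟩, fun m => ?_⟩
  obtain ⟨B, hB⟩ := hx2 m
  obtain ⟨B', hB'⟩ := hc2 m
  refine ⟨B + B', fun t => ?_⟩
  rw [smoothData_succ_seminorm hD (hv t) (hM t)]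
  exact add_le_add (hB t) (hB' t)

end Step

/-- Families that satisfy the conditions of the frame are bounded families in `𝒜_ℓ^∞`. -/
theorem Frame.Mem.isBoundedFamily : ∀ (ℓ : ℕ) {K : Type} [TopologicalSpace K] [DiscreteTopology K]
    {a : K → L (Idx ℓ)}, (frame ℓ).Mem a → IsBoundedFamily ℓ a
  | 0, _, _, _, _, ha => isBoundedFamily_zero ha
  | ℓ + 1, _, _, _, _, ha => isBoundedFamily_step (fun _ hu => hu.isBoundedFamily ℓ) ha

end FrameToSmooth

end QuantumSphere


namespace QuantumSphere

open Filter Topology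

/-! ### From expansions to the frame conditions -/

section SmoothToFrame

variable {κ X Y : Type}

/-- Functions of polynomial growth with respect to the weight `w`. -/
def IsTame (w : κ → ℝ) (g : κ → ℂ) : Prop := ∃ (C : ℝ) (n : ℕ), ∀ s, ‖g s‖ ≤ C * w s ^ n

variable {w : κ → ℝ}

theorem IsTame.const (w : κ → ℝ) (c : ℂ) : IsTame w fun _ => c := ⟨‖c‖, 0, fun s => by simp⟩

theorem IsTame.mul {g g' : κ → ℂ} (h : IsTame w g) (h' : IsTame w g') :
    IsTame w fun s => g s * g' s := by
  obtain ⟨C, n, hC⟩ := h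
  obtain ⟨C', n', hC'⟩ := h'
  refine ⟨C * C', n + n', fun s => ?_⟩
  rw [norm_mul, pow_add, mul_mul_mul_comm]
  exact mul_le_mul (hC s) (hC' s) (norm_nonneg _) ((norm_nonneg _).trans (hC s))

theorem IsTame.of_le {g : κ → ℂ} (C : ℝ) (h : ∀ s, ‖g s‖ ≤ C * w s) : IsTame w g :=
  ⟨C, 1, fun s => by simpa using h s⟩

theorem IsTame.sub (hw : ∀ s, 1 ≤ w s) {g g' : κ → ℂ} (h : IsTame w g) (h' : IsTame w g') :
    IsTame w fun s => g s - g' s := by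
  obtain ⟨C, n, hC⟩ := h
  obtain ⟨C', n', hC'⟩ := h'
  refine ⟨|C| + |C'|, n + n', fun s => (norm_sub_le _ _).trans ?_⟩
  rw [add_mul]
  have h0 := zero_le_one.trans (hw s)
  refine add_le_add ((hC s).trans ?_) ((hC' s).trans ?_)
  · exact mul_le_mul (le_abs_self C) (pow_le_pow_right₀ (hw s) (Nat.le_add_right n n'))
      (pow_nonneg h0 n) (abs_nonneg C)
  · exact mul_le_mul (le_abs_self C') (pow_le_pow_right₀ (hw s) (Nat.le_add_left n' n))
      (pow_nonneg h0 n') (abs_nonneg C')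

/-- Functions that remain bounded after multiplication by functions of polynomial growth. -/
def IsRapidScalar (w : κ → ℝ) (r : κ → ℂ) : Prop :=
  ∀ g : κ → ℂ, IsTame w g → ∃ B : ℝ, ∀ s, ‖g s * r s‖ ≤ B

theorem IsRapidScalar.mul {r g : κ → ℂ} (hr : IsRapidScalar w r) (hg : IsTame w g) :
    IsRapidScalar w fun s => g s * r s := fun g' hg' => by
  obtain ⟨B, hB⟩ := hr _ (hg'.mul hg)
  exact ⟨B, fun s => by simpa only [mul_assoc] using hB s⟩

theorem IsRapidScalar.of_pow {r : κ → ℂ} (hw : ∀ s, 1 ≤ w s)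
    (h : ∀ n : ℕ, ∃ B : ℝ, ∀ s, w s ^ n * ‖r s‖ ≤ B) : IsRapidScalar w r := by
  rintro g ⟨C, n, hC⟩
  obtain ⟨B, hB⟩ := h n
  refine ⟨|C| * B, fun s => ?_⟩
  rw [norm_mul]
  have h0 : 0 ≤ w s ^ n := pow_nonneg (zero_le_one.trans (hw s)) n
  calc ‖g s‖ * ‖r s‖ ≤ (|C| * w s ^ n) * ‖r s‖ := mul_le_mul_of_nonneg_right
        ((hC s).trans (mul_le_mul_of_nonneg_right (le_abs_self C) h0)) (norm_nonneg _)
    _ = |C| * (w s ^ n * ‖r s‖) := mul_assoc _ _ _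
    _ ≤ _ := mul_le_mul_of_nonneg_left (hB s) (abs_nonneg C)

theorem isTame_int {n : κ → ℤ} (hn : ∀ s, |(n s : ℝ)| ≤ w s) : IsTame w fun s => (n s : ℂ) :=
  .of_le 1 fun s => by simpa using hn s

variable [TopologicalSpace κ] [DiscreteTopology κ]

/-- Rapidly decreasing multiples of joint eigenvectors of the derivations are smooth. -/
theorem isSmooth_eigen {G : Set (X → ℝ)} {U : κ → L X} (hU : ∀ s, ‖U s‖ ≤ 1)
    (h : ∀ d ∈ G, ∃ g : κ → ℂ, IsTame w g ∧ ∀ s, IsAd d (U s) (g s • U s)) (n : ℕ) :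
    ∀ {r : κ → ℂ}, IsRapidScalar w r → AdSmooth G n fun s => r s • U s := by
  have hbc : ∀ {r : κ → ℂ}, IsRapidScalar w r → IsBC fun s => r s • U s := fun {r} hr => by
    obtain ⟨B, hB⟩ := hr _ (IsTame.const w 1)
    refine ⟨continuous_of_discreteTopology, B, fun s => ?_⟩
    rw [norm_smul]
    refine (mul_le_of_le_one_right (norm_nonneg _) (hU s)).trans ?_
    simpa using hB s
  induction n with
  | zero => exact hbc
  | succ n ih =>
    refine fun {r} hr => ⟨hbc hr, fun d hd => ?_⟩
    obtain ⟨g, hg, hg'⟩ := h d hd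
    refine ⟨_, ih (hr.mul hg), fun s => ?_⟩
    have := (hg' s).smul (r s)
    rwa [smul_smul, mul_comm (r s)] at this

omit [DiscreteTopology κ] in
theorem IsSmooth.isRapid_empty {G : Set (X → ℝ)} {a : κ → L X} (ha : IsSmooth G a) :
    IsRapid G ∅ a
  | 0 => ha
  | _ + 1 => ⟨ha, fun _ hd => hd.elim⟩

section MatUnit

variable {j k : κ → ℕ}

theorem IsBC.matUnit {u : κ → L Y} (hu : IsBC u) : IsBC fun s => matUnit (j s) (k s) (u s) := by
  obtain ⟨-, C, hC⟩ := hu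
  exact ⟨continuous_of_discreteTopology, C, fun s => (norm_matUnit_le _ _ _).trans (hC s)⟩

variable {G W : Set (Y → ℝ)}

/-- A commutator with `N` multiplies `u` by `j - k`. The hypothesis is therefore made for all tame
multiples of `u`, a form that reproduces itself in the induction. -/
theorem AdSmooth.matUnit (hw : ∀ s, 1 ≤ w s) (hj : IsTame w fun s => (j s : ℂ))
    (hk : IsTame w fun s => (k s : ℂ)) (n : ℕ) : ∀ {u : κ → L Y},
    (∀ g : κ → ℂ, IsTame w g → AdSmooth G n fun s => g s • u s) →
    AdSmooth (liftWeights G) n fun s => QuantumSphere.matUnit (j s) (k s) (u s) := by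
  induction n with
  | zero =>
    intro u hu
    have := hu _ (IsTame.const w 1)
    simp only [one_smul] at this
    exact IsBC.matUnit this
  | succ n ih =>
    intro u hu
    have h1 := hu _ (IsTame.const w 1)
    simp only [one_smul] at h1
    refine ⟨h1.isBC.matUnit, ?_⟩
    rintro _ (rfl | ⟨d, hd, rfl⟩)
    · refine ⟨_, ih (u := fun s => ((j s : ℂ) - k s) • u s) fun g hg => ?_,
        fun s => isAd_fst_matUnit _ _ _⟩
      have := (hu _ (hg.mul (hj.sub hw hk))).of_succ
      simpa only [smul_smul] using this
    · obtain ⟨u', h, h'⟩ := h1.2 d hd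
      refine ⟨_, ih (u := u') fun g hg => ?_, fun s => (h' s).matUnit _ _⟩
      obtain ⟨u'', k1, k2⟩ := (hu g hg).2 d hd
      have : (fun s => g s • u' s) = u'' := funext fun s => ((h' s).smul (g s)).unique (k2 s)
      rwa [this]

theorem LeftDecay.matUnit (hw : ∀ s, 1 ≤ w s) (hj : IsTame w fun s => (j s : ℂ))
    (hk : IsTame w fun s => (k s : ℂ)) (n : ℕ) : ∀ {u : κ → L Y},
    (∀ g : κ → ℂ, IsTame w g → LeftDecay G W n fun s => g s • u s) →
    LeftDecay (liftWeights G) (liftWeights W) n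
      fun s => QuantumSphere.matUnit (j s) (k s) (u s) := by
  induction n with
  | zero =>
    exact fun {u} hu m => AdSmooth.matUnit hw hj hk m fun g hg => hu g hg m
  | succ n ih =>
    intro u hu
    have h1 := hu _ (IsTame.const w 1)
    simp only [one_smul] at h1
    refine ⟨fun m => AdSmooth.matUnit hw hj hk m fun g hg => (hu g hg).isSmooth m, ?_⟩
    rintro _ (rfl | ⟨d, hd, rfl⟩)
    · refine ⟨_, ih (u := fun s => (j s : ℂ) • u s) fun g hg => ?_,
        fun s => isLeft_fst_matUnit _ _ _⟩
      have := (hu _ (hg.mul hj)).of_succ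
      simpa only [smul_smul] using this
    · obtain ⟨u', h, h'⟩ := h1.2 d hd
      refine ⟨_, ih (u := u') fun g hg => ?_, fun s => (h' s).matUnit _ _⟩
      obtain ⟨u'', k1, k2⟩ := (hu g hg).2 d hd
      have : (fun s => g s • u' s) = u'' := funext fun s => ((h' s).smul (g s)).unique (k2 s)
      rwa [this]

theorem IsRapid.matUnit (hw : ∀ s, 1 ≤ w s) (hj : IsTame w fun s => (j s : ℂ))
    (hk : IsTame w fun s => (k s : ℂ)) {u : κ → L Y}
    (hu : ∀ g : κ → ℂ, IsTame w g → IsRapid G W fun s => g s • u s) :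
    IsRapid (liftWeights G) (liftWeights W)
      fun s => QuantumSphere.matUnit (j s) (k s) (u s) :=
  fun n => LeftDecay.matUnit hw hj hk n fun g hg => hu g hg n

/-- The zero scalar corrects the truncated subtraction at `i = 0`, so that one formula covers a
whole family of matrix units. -/
theorem shiftL_mul_matUnit (i l : ℕ) (x : L Y) : shiftL Y * QuantumSphere.matUnit i l x =
    QuantumSphere.matUnit (i - 1) l ((if i = 0 then (0 : ℂ) else 1) • x) := by
  cases i with
  | zero => simp [shiftL_mul_matUnit_zero]
  | succ i => simp [shiftL_mul_matUnit_succ]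

/-- Multiplication by `α_1` on the left lowers the row by one and on the right raises the column by
one. Its commutator is thus a difference of two families of the same kind, with indices still
controlled by the weight. -/
theorem Frame.Mem.matUnit (hw : ∀ s, 1 ≤ w s) (hj : ∀ s, (j s : ℝ) ≤ w s)
    (hk : ∀ s, (k s : ℝ) ≤ w s) {F : Frame Y} {u : κ → L Y}
    (hu : ∀ g : κ → ℂ, IsTame w g → F.Mem fun s => g s • u s) :
    F.step.Mem fun s => QuantumSphere.matUnit (j s) (k s) (u s) := by
  have hj1 : IsTame w fun s => (j s : ℂ) := .of_le 1 fun s => by simpa using hj s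
  have hk1 : IsTame w fun s => (k s : ℂ) := .of_le 1 fun s => by simpa using hk s
  have hj2 : IsTame w fun s => ((j s - 1 : ℕ) : ℂ) := .of_le 1 fun s => by
    rw [Complex.norm_natCast, one_mul]
    exact le_trans (Nat.cast_le.2 (Nat.sub_le _ _)) (hj s)
  have hk2 : IsTame w fun s => ((k s + 1 : ℕ) : ℂ) := .of_le 2 fun s => by
    rw [Complex.norm_natCast]
    push_cast
    linarith [hk s, hw s]
  have hif : IsTame w fun s => if j s = 0 then (0 : ℂ) else 1 := ⟨1, 0, fun s => by
    beta_reduce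
    split_ifs <;> simp⟩
  have hu1 := hu _ (IsTame.const w 1)
  simp only [one_smul] at hu1
  have hsm : ∀ {g : κ → ℂ}, IsTame w g → IsSmooth F.coords fun s => g s • u s :=
    fun hg => (hu _ hg).smooth
  refine ⟨?_, ?_, ?_, ?_⟩
  · rw [F.step_coords]
    exact fun n => AdSmooth.matUnit hw hj1 hk1 n fun g hg => hsm hg n
  · rw [F.step_coords]
    rintro _ (rfl | ⟨p, hp, rfl⟩)
    · refine ⟨_, IsSmooth.isRapid_empty fun n => AdSmooth.matUnit hw hj1 hk1 n fun g hg => ?_,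
        fun s => isAd_fst_matUnit _ _ _⟩
      have := hsm (hg.mul (hj1.sub hw hk1)) n
      simpa only [smul_smul] using this
    · obtain ⟨u', h, h'⟩ := hu1.ad p hp
      refine ⟨_, IsRapid.matUnit hw hj1 hk1 (u := u') fun g hg => ?_, fun s => (h' s).matUnit _ _⟩
      obtain ⟨u'', k1, k2⟩ := (hu g hg).ad p hp
      have : (fun s => g s • u' s) = u'' := funext fun s => ((h' s).smul (g s)).unique (k2 s)
      rwa [this]
  · rw [F.step_coords]
    rintro _ (rfl | ⟨p, hp, rfl⟩)
    · simp only [shiftL_mul_matUnit, matUnit_mul_shiftL]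
      refine IsRapid.sub ?_ ?_
      · refine IsRapid.matUnit hw hj2 hk1
          (u := fun s => (if j s = 0 then (0 : ℂ) else 1) • u s) fun g hg => ?_
        have := (hsm (hg.mul hif)).isRapid_empty
        simpa only [smul_smul] using this
      · exact IsRapid.matUnit hw hj1 hk2 fun g hg => (hsm hg).isRapid_empty
    · have := IsRapid.matUnit hw hj1 hk1 (u := fun s => p.1 * u s - u s * p.1) fun g hg => by
        have := (hu g hg).comm p hp
        simpa only [mul_smul_comm, smul_mul_assoc, ← smul_sub] using this
      convert this using 2 with s
      rw [map_sub, ampR_mul_matUnit, matUnit_mul_ampR]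
  · rintro _ ⟨T, hT, rfl⟩ s
    rw [ampR_mul_matUnit, matUnit_mul_ampR, hu1.rigid T hT]

end MatUnit

section Laurent

variable {n : κ → ℤ}

theorem Frame.Mem.laurentPow_circle (hn : ∀ s, |(n s : ℝ)| ≤ w s) {r : κ → ℂ}
    (hr : IsRapidScalar w r) :
    Frame.circle.Mem fun s => r s • laurentPow (star shiftZ) (n s) := by
  have hs : ∀ s, ‖laurentPow (star shiftZ) (n s)‖ ≤ 1 := fun s =>
    norm_laurentPow_le norm_star_shiftZ_le _
  have had : ∀ s, IsAd (fun i : ℤ => (i : ℝ)) (laurentPow (star shiftZ) (n s))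
      ((n s : ℂ) • laurentPow (star shiftZ) (n s)) := fun s x y => by
    change (n s : ℂ) * laurentPow (star shiftZ) (n s) (e y) x = _
    rw [laurentPow_star_shiftZ_coef]
    split_ifs with h
    · rw [← h]; push_cast; ring
    · simp
  have hsm : ∀ {r : κ → ℂ}, IsRapidScalar w r → IsSmooth Frame.circle.coords
      fun s => r s • laurentPow (star shiftZ) (n s) := fun hr m => by
    refine isSmooth_eigen hs ?_ m hr
    rintro _ ⟨_, rfl, rfl⟩
    exact ⟨_, isTame_int hn, had⟩
  refine ⟨hsm hr, ?_, fun _ h => h.elim, ?_⟩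
  · rintro _ rfl
    refine ⟨_, (hsm (hr.mul (isTame_int hn))).isRapid_empty, fun s => ?_⟩
    have := (had s).smul (r s)
    rwa [smul_smul, mul_comm (r s)] at this
  · rintro _ rfl s
    rw [mul_smul_comm, smul_mul_assoc]
    congr 1
    refine ext_e fun y => ?_
    rw [mul_apply_eq_comp, mul_apply_eq_comp, laurentPow_star_shiftZ_e, shiftZ_e, shiftZ_e,
      laurentPow_star_shiftZ_e]
    congr 1
    ring

/-- The powers of `α_1` are eigenvectors of `[N, ·]` with eigenvalue `-n` and commute with every `I
⊗ T`. Only the commutator with `α_1` itself is not immediate: it is a matrix unit with row at most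
`|n|`, so the rapid decrease of `r` gives its decay. -/
theorem Frame.Mem.laurentPow_step (hw : ∀ s, 1 ≤ w s) (hn : ∀ s, |(n s : ℝ)| ≤ w s)
    {r : κ → ℂ} (hr : IsRapidScalar w r) (F : Frame Y) :
    F.step.Mem fun s => r s • laurentPow (shiftL Y) (n s) := by
  have hs : ∀ s, ‖laurentPow (shiftL Y) (n s)‖ ≤ 1 := fun s =>
    norm_laurentPow_le norm_shiftL_le _
  have hneg : IsTame w fun s => (-n s : ℂ) := .of_le 1 fun s => by simpa using hn s
  have hsm : ∀ {r : κ → ℂ}, IsRapidScalar w r → IsSmooth (liftWeights F.coords)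
      fun s => r s • laurentPow (shiftL Y) (n s) := fun hr m => by
    refine isSmooth_eigen hs ?_ m hr
    rintro _ (rfl | ⟨d, hd, rfl⟩)
    · exact ⟨_, hneg, fun s => isAd_fst_laurentPow _⟩
    · exact ⟨_, .const w 0, fun s => by simpa using! isAd_snd_laurentPow d (n s)⟩
  refine ⟨?_, ?_, ?_, ?_⟩
  · rw [F.step_coords]
    exact hsm hr
  · rw [F.step_coords]
    rintro _ (rfl | ⟨p, hp, rfl⟩)
    · refine ⟨_, (hsm (hr.mul hneg)).isRapid_empty, fun s => ?_⟩
      have := (isAd_fst_laurentPow (Y := Y) (n s)).smul (r s)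
      rwa [smul_smul, mul_comm (r s)] at this
    · refine ⟨_, IsRapid.zero, fun s => ?_⟩
      have := (isAd_snd_laurentPow p.1 (n s)).smul (r s)
      rwa [smul_zero] at this
  · rw [F.step_coords]
    rintro _ (rfl | ⟨p, hp, rfl⟩)
    · have hif : IsTame w fun s => if n s < 0 then (1 : ℂ) else 0 := ⟨1, 0, fun s => by
        beta_reduce
        split_ifs <;> simp⟩
      have hj : IsTame w fun s => ((-n s - 1).toNat : ℂ) := .of_le 1 fun s => by
        rw [Complex.norm_natCast, one_mul]
        refine le_trans ?_ (hn s)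
        have h1 : (((-n s - 1).toNat : ℕ) : ℤ) ≤ |n s| := by
          rcases abs_cases (n s) with h | h <;> omega
        have h2 : ((((-n s - 1).toNat : ℕ) : ℤ) : ℝ) ≤ ((|n s| : ℤ) : ℝ) := Int.cast_le.2 h1
        simpa using h2
      have hone : ∀ {r : κ → ℂ}, IsRapidScalar w r → IsSmooth F.coords
          fun s => r s • (1 : L Y) := fun hr => by
        obtain ⟨B, hB⟩ := hr _ (.const w 1)
        exact (Frame.Mem.scalar (F := F) continuous_of_discreteTopology
          ⟨B, fun s => by simpa using hB s⟩).smooth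
      have := IsRapid.matUnit (G := F.coords) (W := ∅) hw hj (k := fun _ => 0)
        (IsTame.const w _) (u := fun s => ((if n s < 0 then (1 : ℂ) else 0) * r s) • (1 : L Y))
        fun g hg => by
          have := (hone ((hr.mul hif).mul hg)).isRapid_empty
          simpa only [smul_smul] using this
      convert this using 2 with s
      rw [mul_smul_comm, smul_mul_assoc, ← smul_sub, shiftL_commutator_laurentPow, map_smul]
      split_ifs <;> simp
    · convert IsRapid.zero using 2 with s
      simp only
      rw [mul_smul_comm, smul_mul_assoc, ← smul_sub, ampR_commute_laurentPow, sub_self, smul_zero]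
  · rintro _ ⟨T, hT, rfl⟩ s
    rw [mul_smul_comm, smul_mul_assoc, ampR_commute_laurentPow]

end Laurent

section Sums

theorem exists_pow_mul_le {K V ι : Type} [AddCommGroup V] [Module ℂ V] {C : Set V}
    {q : ℕ → V → ℝ} (h : IsCompleteFamily C q) {w : ι → ℝ} (hw : ∀ p, 1 ≤ w p) {x : K → ι → V}
    (hx : ∀ t, x t ∈ WeightedFamily w C q)
    (hb : ∀ m, ∃ B : ℝ, ∀ t, weightedSum w q m (x t) ≤ B) (n m : ℕ) :
    ∃ B : ℝ, ∀ t p, w p ^ n * q m (x t p) ≤ B := by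
  obtain ⟨B, hB⟩ := hb (max n m)
  refine ⟨B, fun t p => ?_⟩
  refine (weighted_le h hw (le_max_left n m) (le_max_right n m) ((hx t).1 p) p).trans ?_
  exact (((hx t).2 _).le_tsum p fun i _ => WeightedFamily.nonneg h hw _ _ ((hx t).1 i) i).trans
    (hB t)

/-- The factor `(1 + |n|)^2` is inserted here to be cancelled by the summable `(1 + |n|)⁻²` when the
terms are summed. -/
theorem isRapidScalar_coeffs {K : Type} {c : K → ℤ → ℂ} (hc : ∀ t, RapidDecay (c t))
    (hb : ∀ m, ∃ B : ℝ, ∀ t, weightedSum intWeight (fun _ (c : ℂ) => ‖c‖) m (c t) ≤ B) :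
    IsRapidScalar (fun s : K × ℤ => intWeight s.2)
      (fun s => ((intWeight s.2 ^ 2 : ℝ) : ℂ) * c s.1 s.2) := by
  refine .of_pow (fun s => one_le_intWeight _) fun n => ?_
  obtain ⟨B, hB⟩ := exists_pow_mul_le isCompleteFamily_norm one_le_intWeight
    (fun t => rapidDecay_iff.1 (hc t)) hb (n + 2) 0
  refine ⟨B, fun s => ?_⟩
  rw [norm_mul, Complex.norm_real, Real.norm_of_nonneg (sq_nonneg _), ← mul_assoc, ← pow_add]
  exact hB s.1 s.2

theorem summable_ofReal_inv {ι : Type} {w : ι → ℝ} {n : ℕ} (h : Summable fun i => (w i ^ n)⁻¹) :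
    Summable fun i => (((w i ^ n : ℝ) : ℂ))⁻¹ := by
  refine (Complex.ofRealCLM.summable h).congr fun i => ?_
  simp only [Complex.ofRealCLM_apply, Complex.ofReal_inv]

theorem inv_smul_weight {V : Type} [AddCommGroup V] [Module ℂ V] {w : ℝ} (hw : 1 ≤ w) (n : ℕ)
    (v : V) : (((w ^ n : ℝ) : ℂ))⁻¹ • ((w ^ n : ℝ) : ℂ) • v = v :=
  inv_smul_smul₀ (Complex.ofReal_ne_zero.2 (pow_pos (zero_lt_one.trans_le hw) n).ne') v

theorem abs_le_intWeight (n : ℤ) : |(n : ℝ)| ≤ intWeight n := le_add_of_nonneg_left zero_le_one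

variable {K : Type} [TopologicalSpace K] [DiscreteTopology K]

theorem frameMem_zero {a : K → L ℤ} (ha : IsBoundedFamily 0 a) : (frame 0).Mem a := by
  choose c hc hm using fun t => mem_smoothData_zero.1 (ha.1 t)
  have hb : ∀ m, ∃ B : ℝ, ∀ t, weightedSum intWeight (fun _ (c : ℂ) => ‖c‖) m (c t) ≤ B := by
    intro m
    obtain ⟨B, hB⟩ := ha.2 m
    exact ⟨B, fun t => (smoothData_zero_seminorm (hc t) (hm t) m).symm.trans_le (hB t)⟩
  have h1 := Frame.Mem.laurentPow_circle (fun s : K × ℤ => abs_le_intWeight s.2)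
    (isRapidScalar_coeffs hc hb)
  have h2 := h1.tsum (summable_ofReal_inv summable_intWeight)
  refine Eq.mp (congrArg Frame.circle.Mem (funext fun t => ?_)) h2
  rw [← (isFourierExpansion_iff.2 ⟨hc t, hm t⟩).2.tsum_eq]
  refine tsum_congr fun n => ?_
  rw [mul_smul, inv_smul_weight (one_le_intWeight n)]

/-- Each term of an expansion is a summable scalar (an inverse power of the weight) times a member
of a family that satisfies the frame uniformly in the index of the term; `Frame.Mem.tsum` then adds
them up. For the matrix part the frame condition comes from the induction hypothesis, applied to all
tame multiples of the coefficients. -/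
theorem frameMem_step {ℓ : ℕ} {a : K → L (ℕ × Idx ℓ)}
    (ih : ∀ u : K × ℕ × ℕ → L (Idx ℓ), IsBoundedFamily ℓ u → (frame ℓ).Mem u)
    (ha : IsBoundedFamily (ℓ + 1) a) : (frame (ℓ + 1)).Mem a := by
  have hD := isGood_smoothData ℓ
  choose v hv hm using fun t => (mem_smoothData_succ hD).1 (ha.1 t)
  have hsum : ∀ m t, (smoothData (ℓ + 1)).seminorm m (a t) =
      weightedSum natWeight (smoothData ℓ).seminorm m (v t).1 +
        weightedSum intWeight (fun _ c => ‖c‖) m (v t).2 :=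
    fun m t => smoothData_succ_seminorm hD (hv t) (hm t) m
  have hb1 : ∀ m, ∃ B : ℝ, ∀ t, weightedSum natWeight (smoothData ℓ).seminorm m (v t).1 ≤ B := by
    intro m
    obtain ⟨B, hB⟩ := ha.2 m
    refine ⟨B, fun t => le_trans ?_ ((hsum m t).symm.trans_le (hB t))⟩
    exact le_add_of_nonneg_right (isCompleteFamily_rapidDecay.nonneg m (hv t).2)
  have hb2 : ∀ m, ∃ B : ℝ, ∀ t, weightedSum intWeight (fun _ (c : ℂ) => ‖c‖) m (v t).2 ≤ B := by
    intro m
    obtain ⟨B, hB⟩ := ha.2 m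
    refine ⟨B, fun t => le_trans ?_ ((hsum m t).symm.trans_le (hB t))⟩
    exact le_add_of_nonneg_left
      ((isCompleteFamily_weighted hD.complete one_le_natWeight).nonneg m (hv t).1)
  have hlaur := (Frame.Mem.laurentPow_step (fun s : K × ℤ => one_le_intWeight s.2)
    (fun s => abs_le_intWeight s.2) (isRapidScalar_coeffs (fun t => (hv t).2) hb2)
    (frame ℓ)).tsum (summable_ofReal_inv summable_intWeight)
  have hmat : (frame ℓ).step.Mem fun s : K × ℕ × ℕ =>
      matUnit s.2.1 s.2.2 (((natWeight s.2 ^ 4 : ℝ) : ℂ) • (v s.1).1 s.2) := by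
    refine Frame.Mem.matUnit (w := fun s => natWeight s.2) (fun s => one_le_natWeight s.2)
      (fun s => ?_) (fun s => ?_) fun g hg => ih _ ⟨fun s => ?_, fun m => ?_⟩
    · have h2 : (0 : ℝ) ≤ s.2.2 := Nat.cast_nonneg _
      simp only [natWeight]
      linarith
    · have h2 : (0 : ℝ) ≤ s.2.1 := Nat.cast_nonneg _
      simp only [natWeight]
      linarith
    · exact hD.complete.smul_mem _ (hD.complete.smul_mem _ ((hv s.1).1.1 s.2))
    · obtain ⟨C, n, hC⟩ := hg
      obtain ⟨B, hB⟩ := exists_pow_mul_le hD.complete one_le_natWeight (fun t => (hv t).1) hb1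
        (n + 4) m
      refine ⟨|C| * B, fun s => ?_⟩
      have hx := (hv s.1).1.1 s.2
      have h0 : 0 ≤ natWeight s.2 := zero_le_one.trans (one_le_natWeight _)
      rw [hD.complete.smul_eq m _ (hD.complete.smul_mem _ hx), hD.complete.smul_eq m _ hx,
        Complex.norm_real, Real.norm_of_nonneg (pow_nonneg h0 4)]
      have hq := hD.complete.nonneg m hx
      calc ‖g s‖ * (natWeight s.2 ^ 4 * (smoothData ℓ).seminorm m ((v s.1).1 s.2))
          ≤ (|C| * natWeight s.2 ^ n) *
            (natWeight s.2 ^ 4 * (smoothData ℓ).seminorm m ((v s.1).1 s.2)) := by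
            refine mul_le_mul_of_nonneg_right ((hC s).trans ?_)
              (mul_nonneg (pow_nonneg h0 4) hq)
            exact mul_le_mul_of_nonneg_right (le_abs_self C) (pow_nonneg h0 n)
        _ = |C| * (natWeight s.2 ^ (n + 4) * (smoothData ℓ).seminorm m ((v s.1).1 s.2)) := by
            rw [pow_add]; ring
        _ ≤ _ := mul_le_mul_of_nonneg_left (hB s.1 s.2) (abs_nonneg C)
  have hmat' := hmat.tsum (summable_ofReal_inv summable_natWeight)
  have := hmat'.add hlaur
  refine Eq.mp (congrArg (frame ℓ).step.Mem (funext fun t => ?_)) this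
  rw [expansion_hasSum hD (hv t) (hm t)]
  congr 1
  · refine tsum_congr fun p => ?_
    rw [map_smul, inv_smul_weight (one_le_natWeight p)]
  · refine tsum_congr fun n => ?_
    rw [mul_smul, inv_smul_weight (one_le_intWeight n)]

end Sums

/-- Bounded families in `𝒜_ℓ^∞` satisfy the conditions of the frame. -/
theorem IsBoundedFamily.frameMem : ∀ (ℓ : ℕ) {K : Type} [TopologicalSpace K] [DiscreteTopology K]
    {a : K → L (Idx ℓ)}, IsBoundedFamily ℓ a → (frame ℓ).Mem a
  | 0, _, _, _, _, ha => frameMem_zero ha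
  | ℓ + 1, _, _, _, _, ha => frameMem_step (fun _ hu => hu.frameMem ℓ) ha

end SmoothToFrame

end QuantumSphere


namespace QuantumSphere

open Filter Topology

/-! ### Products and their joint continuity -/

section Algebra

variable {ℓ : ℕ}

/-- The product is formed on the side of the frame, where the Leibniz rule applies, and the result
is carried back. -/
theorem IsBoundedFamily.mul {K : Type} [TopologicalSpace K] [DiscreteTopology K]
    {a b : K → L (Idx ℓ)} (ha : IsBoundedFamily ℓ a) (hb : IsBoundedFamily ℓ b) :
    IsBoundedFamily ℓ fun t => a t * b t :=
  ((ha.frameMem ℓ).mul (frame_good ℓ) (hb.frameMem ℓ)).isBoundedFamily ℓ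

theorem isBoundedFamily_const {a : L (Idx ℓ)} (ha : a ∈ (smoothData ℓ).carrier) :
    IsBoundedFamily ℓ fun _ : Unit => a :=
  ⟨fun _ => ha, fun _ => ⟨_, fun _ => le_rfl⟩⟩

theorem mul_mem_smooth {a b : L (Idx ℓ)} (ha : a ∈ (smoothData ℓ).carrier)
    (hb : b ∈ (smoothData ℓ).carrier) : a * b ∈ (smoothData ℓ).carrier :=
  ((isBoundedFamily_const ha).mul (isBoundedFamily_const hb)).1 ()

theorem one_mem_smooth : (1 : L (Idx ℓ)) ∈ (smoothData ℓ).carrier := by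
  have h : (frame ℓ).Mem fun _ : Unit => (1 : ℂ) • (1 : L (Idx ℓ)) :=
    Frame.Mem.scalar continuous_const ⟨_, fun _ => le_rfl⟩
  simpa using (h.isBoundedFamily ℓ).1 ()

/-- The smooth algebra as a ⋆-subalgebra of the bounded operators. -/
def smoothAlgebra (ℓ : ℕ) : StarSubalgebra ℂ (L (Idx ℓ)) where
  carrier := smoothSet ℓ
  mul_mem' := mul_mem_smooth
  one_mem' := one_mem_smooth
  add_mem' := (isGood_smoothData ℓ).complete.add_mem
  zero_mem' := (isGood_smoothData ℓ).complete.zero_mem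
  algebraMap_mem' c := by
    rw [Algebra.algebraMap_eq_smul_one]
    exact (isGood_smoothData ℓ).complete.smul_mem c one_mem_smooth
  star_mem' := (isGood_smoothData ℓ).star_mem

theorem norm_le_seminorm {a : L (Idx ℓ)} (ha : a ∈ (smoothData ℓ).carrier) (m : ℕ) :
    ‖a‖ ≤ (smoothData ℓ).seminorm m a :=
  ((isGood_smoothData ℓ).norm_le ha).trans
    ((isGood_smoothData ℓ).complete.mono_le (Nat.zero_le m) ha)

/-- After division of `a n` by its `n`-th seminorm, the `m`-th seminorm is at most `1` for `n ≥ m`,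
and only finitely many terms are left. -/
theorem isBoundedFamily_normalize {a : ℕ → L (Idx ℓ)} (ha : ∀ n, a n ∈ (smoothData ℓ).carrier)
    (hpos : ∀ n, 0 < (smoothData ℓ).seminorm n (a n)) :
    IsBoundedFamily ℓ fun n => (((smoothData ℓ).seminorm n (a n) : ℂ))⁻¹ • a n := by
  have hD := (isGood_smoothData ℓ).complete
  set b : ℕ → L (Idx ℓ) := fun n => (((smoothData ℓ).seminorm n (a n) : ℂ))⁻¹ • a n with hb
  have hbm : ∀ n, b n ∈ (smoothData ℓ).carrier := fun n => hD.smul_mem _ (ha n)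
  refine ⟨hbm, fun m => ⟨1 + ∑ i ∈ Finset.range m, (smoothData ℓ).seminorm m (b i), fun n => ?_⟩⟩
  have h0 : ∀ i, 0 ≤ (smoothData ℓ).seminorm m (b i) := fun i => hD.nonneg m (hbm i)
  by_cases hn : n < m
  · have := Finset.single_le_sum (f := fun i => (smoothData ℓ).seminorm m (b i))
      (fun i _ => h0 i) (Finset.mem_range.2 hn)
    linarith
  · have h1 : (smoothData ℓ).seminorm m (b n) ≤ 1 := by
      refine (hD.mono_le (not_lt.1 hn) (hbm n)).trans ?_
      rw [hb, hD.smul_eq n _ (ha n), norm_inv, Complex.norm_real,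
        Real.norm_of_nonneg (hpos n).le, inv_mul_cancel₀ (hpos n).ne']
    have := Finset.sum_nonneg fun i (_ : i ∈ Finset.range m) => h0 i
    linarith

/-- The product of `𝒜_ℓ^∞` is jointly continuous. -/
theorem exists_seminorm_mul_le (ℓ m : ℕ) : ∃ (n : ℕ), ∀ a ∈ (smoothData ℓ).carrier,
    ∀ b ∈ (smoothData ℓ).carrier, (smoothData ℓ).seminorm m (a * b) ≤
      n * ((smoothData ℓ).seminorm n a * (smoothData ℓ).seminorm n b) := by
  have hD := (isGood_smoothData ℓ).complete
  -- Counterexamples for every `n`, once normalized, form two bounded sequences whose product has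
  -- `m`-th seminorm greater than `n` at the index `n`. This contradicts the boundedness of products
  -- of bounded families.
  by_contra! hcon
  choose a ha b hb hab using hcon
  have hpos : ∀ n, 0 < (smoothData ℓ).seminorm n (a n) ∧ 0 < (smoothData ℓ).seminorm n (b n) := by
    intro n
    have h0 : ∀ c ∈ (smoothData ℓ).carrier, (smoothData ℓ).seminorm n c ≤ 0 → c = 0 :=
      fun c hc h => norm_le_zero_iff.1 ((norm_le_seminorm hc n).trans h)
    constructor <;> by_contra! h
    · have h1 := hab n
      rw [h0 _ (ha n) h, zero_mul, hD.map_zero, hD.map_zero] at h1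
      simp at h1
    · have h1 := hab n
      rw [h0 _ (hb n) h, mul_zero, hD.map_zero, hD.map_zero] at h1
      simp at h1
  obtain ⟨B, hB⟩ := ((isBoundedFamily_normalize ha fun n => (hpos n).1).mul
    (isBoundedFamily_normalize hb fun n => (hpos n).2)).2 m
  obtain ⟨n, hn⟩ := exists_nat_gt B
  have h1 := hB n
  beta_reduce at h1
  rw [smul_mul_smul_comm, hD.smul_eq m _ (mul_mem_smooth (ha n) (hb n)), norm_mul, norm_inv,
    norm_inv, Complex.norm_real, Complex.norm_real, Real.norm_of_nonneg (hpos n).1.le,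
    Real.norm_of_nonneg (hpos n).2.le, ← mul_inv, inv_mul_le_iff₀
    (mul_pos (hpos n).1 (hpos n).2)] at h1
  have h2 := (hab n).trans_le h1
  rw [mul_comm (n : ℝ), mul_lt_mul_iff_right₀ (mul_pos (hpos n).1 (hpos n).2)] at h2
  linarith

end Algebra

/-! ### Expansions of the generators -/

section Generators

theorem entry_tensor {Y : Type} (T : L ℕ) (a : L Y) (j k : ℕ) :
    entry j k (tensor T a) = (T (e k) j) • a := ext_e fun y => by
  ext x
  rw [entry_e, tensor_e]
  rfl

theorem qN_coef (q : Param) (j k : ℕ) : qN q (e k) j = if j = k then ((q : ℝ) : ℂ) ^ k else 0 := by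
  classical
  change (((q : ℝ) ^ j : ℝ) : ℂ) * (e k : H ℕ) j = _
  rw [e_apply]
  split_ifs with h
  · subst h; simp
  · simp

theorem star_shiftN_e (k : ℕ) : star shiftN (e k) = e (k + 1) := by
  classical
  ext j
  cases j with
  | zero => rw [star_shiftN_zero, e_apply, if_neg (Nat.succ_ne_zero k).symm]
  | succ j => rw [star_shiftN_succ, e_apply, e_apply]; simp

theorem X_coef (q : Param) (j k : ℕ) : (sqrtN q * star shiftN) (e k) j =
    if j = k + 1 then ((√(1 - (q : ℝ) ^ (2 * (k + 1))) : ℝ) : ℂ) else 0 := by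
  classical
  rw [mul_apply_eq_comp, star_shiftN_e]
  change ((√(1 - (q : ℝ) ^ (2 * j)) : ℝ) : ℂ) * (e (k + 1) : H ℕ) j = _
  rw [e_apply]
  split_ifs with h
  · subst h; simp
  · simp

/-- The number `2 + 2k` bounds the weight `1 + j + k` on the rows `j ≤ k + 1`, which contain all the
nonzero coefficients of the generators. -/
theorem geometric_weight_bound (q : Param) (n : ℕ) :
    ∃ B : ℝ, ∀ k : ℕ, (2 + 2 * (k : ℝ)) ^ n * (q : ℝ) ^ k ≤ B := by
  have h := tendsto_pow_const_mul_const_pow_of_abs_lt_one n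
    (r := (q : ℝ)) (by rw [abs_of_nonneg q.2.1]; exact q.2.2)
  obtain ⟨B, hB⟩ := h.bddAbove_range
  refine ⟨2 ^ n * (2 ^ (n - 1) * (1 + B)), fun k => ?_⟩
  have h1 := add_pow_le zero_le_one (Nat.cast_nonneg (α := ℝ) k) n
  rw [one_pow] at h1
  have h2 : (k : ℝ) ^ n * (q : ℝ) ^ k ≤ B := hB ⟨k, rfl⟩
  have h3 : (q : ℝ) ^ k ≤ 1 := pow_le_one₀ q.2.1 q.2.2.le
  have h4 : (0 : ℝ) ≤ (q : ℝ) ^ k := pow_nonneg q.2.1 k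
  calc (2 + 2 * (k : ℝ)) ^ n * (q : ℝ) ^ k = 2 ^ n * ((1 + k) ^ n * (q : ℝ) ^ k) := by
        rw [← mul_one_add, mul_pow, mul_assoc]
    _ ≤ 2 ^ n * (2 ^ (n - 1) * (1 + (k : ℝ) ^ n) * (q : ℝ) ^ k) := by gcongr
    _ = 2 ^ n * (2 ^ (n - 1) * ((q : ℝ) ^ k + (k : ℝ) ^ n * (q : ℝ) ^ k)) := by ring
    _ ≤ _ := by gcongr

variable {ℓ : ℕ}

theorem weightedFamily_geometric (q : Param) {b : L (Idx ℓ)} (hb : b ∈ (smoothData ℓ).carrier)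
    {f : ℕ × ℕ → ℂ} (hf : ∀ p, ‖f p‖ ≤ (q : ℝ) ^ p.2)
    (hf' : ∀ p, f p ≠ 0 → p.1 ≤ p.2 + 1) :
    (fun p => f p • b) ∈ WeightedFamily natWeight (smoothData ℓ).carrier (smoothData ℓ).seminorm := by
  have hD := (isGood_smoothData ℓ).complete
  refine (weightedFamily_of_bounded hD one_le_natWeight summable_natWeight (K := Unit)
    (x := fun _ p => f p • b) (fun _ p => hD.smul_mem _ hb) fun n m => ?_).1 ()
  obtain ⟨B, hB⟩ := geometric_weight_bound q n
  have hq := hD.nonneg m hb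
  have hB0 : 0 ≤ B := le_trans (by simp) (hB 0)
  refine ⟨B * (smoothData ℓ).seminorm m b, fun _ p => ?_⟩
  rw [hD.smul_eq m _ hb, ← mul_assoc]
  refine mul_le_mul_of_nonneg_right ?_ hq
  by_cases h0 : f p = 0
  · rw [h0, norm_zero, mul_zero]; exact hB0
  · refine le_trans ?_ (hB p.2)
    refine mul_le_mul (pow_le_pow_left₀ (zero_le_one.trans (one_le_natWeight p)) ?_ n) (hf p)
      (norm_nonneg _) (by positivity)
    have h1 : (p.1 : ℝ) ≤ p.2 + 1 := by exact_mod_cast hf' p h0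
    unfold natWeight
    linarith

/-- The coefficients of `q^N ⊗ b`. -/
theorem isExpansionMatrix_qN (q : Param) (b : L (Idx ℓ)) :
    IsExpansionMatrix (tensor (qN q) b)
      (fun p => (if p.1 = p.2 then ((q : ℝ) : ℂ) ^ p.2 else 0) • b, 0) := fun j k => by
  rw [entry_tensor, qN_coef]
  simp

/-- The coefficients of `Y_{1,q}`. -/
theorem isExpansionMatrix_X (q : Param) : IsExpansionMatrix
    (tensor (sqrtN q * star shiftN) (1 : L (Idx ℓ)))
      (fun p => (if p.1 = p.2 + 1 then ((√(1 - (q : ℝ) ^ (2 * (p.2 + 1))) : ℝ) : ℂ) - 1 else 0) •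
        (1 : L (Idx ℓ)), Pi.single (-1) 1) := fun j k => by
  rw [entry_tensor, X_coef]
  by_cases h : j = k + 1
  · subst h
    simp [sub_smul]
  · have : (k : ℤ) - j ≠ -1 := by omega
    simp [h, this]

theorem rapidDecay_single (n : ℤ) (c : ℂ) : RapidDecay (Pi.single n c) := fun m =>
  summable_of_ne_finset_zero (s := {n}) fun k hk => by
    rw [Pi.single_eq_of_ne (by simpa using hk), norm_zero, mul_zero]

theorem norm_sqrt_sub_one_le {s : ℝ} (h0 : 0 ≤ s) (h1 : s ≤ 1) :
    ‖((√(1 - s) : ℝ) : ℂ) - 1‖ ≤ s := by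
  rw [← Complex.ofReal_one, ← Complex.ofReal_sub, Complex.norm_real, Real.norm_eq_abs, abs_le]
  have h2 : 1 - s ≤ √(1 - s) := Real.le_sqrt_of_sq_le (by nlinarith)
  have h3 : √(1 - s) ≤ 1 := Real.sqrt_le_one.2 (by linarith)
  constructor <;> linarith

theorem coeffs_X_mem (q : Param) :
    ((fun p => (if p.1 = p.2 + 1 then ((√(1 - (q : ℝ) ^ (2 * (p.2 + 1))) : ℝ) : ℂ) - 1 else 0) •
        (1 : L (Idx ℓ)), Pi.single (-1) 1) : (ℕ × ℕ → L (Idx ℓ)) × (ℤ → ℂ)) ∈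
      expansionCoeffs (smoothData ℓ) := by
  refine ⟨weightedFamily_geometric q one_mem_smooth (fun p => ?_) (fun p h => ?_),
    rapidDecay_single _ _⟩
  · split_ifs
    · refine (norm_sqrt_sub_one_le (pow_nonneg q.2.1 _) (pow_le_one₀ q.2.1 q.2.2.le)).trans ?_
      exact pow_le_pow_of_le_one q.2.1 q.2.2.le (by omega)
    · rw [norm_zero]; exact pow_nonneg q.2.1 _
  · by_contra hp
    exact h (if_neg fun h' => hp h'.le)

theorem coeffs_qN_mem (q : Param) {b : L (Idx ℓ)} (hb : b ∈ (smoothData ℓ).carrier) :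
    ((fun p => (if p.1 = p.2 then ((q : ℝ) : ℂ) ^ p.2 else 0) • b, 0) :
      (ℕ × ℕ → L (Idx ℓ)) × (ℤ → ℂ)) ∈ expansionCoeffs (smoothData ℓ) := by
  refine ⟨weightedFamily_geometric q hb (fun p => ?_) (fun p h => ?_),
    isCompleteFamily_rapidDecay.zero_mem⟩
  · split_ifs
    · rw [norm_pow, Complex.norm_real, Real.norm_of_nonneg q.2.1]
    · rw [norm_zero]; exact pow_nonneg q.2.1 _
  · by_contra hp
    exact h (if_neg fun h' => hp (by omega))

theorem Y_mem_smooth (q : Param) : ∀ (ℓ : ℕ) (k : Fin (ℓ + 1)), Y ℓ q k ∈ (smoothData ℓ).carrier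
  | 0, k => by
    refine mem_smoothData_zero.2 ⟨_, rapidDecay_single 1 1, fun x y => ?_⟩
    rw [Y_zero]
    have := laurentPow_star_shiftZ_coef 1 x y
    change (star shiftZ ^ 1) (e y) x = _ at this
    rw [pow_one] at this
    rw [this, Pi.single_apply]
  | ℓ + 1, k => by
    refine (mem_smoothData_succ (isGood_smoothData ℓ)).2 ?_
    refine Fin.cases ?_ (fun k => ?_) k
    · rw [Y_succ_zero]
      exact ⟨_, coeffs_X_mem q, isExpansionMatrix_X q⟩
    · rw [Y_succ_succ]
      exact ⟨_, coeffs_qN_mem q (Y_mem_smooth q ℓ k), isExpansionMatrix_qN q _⟩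

end Generators

/-! ### The smooth algebra lies in the image algebra -/

section Image

variable {ℓ : ℕ} {q : Param}

theorem Y_mem_imageAlgebra (k : Fin (ℓ + 1)) : Y ℓ q k ∈ imageAlgebra ℓ q :=
  ⟨sphereGen ℓ q k, piRep_gen ℓ q k⟩

/-- The universal algebra is the closure of the ⋆-polynomials in its generators, and evaluation in a
representation is continuous. -/
theorem imageAlgebra_subset_closure : (imageAlgebra ℓ q : Set (L (Idx ℓ))) ⊆
    closure (StarAlgebra.adjoin ℂ (Set.range (Y ℓ q)) : Set (L (Idx ℓ))) := by
  rintro _ ⟨z, rfl⟩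
  have hcont : Continuous fun a : SphereProd ℓ (q : ℝ) => a (repY ℓ q) :=
    (lp.evalCLM ℂ (fun R : SphereRep ℓ (q : ℝ) => R.carrier) ∞ (repY ℓ q)).continuous
  have hz := z.2
  change (z : SphereProd ℓ (q : ℝ)) (repY ℓ q) ∈ closure _
  refine map_mem_closure hcont hz fun a ha => ?_
  refine StarAlgebra.adjoin_induction (p := fun a _ => a (repY ℓ q) ∈
    (StarAlgebra.adjoin ℂ (Set.range (Y ℓ q)) : Set (L (Idx ℓ)))) ?_ ?_ ?_ ?_ ?_ ha
  · rintro _ ⟨k, rfl⟩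
    exact StarAlgebra.subset_adjoin ℂ _ (Set.mem_range_self k)
  · exact fun c => algebraMap_mem (StarAlgebra.adjoin ℂ (Set.range (Y ℓ q))) c
  · exact fun a b _ _ ha hb => add_mem ha hb
  · exact fun a b _ _ ha hb => mul_mem ha hb
  · exact fun a _ ha => star_mem ha

theorem hasSum_mem_imageAlgebra {ι : Type} {f : ι → L (Idx ℓ)} {a : L (Idx ℓ)} (h : HasSum f a)
    (hf : ∀ i, f i ∈ imageAlgebra ℓ q) : a ∈ imageAlgebra ℓ q :=
  (instIsClosedImageAlgebra ℓ q).mem_of_tendsto h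
    (Eventually.of_forall fun _ => sum_mem fun i _ => hf i)

theorem laurentPow_mem_imageAlgebra {T : L (Idx ℓ)} (hT : T ∈ imageAlgebra ℓ q) (n : ℤ) :
    laurentPow T n ∈ imageAlgebra ℓ q := by
  cases n with
  | ofNat n => exact pow_mem hT n
  | negSucc n => exact pow_mem (star_mem hT) (n + 1)

theorem matUnit_mul_matUnit {Y : Type} (i j k : ℕ) (x y : L Y) :
    matUnit i j x * matUnit j k y = matUnit i k (x * y) := by
  ext1 v
  change inc i (x (slice j (inc j (y (slice k v))))) = _
  rw [slice_inc, if_pos rfl]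
  rfl

theorem norm_tensor_one_le {Y : Type} (T : L ℕ) : ‖tensor T (1 : L Y)‖ ≤ ‖T‖ := by
  have h1 : ‖(swapOp ℕ Y)‖ ≤ 1 := by
    unfold swapOp pull; exact LinearMap.mkContinuous_norm_le _ zero_le_one _
  have h2 : ‖(swapOp Y ℕ)‖ ≤ 1 := by
    unfold swapOp pull; exact LinearMap.mkContinuous_norm_le _ zero_le_one _
  have h3 : ‖ampR Y T‖ ≤ ‖T‖ := by
    unfold ampR; exact LinearMap.mkContinuous_norm_le _ (norm_nonneg _) _
  change ‖swapOp ℕ Y ∘L ampR Y T ∘L swapOp Y ℕ‖ ≤ ‖T‖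
  refine (ContinuousLinearMap.opNorm_comp_le _ _).trans ?_
  refine (mul_le_of_le_one_left (norm_nonneg _) h1).trans ?_
  refine (ContinuousLinearMap.opNorm_comp_le _ _).trans ?_
  exact (mul_le_of_le_one_right (norm_nonneg _) h2).trans h3

/-- For `n ≥ 1`, `q^{2nm} = q^m (q^{n-1} q^n)^m`, so the difference is `q^m` times a diagonal
contraction. This form also covers `q = 0`. -/
theorem norm_qN_pow_sub_p0_le (q : Param) (m : ℕ) : ‖(qN q * qN q) ^ m - p0‖ ≤ (q : ℝ) ^ m := by
  have hpow : ∀ (m : ℕ) (v : H ℕ) (n : ℕ),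
      ((qN q * qN q) ^ m) v n = ((((q : ℝ) ^ n * (q : ℝ) ^ n) ^ m : ℝ) : ℂ) * v n := by
    intro m
    induction m with
    | zero => intro v n; simp
    | succ m ih =>
      intro v n
      rw [pow_succ, mul_apply_eq_comp, ih]
      change _ * ((((q : ℝ) ^ n : ℝ) : ℂ) * ((((q : ℝ) ^ n : ℝ) : ℂ) * v n)) = _
      push_cast
      ring
  let d : ℕ → ℂ := fun n => if n = 0 then 0 else
    ((((q : ℝ) ^ (n - 1) * (q : ℝ) ^ n) ^ m : ℝ) : ℂ)
  have hd : ∀ n, ‖d n‖ ≤ 1 := fun n => by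
    simp only [d]
    split_ifs
    · simp
    · rw [Complex.norm_real, Real.norm_of_nonneg
        (pow_nonneg (mul_nonneg (pow_nonneg q.2.1 _) (pow_nonneg q.2.1 _)) _)]
      exact pow_le_one₀ (mul_nonneg (pow_nonneg q.2.1 _) (pow_nonneg q.2.1 _))
        (mul_le_one₀ (pow_le_one₀ q.2.1 q.2.2.le) (pow_nonneg q.2.1 _)
          (pow_le_one₀ q.2.1 q.2.2.le))
  have h : (qN q * qN q) ^ m - p0 = (((q : ℝ) ^ m : ℝ) : ℂ) • diag d hd := by
    ext v n
    change ((qN q * qN q) ^ m) v n - (if n = 0 then (1 : ℂ) else 0) * v n =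
      (((q : ℝ) ^ m : ℝ) : ℂ) * (d n * v n)
    rw [hpow]
    cases n with
    | zero => simp [d]
    | succ n =>
      simp only [d, Nat.succ_ne_zero, if_false, Nat.add_sub_cancel]
      push_cast
      ring
  rw [h, norm_smul, Complex.norm_real, Real.norm_of_nonneg (pow_nonneg q.2.1 m)]
  exact mul_le_of_le_one_right (pow_nonneg q.2.1 m) (norm_diag_le d hd)

/-- The powers of `q^{2N} ⊗ 1 = 1 - Y_1 Y_1^*` converge in norm to `p_0 ⊗ 1`. -/
theorem matUnit_zero_one_mem : matUnit 0 0 (1 : L (Idx ℓ)) ∈ imageAlgebra (ℓ + 1) q := by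
  have h1 : ∀ m : ℕ, tensor ((qN q * qN q) ^ m) (1 : L (Idx ℓ)) ∈ imageAlgebra (ℓ + 1) q := by
    intro m
    have h2 : tensor (qN q * qN q) (1 : L (Idx ℓ)) ∈ imageAlgebra (ℓ + 1) q := by
      have h3 : tensor (qN q * qN q) (1 : L (Idx ℓ)) =
          1 - Y (ℓ + 1) q 0 * star (Y (ℓ + 1) q 0) := by
        rw [Y_succ_zero, star_tensor, tensor_mul, star_X, X_mul_star, star_one, mul_one,
          tensor_sub_left, tensor_one, sub_sub_cancel]
      rw [h3]
      exact sub_mem (one_mem _) (mul_mem (Y_mem_imageAlgebra 0) (star_mem (Y_mem_imageAlgebra 0)))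
    induction m with
    | zero => rw [pow_zero, tensor_one]; exact one_mem _
    | succ m ih =>
      have := mul_mem ih h2
      rwa [tensor_mul, mul_one, ← pow_succ] at this
  rw [matUnit_zero_zero]
  refine (instIsClosedImageAlgebra (ℓ + 1) q).mem_of_tendsto (b := atTop) ?_
    (Eventually.of_forall h1)
  rw [tendsto_iff_norm_sub_tendsto_zero]
  refine squeeze_zero (fun _ => norm_nonneg _) (fun m => ?_)
    (tendsto_pow_atTop_nhds_zero_of_lt_one q.2.1 q.2.2)
  rw [← tensor_sub_left]
  exact (norm_tensor_one_le _).trans (norm_qN_pow_sub_p0_le q m)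

/-- As `p_0 q^N = p_0`, one has `(p_0 ⊗ 1) Y_{k+1} = p_0 ⊗ Y_k`, where the `Y_k` on the right
belongs to the lower level. The map `x ↦ p_0 ⊗ x` is linear, multiplicative, ⋆-preserving and
continuous, so the generators suffice. -/
theorem matUnit_zero_mem {x : L (Idx ℓ)} (hx : x ∈ imageAlgebra ℓ q) :
    matUnit 0 0 x ∈ imageAlgebra (ℓ + 1) q := by
  have hcl := (instIsClosedImageAlgebra (ℓ + 1) q)
  have : (matUnit 0 0 x : L (Idx (ℓ + 1))) ∈ closure (imageAlgebra (ℓ + 1) q : Set _) := by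
    refine map_mem_closure (matUnit 0 0).continuous (imageAlgebra_subset_closure hx) fun a ha => ?_
    refine StarAlgebra.adjoin_induction (p := fun a _ =>
      matUnit 0 0 a ∈ (imageAlgebra (ℓ + 1) q : Set (L (Idx (ℓ + 1))))) ?_ ?_ ?_ ?_ ?_ ha
    · rintro _ ⟨k, rfl⟩
      have hp : p0 * qN q = p0 := by
        ext v n
        change (if n = 0 then (1 : ℂ) else 0) * ((((q : ℝ) ^ n : ℝ) : ℂ) * v n) =
          (if n = 0 then (1 : ℂ) else 0) * v n
        split_ifs with h <;> simp [h]
      have h := mul_mem (matUnit_zero_one_mem (ℓ := ℓ) (q := q)) (Y_mem_imageAlgebra k.succ)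
      rw [Y_succ_succ, matUnit_zero_zero, tensor_mul, one_mul, hp, ← matUnit_zero_zero] at h
      exact h
    · intro c
      rw [Algebra.algebraMap_eq_smul_one, map_smul]
      exact SMulMemClass.smul_mem (s := imageAlgebra (ℓ + 1) q) c matUnit_zero_one_mem
    · intro a b _ _ ha hb
      rw [map_add]
      exact add_mem ha hb
    · intro a b _ _ ha hb
      rw [← matUnit_mul_matUnit 0 0 0]
      exact mul_mem ha hb
    · intro a _ ha
      rw [← star_matUnit]
      exact star_mem ha
  rwa [hcl.closure_eq] at this

theorem X_mul_matUnit (j k : ℕ) (x : L (Idx ℓ)) : Y (ℓ + 1) q 0 * matUnit j k x =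
    ((√(1 - (q : ℝ) ^ (2 * (j + 1))) : ℝ) : ℂ) • matUnit (j + 1) k x := by
  rw [Y_succ_zero]
  refine ext_e ?_
  rintro ⟨l, y⟩
  by_cases hl : l = k
  · subst hl
    have h1 : ∀ i, matUnit i l x (e (l, y)) = inc i (x (e y)) := fun i => by
      classical
      rw [matUnit_apply, slice_e, if_pos rfl]
    rw [mul_apply_eq_comp, h1]
    have h2 : tensor (sqrtN q * star shiftN) (1 : L (Idx ℓ)) ∘L inc j =
        ((√(1 - (q : ℝ) ^ (2 * (j + 1))) : ℝ) : ℂ) • inc (j + 1) := by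
      refine ext_e fun z => ?_
      ext ⟨i, w⟩
      have h3 := congrArg (fun T : L (Idx ℓ) => (T (e z)) w)
        (entry_tensor (sqrtN q * star shiftN) (1 : L (Idx ℓ)) i j)
      change tensor (sqrtN q * star shiftN) (1 : L (Idx ℓ)) (inc j (e z)) (i, w) =
        ((√(1 - (q : ℝ) ^ (2 * (j + 1))) : ℝ) : ℂ) * inc (j + 1) (e z) (i, w)
      rw [inc_apply]
      refine h3.trans ?_
      rw [X_coef]
      split_ifs
      · rfl
      · rw [zero_smul]
        simp
    have h4 := congrArg (fun T => T (x (e y))) h2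
    refine h4.trans ?_
    change _ = ((√(1 - (q : ℝ) ^ (2 * (j + 1))) : ℝ) : ℂ) • matUnit (j + 1) l x (e (l, y))
    rw [h1]
    rfl
  · have h1 : ∀ i, matUnit i k x (e (l, y)) = 0 := fun i => by
      classical
      rw [matUnit_apply, slice_e, if_neg (Ne.symm hl), map_zero, map_zero]
    rw [mul_apply_eq_comp, h1, map_zero]
    change _ = ((√(1 - (q : ℝ) ^ (2 * (j + 1))) : ℝ) : ℂ) • matUnit (j + 1) k x (e (l, y))
    rw [h1, smul_zero]

/-- Multiplication by `Y_1` raises the row index up to a nonzero scalar; adjoints then give the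
columns. -/
theorem matUnit_mem {x : L (Idx ℓ)} (hx : x ∈ imageAlgebra ℓ q) (j k : ℕ) :
    matUnit j k x ∈ imageAlgebra (ℓ + 1) q := by
  have h1 : ∀ (y : L (Idx ℓ)), y ∈ imageAlgebra ℓ q → ∀ j,
      matUnit j 0 y ∈ imageAlgebra (ℓ + 1) q := fun y hy j => by
    induction j with
    | zero => exact matUnit_zero_mem hy
    | succ j ih =>
      have h2 := mul_mem (Y_mem_imageAlgebra (q := q) (ℓ := ℓ + 1) 0) ih
      rw [X_mul_matUnit] at h2
      have hne : ((√(1 - (q : ℝ) ^ (2 * (j + 1))) : ℝ) : ℂ) ≠ 0 := by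
        refine Complex.ofReal_ne_zero.2 (Real.sqrt_ne_zero'.2 ?_)
        have := pow_lt_one₀ q.2.1 q.2.2 (n := 2 * (j + 1)) (by omega)
        linarith
      have h3 := SMulMemClass.smul_mem (s := imageAlgebra (ℓ + 1) q)
        (((√(1 - (q : ℝ) ^ (2 * (j + 1))) : ℝ) : ℂ))⁻¹ h2
      rwa [inv_smul_smul₀ hne] at h3
  have h2 := mul_mem (h1 x hx j) (star_mem (h1 1 (one_mem _) k))
  rwa [star_matUnit, matUnit_mul_matUnit, star_one, mul_one] at h2

/-- By the expansion of `Y_1`, the operator `α_1^*` differs from it by an absolutely convergent sum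
of scalar matrix units, and the image algebra is closed. -/
theorem shiftL_mem_imageAlgebra : shiftL (Idx ℓ) ∈ imageAlgebra (ℓ + 1) q := by
  have hD := isGood_smoothData ℓ
  have hv := coeffs_X_mem (ℓ := ℓ) q
  have hM := isExpansionMatrix_X (ℓ := ℓ) q
  have hs := (summable_matUnit hD hv.1).hasSum
  have h1 := hasSum_mem_imageAlgebra (q := q) (ℓ := ℓ + 1) hs fun p =>
    matUnit_mem (SMulMemClass.smul_mem (s := imageAlgebra ℓ q) _ (one_mem _)) p.1 p.2
  have h2 := sub_mem (Y_mem_imageAlgebra (q := q) (ℓ := ℓ + 1) 0) h1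
  have h3 : star (shiftL (Idx ℓ)) ∈ imageAlgebra (ℓ + 1) q := by
    convert h2 using 1
    refine ext_entry fun j k => ?_
    have h4 := entry_laurentPow (Y := Idx ℓ) (-1) j k
    change entry j k (star (shiftL (Idx ℓ)) ^ 1) = _ at h4
    rw [pow_one] at h4
    rw [map_sub, Y_succ_zero, entry_hasSum_matUnit hs, hM, add_sub_cancel_left, h4]
    change _ = (Pi.single (-1) 1 : ℤ → ℂ) ((k : ℤ) - j) • (1 : L (Idx ℓ))
    rw [Pi.single_apply]
    split_ifs <;> simp
  simpa using star_mem h3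

theorem smooth_subset_imageAlgebra (q : Param) :
    ∀ (ℓ : ℕ) {a : L (Idx ℓ)}, a ∈ (smoothData ℓ).carrier → a ∈ imageAlgebra ℓ q
  | 0, a, ⟨c, hc⟩ => hasSum_mem_imageAlgebra hc.2 fun n =>
      SMulMemClass.smul_mem (s := imageAlgebra 0 q) _
        (laurentPow_mem_imageAlgebra (Y_mem_imageAlgebra (ℓ := 0) 0) n)
  | ℓ + 1, a, ha => by
      have hD := isGood_smoothData ℓ
      obtain ⟨v, hv, hm⟩ := (mem_smoothData_succ hD).1 ha
      rw [expansion_hasSum hD hv hm]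
      refine add_mem ?_ ?_
      · exact hasSum_mem_imageAlgebra (ℓ := ℓ + 1) (summable_matUnit hD hv.1).hasSum fun p =>
          matUnit_mem (smooth_subset_imageAlgebra q ℓ (hv.1.1 p)) p.1 p.2
      · exact hasSum_mem_imageAlgebra (ℓ := ℓ + 1)
          (RapidDecay.summable_smul norm_shiftL_le hv.2).hasSum fun n =>
          SMulMemClass.smul_mem (s := imageAlgebra (ℓ + 1) q) _
            (laurentPow_mem_imageAlgebra shiftL_mem_imageAlgebra n)

end Image

end QuantumSphere


namespace QuantumSphere

open Filter Topology

/-! ### The Fréchet topology and density -/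

section Frechet

/-- A criterion for a sequence of seminorms on a ⋆-algebra to define a Fréchet ⋆-algebra. -/
theorem isFrechetStarAlgebra_of_bounds {E B : Type*} [Ring E] [StarRing E] [Algebra ℂ E]
    [SeminormedAddCommGroup B] {p : SeminormFamily ℂ E ℕ} (j : E →+ B)
    (hj : ∀ a, ‖j a‖ ≤ p 0 a) (hp : ∀ a, p 0 a = 0 → a = 0)
    (hmul : ∀ m, ∃ n : ℕ, ∀ a b, p m (a * b) ≤ n * (p n a * p n b))
    (hstar : ∀ m a, p m (star a) = p m a)
    (hcomplete : ∀ u : ℕ → E, (∀ m, ∀ ε > 0, ∃ N, ∀ n ≥ N, ∀ k ≥ N, p m (u n - u k) < ε) →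
      ∃ a, ∀ m, Tendsto (fun n => p m (u n - a)) atTop (𝓝 0)) :
    IsFrechetStarAlgebra p j := by
  let τ : TopologicalSpace E := p.moduleFilterBasis.topology
  have hw : WithSeminorms p := ⟨rfl⟩
  have : IsTopologicalAddGroup E := hw.topologicalAddGroup
  let : UniformSpace E := IsTopologicalAddGroup.rightUniformSpace E
  have : IsUniformAddGroup E := isUniformAddGroup_of_addCommGroup
  have : FirstCountableTopology E := hw.firstCountableTopology
  -- The criterion for convergence to `0` is needed in two universes: that of `E` and its powers,
  -- and `Type` for sequences.
  have h0 : ∀ {α : Type _} {f : Filter α} {u : α → E}, Tendsto u f (𝓝 0) ↔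
      ∀ m, Tendsto (fun x => p m (u x)) f (𝓝 0) := fun {α f u} => by
    rw [(p.withSeminorms_iff_nhds_eq_iInf).1 hw, tendsto_iInf]
    exact forall_congr' fun m => tendsto_comap_iff
  have h0' : ∀ {α : Type} {f : Filter α} {u : α → E}, Tendsto u f (𝓝 0) ↔
      ∀ m, Tendsto (fun x => p m (u x)) f (𝓝 0) := fun {α f u} => by
    rw [(p.withSeminorms_iff_nhds_eq_iInf).1 hw, tendsto_iInf]
    exact forall_congr' fun m => tendsto_comap_iff
  have hid : ∀ m, Tendsto (fun x : E => p m x) (𝓝 0) (𝓝 0) := h0.1 tendsto_id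
  have hcont : Continuous j := by
    refine continuous_of_continuousAt_zero j ?_
    rw [ContinuousAt, map_zero]
    exact squeeze_zero_norm hj (hid 0)
  refine ⟨inferInstance, inferInstance, hw, ?_, ?_, ?_, ?_, hcont⟩
  · have := hw.T1_of_separating fun x hx => ⟨0, fun h => hx (hp x h)⟩
    infer_instance
  · have := IsUniformAddGroup.uniformity_countably_generated (α := E)
    refine UniformSpace.complete_of_cauchySeq_tendsto fun u hu => ?_
    rw [cauchySeq_iff_tendsto, uniformity_eq_comap_nhds_zero, tendsto_comap_iff] at hu
    obtain ⟨a, ha⟩ := hcomplete u fun m ε hε => by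
      have h1 := (h0'.1 hu m).eventually (gt_mem_nhds hε)
      obtain ⟨⟨N, M⟩, hN⟩ := eventually_atTop.1 h1
      refine ⟨max N M, fun n hn k hk => ?_⟩
      -- The uniformity is pulled back along `(x, y) ↦ y - x`, which reverses the pair.
      exact hN (k, n) ⟨(le_max_left _ _).trans hk, (le_max_right _ _).trans hn⟩
    refine ⟨a, ?_⟩
    rw [← tendsto_sub_nhds_zero_iff]
    exact h0'.2 ha
  · have hmul0 : ∀ m, ∃ n : ℕ, ∀ a b, ‖p m (a * b)‖ ≤ n * (p n a * p n b) := fun m => by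
      obtain ⟨n, hn⟩ := hmul m
      exact ⟨n, fun a b => by rw [Real.norm_of_nonneg (apply_nonneg _ _)]; exact hn a b⟩
    have : IsTopologicalRing E := by
      refine .of_addGroup_of_nhds_zero ?_ ?_ ?_
      · refine h0.2 fun m => ?_
        obtain ⟨n, hn⟩ := hmul0 m
        refine squeeze_zero_norm (fun x => hn x.1 x.2) ?_
        simpa using (((hid n).comp tendsto_fst).mul ((hid n).comp tendsto_snd)).const_mul (n : ℝ)
      · refine fun x => h0.2 fun m => ?_
        obtain ⟨n, hn⟩ := hmul0 m
        refine squeeze_zero_norm (fun y => hn x y) ?_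
        simpa using ((hid n).const_mul (p n x)).const_mul (n : ℝ)
      · refine fun x => h0.2 fun m => ?_
        obtain ⟨n, hn⟩ := hmul0 m
        refine squeeze_zero_norm (fun y => hn y x) ?_
        simpa using ((hid n).mul_const (p n x)).const_mul (n : ℝ)
    infer_instance
  · refine ⟨?_⟩
    refine continuous_of_continuousAt_zero (starAddEquiv : E ≃+ E) ?_
    rw [ContinuousAt, map_zero]
    exact h0.2 fun m => (hid m).congr fun a => (hstar m a).symm

variable (ℓ : ℕ) (q : Param)

/-- The smooth algebra as a ⋆-subalgebra of `A_ℓ(q)`. -/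
noncomputable def smoothSubalgebra : StarSubalgebra ℂ (imageAlgebra ℓ q) :=
  (smoothAlgebra ℓ).comap (imageAlgebra ℓ q).subtype

variable {ℓ q} in
theorem mem_smoothSubalgebra {a : imageAlgebra ℓ q} :
    a ∈ smoothSubalgebra ℓ q ↔ (a : L (Idx ℓ)) ∈ (smoothData ℓ).carrier := Iff.rfl

theorem image_smoothSubalgebra :
    Subtype.val '' (smoothSubalgebra ℓ q : Set (imageAlgebra ℓ q)) = smoothSet ℓ := by
  ext a
  constructor
  · rintro ⟨b, hb, rfl⟩
    exact hb
  · exact fun ha => ⟨⟨a, smooth_subset_imageAlgebra q ℓ ha⟩, ha, rfl⟩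

/-- The smooth algebra contains the ⋆-polynomials in the `Y_k`, which are dense in the image
algebra. -/
theorem dense_smoothSubalgebra : Dense (smoothSubalgebra ℓ q : Set (imageAlgebra ℓ q)) := by
  intro a
  rw [closure_subtype, image_smoothSubalgebra]
  refine closure_mono ?_ (imageAlgebra_subset_closure a.2)
  have h : StarAlgebra.adjoin ℂ (Set.range (Y ℓ q)) ≤ smoothAlgebra ℓ := by
    refine StarAlgebra.adjoin_le ?_
    rintro _ ⟨k, rfl⟩
    exact Y_mem_smooth q ℓ k
  exact h

/-- The seminorms `‖·‖_m` of the smooth algebra. -/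
noncomputable def smoothSeminormFamily : SeminormFamily ℂ (smoothSubalgebra ℓ q) ℕ := fun m =>
  Seminorm.of (fun a => smoothSeminorm ℓ m a.1.1)
    (fun a b => (isGood_smoothData ℓ).complete.add_le m a.2 b.2)
    (fun c a => (isGood_smoothData ℓ).complete.smul_eq m c a.2)

theorem isFrechetStarAlgebra_smooth : IsFrechetStarAlgebra (smoothSeminormFamily ℓ q)
    (Subtype.val : smoothSubalgebra ℓ q → imageAlgebra ℓ q) := by
  have hD := (isGood_smoothData ℓ).complete
  have hle : ∀ a : smoothSubalgebra ℓ q, ‖a.1‖ ≤ smoothSeminormFamily ℓ q 0 a :=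
    fun a => norm_le_seminorm a.2 0
  have hsub : ∀ m (a b : smoothSubalgebra ℓ q), smoothSeminormFamily ℓ q m (a - b) =
      (smoothData ℓ).seminorm m (a.1.1 - b.1.1) := fun _ _ _ => rfl
  refine isFrechetStarAlgebra_of_bounds
    (AddMonoidHomClass.toAddMonoidHom (smoothSubalgebra ℓ q).subtype) hle (fun a ha => ?_)
    (fun m => ?_) (fun m a => (isGood_smoothData ℓ).star_eq m a.2) (fun u hu => ?_)
  · exact Subtype.ext (norm_le_zero_iff.1 ((hle a).trans ha.le))
  · obtain ⟨n, hn⟩ := exists_seminorm_mul_le ℓ m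
    exact ⟨n, fun a b => hn a.1.1 a.2 b.1.1 b.2⟩
  · simp only [hsub] at hu ⊢
    obtain ⟨a, ha, h⟩ := hD.complete (fun n => (u n).1.1) (fun n => (u n).2) hu
    exact ⟨⟨⟨a, smooth_subset_imageAlgebra q ℓ ha⟩, ha⟩, h⟩

end Frechet

/-! ### Contour integrals of the resolvent -/

section Holomorphic

open MeasureTheory

theorem IsPiecewiseC1Loop.continuousOn {γ : ℝ → ℂ} (h : IsPiecewiseC1Loop γ) :
    ContinuousOn γ (Set.Icc 0 1) := by
  obtain ⟨-, N, t, ht, h0, h1, hγ⟩ := h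
  have key : ∀ n : ℕ, ∀ hn : n < N + 1, ContinuousOn γ (Set.Icc 0 (t ⟨n, hn⟩)) := by
    intro n
    induction n with
    | zero =>
      intro hn
      have : t ⟨0, hn⟩ = 0 := h0
      rw [this, Set.Icc_self]
      exact continuousOn_singleton _ _
    | succ n ih =>
      intro hn
      have h2 := (hγ ⟨n, by omega⟩).continuousOn
      have h3 : (0 : ℝ) ≤ t ⟨n, by omega⟩ := h0 ▸ ht.monotone (Fin.zero_le _)
      have h4 : t ⟨n, by omega⟩ ≤ t ⟨n + 1, hn⟩ := ht.monotone (Fin.mk_le_mk.2 n.le_succ)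
      rw [← Set.Icc_union_Icc_eq_Icc h3 h4]
      exact (ih (by omega)).union_of_isClosed h2 isClosed_Icc isClosed_Icc
  have := key N N.lt_succ_self
  rwa [show t ⟨N, N.lt_succ_self⟩ = 1 from h1] at this

variable {ℓ : ℕ} {q : Param}

/-- The resolvent of a smooth element along a curve is a member of the frame. -/
theorem frameMem_resolvent {a : imageAlgebra ℓ q} (ha : a ∈ smoothSubalgebra ℓ q) {γ : ℝ → ℂ}
    (hγ : Continuous γ) (hγ' : ∃ C, ∀ t, ‖γ t‖ ≤ C) (hs : ∀ t, γ t ∉ spectrum ℂ a)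
    (hb : ∃ C, ∀ t, ‖resolvent a (γ t)‖ ≤ C) :
    (frame ℓ).Mem fun t => ((resolvent a (γ t) : imageAlgebra ℓ q) : L (Idx ℓ)) := by
  -- Bounded families yield frame members only over discrete index sets. The constant family is
  -- therefore taken over a point and pulled back to the line.
  have h1 : (frame ℓ).Mem fun _ : ℝ => ((-a : imageAlgebra ℓ q) : L (Idx ℓ)) :=
    ((isBoundedFamily_const (neg_mem ha : -a ∈ smoothSubalgebra ℓ q)).frameMem ℓ).comp
      (f := fun _ : ℝ => ()) continuous_const
  have h2 := (Frame.Mem.scalar (F := frame ℓ) hγ hγ').add h1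
  have h3 : ∀ t, IsUnit (algebraMap ℂ (imageAlgebra ℓ q) (γ t) - a) := fun t => by
    simpa [spectrum.mem_iff] using hs t
  have h4 : ∀ t, (γ t • (1 : L (Idx ℓ)) + ((-a : imageAlgebra ℓ q) : L (Idx ℓ))) =
      ((algebraMap ℂ (imageAlgebra ℓ q) (γ t) - a : imageAlgebra ℓ q) : L (Idx ℓ)) := fun t => by
    rw [Algebra.algebraMap_eq_smul_one, sub_eq_add_neg]
    rfl
  refine h2.inv (frame_good ℓ) (fun t => ?_) (fun t => ?_) ⟨?_, hb⟩
  · rw [h4]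
    exact congrArg Subtype.val (Ring.mul_inverse_cancel _ (h3 t))
  · rw [h4]
    exact congrArg Subtype.val (Ring.inverse_mul_cancel _ (h3 t))
  · refine continuous_subtype_val.comp (continuous_iff_continuousAt.2 fun t => ?_)
    exact ContinuousAt.comp (g := resolvent a)
      (spectrum.hasDerivAt_resolvent_const_left (not_not.1 (hs t))).continuousAt hγ.continuousAt

/-- Clamping the parameter to `[0, 1]` turns the resolvent along the curve into a bounded continuous
family on the whole line. It satisfies the frame, and hence so does its average against the
integrable weight `g`, a family over a point. -/
theorem integral_resolvent_mem {a : imageAlgebra ℓ q} (ha : a ∈ smoothSubalgebra ℓ q) {γ : ℝ → ℂ}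
    (hγ : ContinuousOn γ (Set.Icc 0 1)) (hs : ∀ t ∈ Set.Icc (0 : ℝ) 1, γ t ∉ spectrum ℂ a)
    {g : ℝ → ℂ} (hg : IntervalIntegrable g volume 0 1) :
    ∫ t in (0 : ℝ)..1, g t • resolvent a (γ t) ∈ smoothSubalgebra ℓ q := by
  let σ : ℝ → ℝ := fun t => Set.projIcc (0 : ℝ) 1 zero_le_one t
  have hσ : ∀ t, σ t ∈ Set.Icc (0 : ℝ) 1 := fun t => Subtype.coe_prop _
  have hσc : Continuous σ := continuous_subtype_val.comp continuous_projIcc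
  have hσe : ∀ t ∈ Set.Icc (0 : ℝ) 1, σ t = t := fun t ht =>
    congrArg Subtype.val (Set.projIcc_of_mem zero_le_one ht)
  have hc : Continuous fun t => γ (σ t) := hγ.comp_continuous hσc hσ
  have hr : ContinuousOn (fun t => resolvent a (γ t)) (Set.Icc 0 1) := fun t ht =>
    ContinuousAt.comp_continuousWithinAt (g := resolvent a)
      (spectrum.hasDerivAt_resolvent_const_left (not_not.1 (hs t ht))).continuousAt (hγ t ht)
  obtain ⟨C₁, hC₁⟩ := isCompact_Icc.exists_bound_of_continuousOn hγ
  obtain ⟨C₂, hC₂⟩ := isCompact_Icc.exists_bound_of_continuousOn hr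
  have hmem := frameMem_resolvent ha hc ⟨C₁, fun t => hC₁ _ (hσ t)⟩ (fun t => hs _ (hσ t))
    ⟨C₂, fun t => hC₂ _ (hσ t)⟩
  have havg := ((hmem.comp (K' := Unit × ℝ) continuous_snd).average
    ((intervalIntegrable_iff_integrableOn_Ioc_of_le zero_le_one).1 hg)).isBoundedFamily ℓ
  have h1 := havg.1 ()
  rw [mem_smoothSubalgebra]
  have h2 : IntervalIntegrable (fun t => g t • resolvent a (γ t)) volume 0 1 := by
    refine hg.smul_continuousOn ?_
    rwa [Set.uIcc_of_le zero_le_one]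
  let j : imageAlgebra ℓ q →L[ℂ] L (Idx ℓ) :=
    (Subalgebra.toSubmodule (imageAlgebra ℓ q).toSubalgebra).subtypeL
  have h3 := j.intervalIntegral_comp_comm h2
  change j (∫ t in (0 : ℝ)..1, g t • resolvent a (γ t)) ∈ _
  rw [← h3, intervalIntegral.integral_of_le zero_le_one]
  convert h1 using 1
  refine setIntegral_congr_fun measurableSet_Ioc fun t ht => ?_
  change _ = g t • ((resolvent a (γ (σ t)) : imageAlgebra ℓ q) : L (Idx ℓ))
  rw [hσe t (Set.Ioc_subset_Icc_self ht)]
  rfl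

/-- Inside each piece `deriv γ` agrees with the one-piece derivative, which is continuous up to the
ends; the endpoints form a null set. -/
theorem IsPiecewiseC1Loop.intervalIntegrable_deriv {γ : ℝ → ℂ} (h : IsPiecewiseC1Loop γ) :
    IntervalIntegrable (deriv γ) volume 0 1 := by
  obtain ⟨-, N, t, ht, h0, h1, hγ⟩ := h
  have key : ∀ n : ℕ, ∀ hn : n < N + 1, IntervalIntegrable (deriv γ) volume 0 (t ⟨n, hn⟩) := by
    intro n
    induction n with
    | zero =>
      intro hn
      have : t ⟨0, hn⟩ = 0 := h0
      rw [this]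
    | succ n ih =>
      intro hn
      have h4 : t ⟨n, by omega⟩ < t ⟨n + 1, hn⟩ := ht (Fin.mk_lt_mk.2 n.lt_succ_self)
      refine (ih (by omega)).trans ?_
      have h2 := (hγ ⟨n, by omega⟩).continuousOn_derivWithin (uniqueDiffOn_Icc h4) le_rfl
      have h3 : IntervalIntegrable (derivWithin γ (Set.Icc (t ⟨n, by omega⟩) (t ⟨n + 1, hn⟩)))
          volume (t ⟨n, by omega⟩) (t ⟨n + 1, hn⟩) := by
        refine ContinuousOn.intervalIntegrable ?_
        rw [Set.uIcc_of_le h4.le]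
        exact h2
      rw [intervalIntegrable_iff_integrableOn_Ioo_of_le h4.le] at h3 ⊢
      refine h3.congr_fun (fun s hs => ?_) measurableSet_Ioo
      exact derivWithin_of_mem_nhds (Icc_mem_nhds hs.1 hs.2)
  have := key N N.lt_succ_self
  rwa [show t ⟨N, N.lt_succ_self⟩ = 1 from h1] at this

theorem isClosedUnderHolomorphicCalculus_smooth (ℓ : ℕ) (q : Param) :
    IsClosedUnderHolomorphicCalculus (smoothSubalgebra ℓ q : Set (imageAlgebra ℓ q)) := by
  rintro a ha f b ⟨U, -, -, hf, n, Γ, ⟨hΓ, hΓU, -, -⟩, rfl⟩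
  refine SMulMemClass.smul_mem (s := smoothSubalgebra ℓ q) _ (sum_mem fun i _ => ?_)
  have hc := (hΓ i).continuousOn
  have hfc : ContinuousOn (fun t => f (Γ i t)) (Set.uIcc 0 1) := by
    rw [Set.uIcc_of_le zero_le_one]
    exact hf.continuousOn.comp hc fun t ht => (hΓU i t ht).1
  have := integral_resolvent_mem ha hc (fun t ht => (hΓU i t ht).2)
    ((hΓ i).intervalIntegrable_deriv.mul_continuousOn hfc)
  simpa only [smul_smul] using this

end Holomorphic

end QuantumSphere

theorem mainTheorem4 (ℓ : ℕ) (q : QuantumSphere.Param) :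
    ∃ 𝒮 : StarSubalgebra ℂ (QuantumSphere.imageAlgebra ℓ q),
      Subtype.val '' (𝒮 : Set (QuantumSphere.imageAlgebra ℓ q)) = QuantumSphere.smoothSet ℓ ∧
      Dense (𝒮 : Set (QuantumSphere.imageAlgebra ℓ q)) ∧
      (∃ p : SeminormFamily ℂ 𝒮 ℕ,
        (∀ (m : ℕ) (a : 𝒮), p m a = QuantumSphere.smoothSeminorm ℓ m a.1.1) ∧
        QuantumSphere.IsFrechetStarAlgebra p
          (Subtype.val : 𝒮 → QuantumSphere.imageAlgebra ℓ q)) ∧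
      QuantumSphere.IsClosedUnderHolomorphicCalculus
        (𝒮 : Set (QuantumSphere.imageAlgebra ℓ q)) ∧
      ∀ k : Fin (ℓ + 1), QuantumSphere.Y ℓ q k ∈ QuantumSphere.smoothSet ℓ :=
  ⟨QuantumSphere.smoothSubalgebra ℓ q, QuantumSphere.image_smoothSubalgebra ℓ q,
    QuantumSphere.dense_smoothSubalgebra ℓ q,
    ⟨QuantumSphere.smoothSeminormFamily ℓ q, fun _ _ => rfl,
      QuantumSphere.isFrechetStarAlgebra_smooth ℓ q⟩,
    QuantumSphere.isClosedUnderHolomorphicCalculus_smooth ℓ q, QuantumSphere.Y_mem_smooth q ℓ⟩
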